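/- **Setting.** Let $\Sigma,\Pi$ be alphabets. Positions in strings are counted from $1$; $X[i]$ is a symbol, and $X[i:j]$ is a substring (empty if $i>j$). A *substring consistent equivalence relation* (SCER) is an equivalence relation $\approx$ on $\Sigma^*$ such that $X\approx Y$ implies $|X|=|Y|$ and $X[i:j]\approx Y[i:j]$ for all $1\le i\le j\le|X|$. A function $f:\Sigma^*\to\Pi^*$, written $f(X)=\widetilde X$, is a *$\approx$-encoding* if (1) $|X|=|\widetilde X|$; (2) $f(X[1:i])=\widetilde X[1:i]$; (3) for $|X|=|Y|$ and $j<i\le|X|$, $\widetilde X[i]=\widetilde Y[i]$ implies $f(X[j+1:|X|])[i-j]=f(Y[j+1:|Y|])[i-j]$; (4) $\widetilde X=\widetilde Y$ iff $X\approx Y$. Write $\widetilde X_x[i]=f(X[x:|X|])[i]$. Let $P$ (pattern) and $T$ (text) be strings with $m=|P|\ge 2$ and $n=|T|\ge m$. A position $i$, $1\le i\le n-m+1$, is an *$\approx$-occurrence* of $P$ in $T$ if $P\approx T[i:i+m-1]$. For $0\le a<m$ let $\mathcal W_P(a)=\{w : 1\le w\le m-a,\ \widetilde P_{a+1}[w]\ne\widetilde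 P[w]\}$. A *witness table* is an array $W[0:m-1]$ with $W[a]\in\mathcal W_P(a)$ if $\mathcal W_P(a)\neq\emptyset$, and $W[a]=0$ otherwise. **Machine and input.** The machine is a Priority CRCW PRAM: synchronous processors share a memory, concurrent reads are allowed, and on a write conflict the processor of smallest index succeeds. Time is the number of parallel steps, and work is the total number of operations of all active processors. Given $\widetilde X$, re-encoding one element, i.e. computing $\widetilde X_x[i]$, takes $\xi^{t}_{|X|}\ge1$ time and $\xi^{w}_{|X|}\ge1$ work, where $\xi^t_\ell\le K\xi^t_m$ and $\xi^w_\ell\le K\xi^w_m$ for all $m\le\ell\le 2m-1$, with a constant $K$. The text is cut into the overlapping pieces $T[qm+1:\min(qm+2m-1,n)]$, $0\le q\le\lfloor (n-1)/m\rfloor$, which are processed independently. The input consists of $m$, $n$, $\widetilde P$, the encoding of every piece (for $n\le 2m-1$ the first piece is $T$ itself), and a witness table $W$ of $P$. **Algorithm (duel-and-sweep pattern search)**, for each piece; below $T$ is the piece and $T_x=T[x:x+m-1]$ for its candidate positions $x$. *Dueling stage.* Start with the one-element lists $\{x\}$, $1\le x\le m$ (empty if $x$ is not a candidate position). In rounds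 $k=1,\dots,\lceil\log_2 m\rceil$, merge in parallel the sorted lists $\mathcal A,\mathcal B$ of neighbouring blocks of size $2^{k-1}$, each merge on one processor. For $x\in\mathcal A$, $y\in\mathcal B$ put $G[x][y]=0$ if $W[y-x]=0$; otherwise, with $w=W[y-x]$, put $G[x][y]=1$ ($y$ wins the duel) if $\widetilde T_y[w]=\widetilde P[w]$, and $G[x][y]=-1$ ($x$ wins) if not. A binary search over the rows $0,\dots,|\mathcal A|+1$ with current bounds $l,r$ inspects the middle row by a binary search for its first $0$, stopped as soon as a $1$ is seen; if a $1$ was seen, the middle row becomes $r$, otherwise it becomes $l$. When $r=l+1$, let $b$ be the first column with $G=0$ in row $l$, found by binary search ($b=1$ if $l=0$; $b=|\mathcal B|+1$ if there is none). The merged list is $\mathcal A[1:l]$ followed by $\mathcal B[b:|\mathcal B|]$. After the last round set $C[x]=\mathit{True}$ for the members of the final list and $C[x]=\mathit{False}$ otherwise. *Sweeping stage.* Set $R[x]=0$ for all $x$. For $k=\lceil\log_2 m\rceil,\dots,1,0$, partition $\{1,\dots,m\}$ into consecutive blocks of size $2^k$. In every block let $x$ be the least position in its second half (in the whole block if $k=0$)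 with $C[x]=\mathit{True}$, if there is one. For all these $x$ in parallel, compare $\widetilde P[i]$ with $\widetilde T_x[i]$ for all $R[x]<i\le m$ in parallel, and set $R[x]$ to $i_0-1$, where $i_0$ is the first $i$ at which they differ, or to $m$ if there is none. Then for all positions $i$ of the block in parallel: if $i\le x$ and $R[x]\le m-(x-i)-1$, set $C[i]=\mathit{False}$; if $i\ge x$ and $C[i]=\mathit{True}$, set $R[i]=\max(0,R[x]-(i-x))$. **Theorem.** For every $K$ there is a constant $c$, depending only on $K$, such that for every SCER $\approx$, every $\approx$-encoding, all $P$, $T$, every witness table $W$ of $P$ and all costs $\xi^t,\xi^w$ as above, this algorithm, as a program for the Priority CRCW PRAM, halts, and * its output is exactly the set of $\approx$-occurrences: for $1\le i\le n-m+1$, the Boolean entry for text position $i$ is $\mathit{True}$ if and only if $i$ is an $\approx$-occurrence of $P$ in $T$; * it takes at most $c\,\xi^t_m\log^3 m$ time and at most $c\,\xi^w_m\, n\log^2 m$ work. -/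

import Mathlib

namespace DuelSweep

/-! ## Strings, substring consistent equivalence relations, encodings -/

/-- The `i`-th symbol `X[i]` of a string, positions counted from 1 (`none` outside `1, …, |X|`). -/
def sym {α : Type*} (X : List α) (i : ℕ) : Option α :=
  if i = 0 then none else X[i - 1]?

/-- The substring `X[i : j]`, positions counted from 1; it is empty when `i > j`. -/
def substr {α : Type*} (X : List α) (i j : ℕ) : List α :=
  (X.drop (i - 1)).take (j + 1 - i)

/-- Substring consistent equivalence relation. -/
structure IsSCER {α : Type*} (rel : List α → List α → Prop) : Prop where
  equiv : Equivalence rel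
  length_eq : ∀ X Y, rel X Y → X.length = Y.length
  substr_rel : ∀ X Y, rel X Y → ∀ i j, 1 ≤ i → i ≤ j → j ≤ X.length →
    rel (substr X i j) (substr Y i j)

/-- `f` is an encoding for the equivalence relation `rel`. -/
structure IsEncoding {α β : Type*} (rel : List α → List α → Prop) (f : List α → List β) :
    Prop where
  length_eq : ∀ X, X.length = (f X).length
  prefix_eq : ∀ X i, i ≤ X.length → f (substr X 1 i) = substr (f X) 1 i
  suffix_eq : ∀ X Y, X.length = Y.length → ∀ j i, j < i → i ≤ X.length →
    sym (f X) i = sym (f Y) i →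
      sym (f (substr X (j + 1) X.length)) (i - j) = sym (f (substr Y (j + 1) Y.length)) (i - j)
  eq_iff : ∀ X Y, f X = f Y ↔ rel X Y

/-- Position `i` is an occurrence of `P` in `T`. -/
def IsOccurrence {α : Type*} (rel : List α → List α → Prop) (P T : List α) (i : ℕ) : Prop :=
  1 ≤ i ∧ i + P.length ≤ T.length + 1 ∧ rel P (substr T i (i + P.length - 1))

/-- The set of all witnesses for the offset `a`: the positions `w` of the overlap at which the
encoding of `P[a + 1 : m]` differs from the encoding of `P`. -/
def witnesses {α β : Type*} (f : List α → List β) (P : List α) (a : ℕ) : Set ℕ :=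
  {w | 1 ≤ w ∧ w + a ≤ P.length ∧ sym (f (substr P (a + 1) P.length)) w ≠ sym (f P) w}

/-- `W[0 : m - 1]` is a witness table of `P`; the entry `0` says that there is no witness. -/
def IsWitnessTable {α β : Type*} (f : List α → List β) (P : List α) (W : ℕ → ℕ) : Prop :=
  ∀ a, a < P.length →
    ((witnesses f P a).Nonempty → W a ∈ witnesses f P a) ∧ (witnesses f P a = ∅ → W a = 0)

open Classical in
/-- Re-encoding: computes, from the encoding `Y = f X` alone, the symbol at position `i` of the
encoding of the suffix `X[x : |X|]`. (For an encoding of an SCER the result does not depend on the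
string `X` that is chosen with `f X = Y`.) -/
noncomputable def reencode {α β : Type*} (f : List α → List β) (Y : List β) (x i : ℕ) :
    Option β :=
  if h : ∃ X, f X = Y then sym (f (substr h.choose x h.choose.length)) i else none

/-! ## The priority CRCW PRAM

Synchronous processors with private registers share a memory. All processors run one program in
lock step, and a processor whose branch or loop condition excludes it is idle. In each
step the active processors first read and evaluate, then write; if several processors
write to one cell, the processor with the smallest index succeeds. `par` starts one new processor
per element of an index range and waits for all of them (work-time presentation). -/

/-- Registers holding numbers. -/
inductive Reg
  | n | m | q | base | x | i | j | b | s | h | bs | la | lb | l1 | r1 | l2 | r2 | m1 | m2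
  | obs | w | rx
  deriving DecidableEq

/-- Registers holding symbols of the encoding alphabet. -/
inductive SReg
  | c | d
  deriving DecidableEq

/-- Arrays of the shared memory. -/
inductive Arr
  | W | D | Len | C | R | Cand | Wit
  deriving DecidableEq

/-- Arithmetic operations and comparisons (with result `0` or `1`) on natural numbers;
subtraction is truncated. -/
inductive BinOp
  | add | sub | mul | div | mod | le | lt | eq

def BinOp.eval : BinOp → ℕ → ℕ → ℕ
  | .add, a, b => a + b
  | .sub, a, b => a - b
  | .mul, a, b => a * b
  | .div, a, b => a / b
  | .mod, a, b => a % b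
  | .le, a, b => if a ≤ b then 1 else 0
  | .lt, a, b => if a < b then 1 else 0
  | .eq, a, b => if a = b then 1 else 0

/-- Expressions: constants, registers, cells of the shared memory, operations, and the test whether
two symbol registers are equal. -/
inductive Expr
  | lit (k : ℕ)
  | reg (r : Reg)
  | ld (A : Arr) (a : Expr)
  | op (o : BinOp) (a b : Expr)
  | symEq (s t : SReg)

/-- Number of elementary operations in the evaluation of an expression. -/
def Expr.size : Expr → ℕ
  | .lit _ => 1
  | .reg _ => 1
  | .ld _ a => a.size + 1
  | .op _ a b => a.size + b.size + 1
  | .symEq _ _ => 1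

/-- Programs. -/
inductive Cmd
  /-- `r ← e` -/
  | assign (r : Reg) (e : Expr)
  /-- `A[a] ⇐ e` -/
  | store (A : Arr) (a e : Expr)
  /-- `s ←` the `i`-th symbol of the encoded input string number `k` -/
  | loadSym (s : SReg) (k i : Expr)
  /-- `s ←` the symbol at position `i` of the encoded input string number `k`, re-encoded with
  respect to the suffix that starts at position `x` -/
  | reenc (s : SReg) (k x i : Expr)
  | seq (c₁ c₂ : Cmd)
  | ite (e : Expr) (c₁ c₂ : Cmd)
  | skip
  | loop (e : Expr) (c : Cmd)
  /-- for each `r ∈ {lo, …, hi}` in parallel do `c` -/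
  | par (r : Reg) (lo hi : Expr) (c : Cmd)

/-- A processor is identified by the indices of the nested parallel loops that started it, the
outermost first; processors are ordered lexicographically. -/
abbrev Proc := List ℕ

/-- Shared memory, number registers and symbol registers of the processors. -/
structure State (β : Type*) where
  mem : Arr → ℕ → ℕ
  reg : Proc → Reg → ℕ
  sreg : Proc → SReg → Option β

open Classical in
/-- Value of an expression for processor `p`. -/
noncomputable def State.eval {β : Type*} (σ : State β) (p : Proc) : Expr → ℕ
  | .lit k => k
  | .reg r => σ.reg p r
  | .ld A a => σ.mem A (σ.eval p a)
  | .op o a b => o.eval (σ.eval p a) (σ.eval p b)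
  | .symEq s t => if σ.sreg p s = σ.sreg p t then 1 else 0

/-- What the machine is given: the encoded input strings (read only), the re-encoding operation,
and the time and the work of one re-encoding as functions of the length of the string. -/
structure Input (β : Type*) where
  str : ℕ → List β
  re : List β → ℕ → ℕ → Option β
  ξt : ℕ → ℕ
  ξw : ℕ → ℕ

/-- Each processor in `S` sets its register `r` to `v`. -/
def State.setReg {β : Type*} (σ : State β) (S : Finset Proc) (r : Reg) (v : Proc → ℕ) :
    State β :=
  { σ with reg := fun p r' => if p ∈ S ∧ r' = r then v p else σ.reg p r' }

/-- Each processor in `S` sets its symbol register `s` to `v`. -/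
def State.setSReg {β : Type*} (σ : State β) (S : Finset Proc) (s : SReg)
    (v : Proc → Option β) : State β :=
  { σ with sreg := fun p s' => if p ∈ S ∧ s' = s then v p else σ.sreg p s' }

/-- Each processor `p` in `S` writes `v p` into `A[a p]`. On a conflict the smallest processor
succeeds. -/
def State.write {β : Type*} (σ : State β) (S : Finset Proc) (A : Arr) (a v : Proc → ℕ) :
    State β :=
  { σ with
    mem := fun A' k =>
      if h : A' = A ∧ (S.filter (fun p => a p = k)).Nonempty
      then v (Finset.min' (S.filter (fun p => a p = k)) h.2)
      else σ.mem A' k }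

/-- The processors started by those in `S` over the index ranges `{lo p, …, hi p}`. -/
def children (S : Finset Proc) (lo hi : Proc → ℕ) : Finset Proc :=
  S.biUnion (fun p => (Finset.Icc (lo p) (hi p)).image (fun k => p ++ [k]))

/-- Each new processor in `S'` inherits the registers of the processor that started it, and finds
its own index in register `r`. -/
def State.fork {β : Type*} (σ : State β) (S' : Finset Proc) (r : Reg) : State β :=
  { σ with
    reg := fun p r' =>
      if p ∈ S' then (if r' = r then p.getLast?.getD 0 else σ.reg p.dropLast r') else σ.reg p r'
    sreg := fun p s => if p ∈ S' then σ.sreg p.dropLast s else σ.sreg p s }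

/-- The processors in `S` for which `e` is true (not zero). -/
noncomputable def State.sel {β : Type*} (σ : State β) (S : Finset Proc) (e : Expr) :
    Finset Proc :=
  S.filter (fun p => σ.eval p e ≠ 0)

/-- The processors in `S` for which `e` is false (zero). -/
noncomputable def State.unsel {β : Type*} (σ : State β) (S : Finset Proc) (e : Expr) :
    Finset Proc :=
  S.filter (fun p => σ.eval p e = 0)

/-- `Exec I c S σ σ' t w`: the program `c`, run synchronously by the processors in `S` from the
state `σ`, halts in the state `σ'` after `t` time units, and all processors together have performed
`w` operations (the work). -/
inductive Exec {β : Type*} (I : Input β) :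
    Cmd → Finset Proc → State β → State β → ℕ → ℕ → Prop
  | assign (r : Reg) (e : Expr) (S : Finset Proc) (σ : State β) :
      Exec I (.assign r e) S σ (σ.setReg S r (fun p => σ.eval p e))
        (e.size + 1) (S.card * (e.size + 1))
  | store (A : Arr) (a e : Expr) (S : Finset Proc) (σ : State β) :
      Exec I (.store A a e) S σ (σ.write S A (fun p => σ.eval p a) (fun p => σ.eval p e))
        (a.size + e.size + 1) (S.card * (a.size + e.size + 1))
  | loadSym (s : SReg) (k i : Expr) (S : Finset Proc) (σ : State β) :
      Exec I (.loadSym s k i) S σ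
        (σ.setSReg S s (fun p => sym (I.str (σ.eval p k)) (σ.eval p i)))
        (k.size + i.size + 1) (S.card * (k.size + i.size + 1))
  | reenc (s : SReg) (k x i : Expr) (S : Finset Proc) (σ : State β) :
      Exec I (.reenc s k x i) S σ
        (σ.setSReg S s (fun p => I.re (I.str (σ.eval p k)) (σ.eval p x) (σ.eval p i)))
        (k.size + x.size + i.size + 1 + S.sup (fun p => I.ξt (I.str (σ.eval p k)).length))
        (S.card * (k.size + x.size + i.size + 1) +
          ∑ p ∈ S, I.ξw (I.str (σ.eval p k)).length)
  | seq (c₁ c₂ : Cmd) (S : Finset Proc) (σ σ₁ σ₂ : State β) (t₁ w₁ t₂ w₂ : ℕ) :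
      Exec I c₁ S σ σ₁ t₁ w₁ → Exec I c₂ S σ₁ σ₂ t₂ w₂ →
      Exec I (.seq c₁ c₂) S σ σ₂ (t₁ + t₂) (w₁ + w₂)
  | ite (e : Expr) (c₁ c₂ : Cmd) (S : Finset Proc) (σ σ₁ σ₂ : State β) (t₁ w₁ t₂ w₂ : ℕ) :
      Exec I c₁ (σ.sel S e) σ σ₁ t₁ w₁ → Exec I c₂ (σ.unsel S e) σ₁ σ₂ t₂ w₂ →
      Exec I (.ite e c₁ c₂) S σ σ₂ (e.size + 1 + t₁ + t₂) (S.card * (e.size + 1) + w₁ + w₂)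
  | skip (S : Finset Proc) (σ : State β) : Exec I .skip S σ σ 1 S.card
  | loopDone (e : Expr) (c : Cmd) (S : Finset Proc) (σ : State β) :
      σ.sel S e = ∅ → Exec I (.loop e c) S σ σ (e.size + 1) (S.card * (e.size + 1))
  | loopStep (e : Expr) (c : Cmd) (S : Finset Proc) (σ σ₁ σ₂ : State β) (t₁ w₁ t₂ w₂ : ℕ) :
      (σ.sel S e).Nonempty → Exec I c (σ.sel S e) σ σ₁ t₁ w₁ →
      Exec I (.loop e c) (σ.sel S e) σ₁ σ₂ t₂ w₂ →
      Exec I (.loop e c) S σ σ₂ (e.size + 1 + t₁ + t₂) (S.card * (e.size + 1) + w₁ + w₂)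
  | par (r : Reg) (lo hi : Expr) (c : Cmd) (S S' : Finset Proc) (σ σ₁ : State β) (t₁ w₁ : ℕ) :
      S' = children S (fun p => σ.eval p lo) (fun p => σ.eval p hi) →
      Exec I c S' (σ.fork S' r) σ₁ t₁ w₁ →
      Exec I (.par r lo hi c) S σ σ₁ (lo.size + hi.size + 1 + t₁)
        (S.card * (lo.size + hi.size + 1) + S'.card + w₁)

/-- The outcome, the time and the work of a run are determined by the program and the initial
state. -/
theorem Exec.deterministic {β : Type*} {I : Input β} {c : Cmd} {S : Finset Proc}
    {σ σ₁ σ₂ : State β} {t₁ w₁ t₂ w₂ : ℕ}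
    (h₁ : Exec I c S σ σ₁ t₁ w₁) (h₂ : Exec I c S σ σ₂ t₂ w₂) :
    σ₁ = σ₂ ∧ t₁ = t₂ ∧ w₁ = w₂ := by
  induction h₁ generalizing σ₂ t₂ w₂ with
  | assign => cases h₂; simp
  | store => cases h₂; simp
  | loadSym => cases h₂; simp
  | reenc => cases h₂; simp
  | skip => cases h₂; simp
  | seq _ _ _ _ _ _ _ _ _ _ _ _ ih₁ ih₂ =>
    cases h₂ with
    | seq _ _ _ _ _ _ _ _ _ _ k₁ k₂ =>
      obtain ⟨rfl, rfl, rfl⟩ := ih₁ k₁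
      obtain ⟨rfl, rfl, rfl⟩ := ih₂ k₂
      simp
  | ite _ _ _ _ _ _ _ _ _ _ _ _ _ ih₁ ih₂ =>
    cases h₂ with
    | ite _ _ _ _ _ _ _ _ _ _ _ k₁ k₂ =>
      obtain ⟨rfl, rfl, rfl⟩ := ih₁ k₁
      obtain ⟨rfl, rfl, rfl⟩ := ih₂ k₂
      simp
  | loopDone _ _ _ _ he =>
    cases h₂ with
    | loopDone => simp
    | loopStep _ _ _ _ _ _ _ _ _ _ hne => simp [he] at hne
  | loopStep _ _ _ _ _ _ _ _ _ _ hne _ _ ih₁ ih₂ =>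
    cases h₂ with
    | loopDone _ _ _ _ he => simp [he] at hne
    | loopStep _ _ _ _ _ _ _ _ _ _ _ k₁ k₂ =>
      obtain ⟨rfl, rfl, rfl⟩ := ih₁ k₁
      obtain ⟨rfl, rfl, rfl⟩ := ih₂ k₂
      simp
  | par _ _ _ _ _ _ _ _ _ _ hS _ ih₁ =>
    cases h₂ with
    | par _ _ _ _ _ _ _ _ _ _ kS k₁ =>
      subst hS kS
      obtain ⟨rfl, rfl, rfl⟩ := ih₁ k₁
      simp

/-! ## Notation for programs -/

instance (k : ℕ) : OfNat Expr k := ⟨.lit k⟩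
instance : Coe Reg Expr := ⟨.reg⟩
instance : Add Expr := ⟨.op .add⟩
instance : Sub Expr := ⟨.op .sub⟩
instance : Mul Expr := ⟨.op .mul⟩
instance : Div Expr := ⟨.op .div⟩
instance : Mod Expr := ⟨.op .mod⟩

infix:50 " ≤ₑ " => Expr.op BinOp.le
infix:50 " <ₑ " => Expr.op BinOp.lt
infix:50 " =ₑ " => Expr.op BinOp.eq
infixr:35 " ∧ₑ " => Expr.op BinOp.mul
infix:25 " ≔ " => Cmd.assign
infixr:20 " ;; " => Cmd.seq

/-! ## The duel-and-sweep pattern search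

The text is cut into the overlapping pieces `T[qm + 1 : qm + 2m - 1]`, `q = 0, …, ⌊(n - 1) / m⌋`
(shorter at the end of the text), which are processed independently. Input string `0` is the
encoding of the pattern, and input string `q + 1` is the encoding of piece `q`. Candidate position
`x ∈ {1, …, m}` of piece `q` belongs to the cell `qm + x` of the arrays `C` and `R`. -/

/-- Merge of two consistent lists `𝒜 = D[s + 1 : s + la]` and `ℬ = D[s + h + 1 : s + h + lb]` of
candidate positions, on a single processor: `𝒜[1 : l1]` and `ℬ[r2 : lb]` survive.
A duel between `𝒜[m1]` and `ℬ[m2]` with witness `w` is won by `ℬ[m2]` iff the symbols at position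
`w` of the encodings of the pattern and of the text from `ℬ[m2]` on agree. -/
def merge : Cmd :=
  (.l1 ≔ 0) ;;
  (.r1 ≔ Reg.la + 1) ;;
  .loop (Reg.l1 + 1 <ₑ Reg.r1) (
    (.m1 ≔ (Reg.l1 + Reg.r1) / 2) ;;
    (.obs ≔ 0) ;;
    (.l2 ≔ 0) ;;
    (.r2 ≔ Reg.lb + 1) ;;
    .loop ((Reg.l2 + 1 <ₑ Reg.r2) ∧ₑ (Reg.obs =ₑ 0)) (
      (.m2 ≔ (Reg.l2 + Reg.r2) / 2) ;;
      (.w ≔ .ld .W (.ld .D (Reg.s + Reg.h + Reg.m2) - .ld .D (Reg.s + Reg.m1))) ;;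
      .ite (Reg.w =ₑ 0)
        (.r2 ≔ Reg.m2)
        (.loadSym .c 0 Reg.w ;;
         .reenc .d (Reg.q + 1) (.ld .D (Reg.s + Reg.h + Reg.m2)) Reg.w ;;
         .ite (.symEq .c .d) (.obs ≔ 1) (.l2 ≔ Reg.m2))) ;;
    .ite Reg.obs (.r1 ≔ Reg.m1) (.l1 ≔ Reg.m1)) ;;
  (.l2 ≔ 0) ;;
  (.r2 ≔ Reg.lb + 1) ;;
  .loop (Reg.l2 + 1 <ₑ Reg.r2) (
    (.m2 ≔ (Reg.l2 + Reg.r2) / 2) ;;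
    .ite (Reg.l1 =ₑ 0)
      (.r2 ≔ Reg.m2)
      (.ite (.ld .W (.ld .D (Reg.s + Reg.h + Reg.m2) - .ld .D (Reg.s + Reg.l1)) =ₑ 0)
        (.r2 ≔ Reg.m2) (.l2 ≔ Reg.m2)))

/-- Dueling stage for one piece. When the blocks have size `h`, the sorted list of the surviving
candidates of block `j` is `D[s + 1 : s + Len[s]]` with `s = base + (j - 1) h`. Round `h` merges the
blocks `2j - 1` and `2j` of size `h` for all `j` in parallel. Initially the list of block `{x}` is
`x` alone, and it is empty if the position `x` is no candidate because the text ends too early.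
At the end, `h` is the least power of two with `m ≤ h`. -/
def duelingStage : Cmd :=
  .par .x 1 Reg.m (
    .store .D (Reg.base + Reg.x) Reg.x ;;
    .store .Len (Reg.base + Reg.x - 1) (Reg.base + Reg.x + Reg.m ≤ₑ Reg.n + 1)) ;;
  (.h ≔ 1) ;;
  .loop (Reg.h <ₑ Reg.m) (
    .par .j 1 ((Reg.m + 2 * Reg.h - 1) / (2 * Reg.h)) (
      (.s ≔ Reg.base + (Reg.j - 1) * (2 * Reg.h)) ;;
      (.la ≔ .ld .Len Reg.s) ;;
      .ite ((Reg.j - 1) * (2 * Reg.h) + Reg.h <ₑ Reg.m)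
        (.lb ≔ .ld .Len (Reg.s + Reg.h))
        (.lb ≔ 0) ;;
      merge ;;
      .par .i Reg.r2 Reg.lb (
        .store .D (Reg.s + Reg.l1 + (Reg.i - Reg.r2) + 1) (.ld .D (Reg.s + Reg.h + Reg.i))) ;;
      .store .Len Reg.s (Reg.l1 + (Reg.lb + 1 - Reg.r2))) ;;
    (.h ≔ 2 * Reg.h)) ;;
  .par .x 1 Reg.m (.store .C (Reg.base + Reg.x) 0) ;;
  .par .i 1 (.ld .Len Reg.base) (.store .C (Reg.base + .ld .D (Reg.base + Reg.i)) 1)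

/-- Sweeping stage for one piece, with blocks of size `bs = 2 ^ ⌈log m⌉, …, 4, 2, 1`. The entry
`Cand[base + b]` is the least surviving candidate in the second half of the `b`-th block, or `0` if
there is none; a block of size one is its own second half. For it, `R` becomes the length of the
longest matching prefix, computed by comparing all remaining positions in parallel. -/
def sweepingStage : Cmd :=
  .par .x 1 Reg.m (.store .R (Reg.base + Reg.x) 0) ;;
  (.bs ≔ Reg.h) ;;
  .loop (0 <ₑ Reg.bs) (
    .par .b 1 ((Reg.m + Reg.bs - 1) / Reg.bs) (.store .Cand (Reg.base + Reg.b) 0) ;;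
    .par .x 1 Reg.m (
      .ite ((.ld .C (Reg.base + Reg.x) =ₑ 1) ∧ₑ (Reg.bs / 2 ≤ₑ (Reg.x - 1) % Reg.bs))
        (.store .Cand (Reg.base + ((Reg.x - 1) / Reg.bs + 1)) Reg.x)
        .skip) ;;
    .par .b 1 ((Reg.m + Reg.bs - 1) / Reg.bs) (
      (.x ≔ .ld .Cand (Reg.base + Reg.b)) ;;
      .ite Reg.x
        ((.rx ≔ .ld .R (Reg.base + Reg.x)) ;;
         .store .Wit (Reg.base + Reg.b) 0 ;;
         .par .i (Reg.rx + 1) Reg.m (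
           .loadSym .c 0 Reg.i ;;
           .reenc .d (Reg.q + 1) Reg.x Reg.i ;;
           .ite (.symEq .c .d) .skip (.store .Wit (Reg.base + Reg.b) (Reg.i - Reg.rx))) ;;
         (.w ≔ .ld .Wit (Reg.base + Reg.b)) ;;
         .ite (Reg.w =ₑ 0)
           (.store .R (Reg.base + Reg.x) Reg.m)
           (.store .R (Reg.base + Reg.x) (Reg.rx + Reg.w - 1)))
        .skip) ;;
    .par .i 1 Reg.m (
      (.x ≔ .ld .Cand (Reg.base + ((Reg.i - 1) / Reg.bs + 1))) ;;
      .ite Reg.x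
        ((.rx ≔ .ld .R (Reg.base + Reg.x)) ;;
         .ite ((Reg.i ≤ₑ Reg.x) ∧ₑ (Reg.rx + (Reg.x - Reg.i) + 1 ≤ₑ Reg.m))
           (.store .C (Reg.base + Reg.i) 0)
           .skip ;;
         .ite ((Reg.x ≤ₑ Reg.i) ∧ₑ (.ld .C (Reg.base + Reg.i) =ₑ 1))
           (.store .R (Reg.base + Reg.i) (Reg.rx - (Reg.i - Reg.x)))
           .skip)
        .skip) ;;
    (.bs ≔ Reg.bs / 2))

/-- The pattern search: both stages for all pieces of the text in parallel. -/
def patternSearch : Cmd :=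
  .par .q 0 ((Reg.n - 1) / Reg.m) (
    (.base ≔ Reg.q * Reg.m) ;;
    duelingStage ;;
    sweepingStage)

/-- Piece `q` of the text `T` for a pattern of length `m`. -/
def piece {α : Type*} (T : List α) (m q : ℕ) : List α :=
  substr T (q * m + 1) (q * m + (2 * m - 1))

/-- The input of the pattern search: the encodings of the pattern and of the pieces of the text (of
the text itself, if `n ≤ 2m - 1`), and re-encoding with time `ξt` and work `ξw`. -/
noncomputable def searchInput {α β : Type*} (f : List α → List β) (ξt ξw : ℕ → ℕ)
    (P T : List α) : Input β where
  str k := if k = 0 then f P else f (piece T P.length (k - 1))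
  re := reencode f
  ξt := ξt
  ξw := ξw

end DuelSweep

/-! By conditions (2) and (4) of an encoding, symbolwise agreement of two encodings up to position
`r` means that the prefixes of length `r` are equivalent (`IsEncoding.agree_iff`). Hence `W[a] = 0`
says that `P[a+1:m]` is equivalent to `P[1:m-a]`, and every statement about duels and sweeps becomes
one about prefixes, suffixes and transitivity of the relation. `pieceSpec` collects these facts for
one piece; afterwards strings are no longer needed.

Dueling. Consistency is additive: `W[a] = W[b] = 0` gives `W[a+b] = 0`. So, for two sorted
consistent lists, the zeros of the duel matrix form a staircase (`Mergeable.W_right`,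
`Mergeable.W_left`). A single duel decides more than one candidate: a 1 in row `i` refutes all of
`𝒜[i:]`, and a -1 in column `j` refutes all of `ℬ[1:j]`, because the members of one list are
consistent with each other. Therefore logarithmically many duels settle a row, and logarithmically
many rows settle a merge; what is discarded is never an occurrence (`Mergeable.isMerge`).

Sweeping. All survivors are pairwise consistent, so a match of length `r` at `x` yields a match of
length `r - (y - x)` at a later survivor `y`, and a mismatch at `x` refutes every earlier survivor
that reaches the mismatch. The invariant `SweepInv` says that, for survivors `x < y` of different
blocks, the text still to be compared for `y` starts only where the text of `x` ends. Thus the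
comparisons of one round concern disjoint parts of the piece, at most `2m` of them
(`SweepInv.work`), and halving the blocks preserves the invariant (`SweepInv.step`). When the block
size reaches 0, every survivor is matched completely.

Cost. With `L = ⌈log₂ m⌉`, a merge takes `O(L²)` re-encodings on one processor. There are `L`
rounds, which gives time `O(L³)`, and `O(m)` merges per piece in total, because their number halves
from round to round (`sum_div_two_pow_le`). The sweep adds `L + 1` rounds of constantly many
re-encodings in time and `O(m)` in work. The pieces have total length at most `2n`.

On the machine level, code that leaves the shared memory alone is treated processor by processor
(`Triple`), and the rest by total-correctness statements with bounds (`Runs`). The priority rule for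
writes is what computes the least candidate of a block and the first mismatch. -/

namespace DuelSweep

/-! ## Reasoning about programs -/

section Machine

variable {β : Type*} {I : Input β}

/-- The arrays that a program may write. -/
def Cmd.writes : Cmd → List Arr
  | .store A _ _ => [A]
  | .seq c₁ c₂ => c₁.writes ++ c₂.writes
  | .ite _ c₁ c₂ => c₁.writes ++ c₂.writes
  | .loop _ c => c.writes
  | .par _ _ _ c => c.writes
  | _ => []

/-- The number registers that a program may change on the processors that run it. -/
def Cmd.sets : Cmd → List Reg
  | .assign r _ => [r]
  | .seq c₁ c₂ => c₁.sets ++ c₂.sets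
  | .ite _ c₁ c₂ => c₁.sets ++ c₂.sets
  | .loop _ c => c.sets
  | _ => []

theorem mem_children {S : Finset Proc} {lo hi : Proc → ℕ} {p : Proc} :
    p ∈ children S lo hi ↔ ∃ p₀ ∈ S, ∃ k, lo p₀ ≤ k ∧ k ≤ hi p₀ ∧ p₀ ++ [k] = p := by
  simp [children, and_assoc]

theorem length_of_mem_children {S : Finset Proc} {lo hi : Proc → ℕ} {d : ℕ}
    (hS : ∀ p ∈ S, p.length = d) : ∀ p ∈ children S lo hi, p.length = d + 1 := by
  intro p hp
  obtain ⟨p₀, h₀, k, -, -, rfl⟩ := mem_children.1 hp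
  simp [hS p₀ h₀]

/-- Different pairs of parent and index give different lists, so the union over the parents is
disjoint and the work of a parallel loop splits over the parents. -/
theorem sum_children {γ : Type*} [AddCommMonoid γ] (S : Finset Proc) (lo hi : Proc → ℕ)
    (g : Proc → γ) :
    ∑ p ∈ children S lo hi, g p = ∑ p ∈ S, ∑ k ∈ Finset.Icc (lo p) (hi p), g (p ++ [k]) := by
  rw [children, Finset.sum_biUnion]
  · refine Finset.sum_congr rfl fun p _ => ?_
    rw [Finset.sum_image]
    intro a _ b _ h
    simpa using h
  · intro p _ p' _ hpp'
    rw [Function.onFun, Finset.disjoint_left]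
    intro x hx hx'
    simp only [Finset.mem_image] at hx hx'
    obtain ⟨k, -, rfl⟩ := hx
    obtain ⟨k', -, h⟩ := hx'
    exact hpp' (List.append_inj_left' h rfl).symm

theorem card_children (S : Finset Proc) (lo hi : Proc → ℕ) :
    (children S lo hi).card = ∑ p ∈ S, (hi p + 1 - lo p) := by
  rw [Finset.card_eq_sum_ones, sum_children]
  simp

theorem Exec.mem_frame {c : Cmd} {S : Finset Proc} {σ σ' : State β} {t w : ℕ}
    (h : Exec I c S σ σ' t w) {A : Arr} (hA : A ∉ c.writes) : σ'.mem A = σ.mem A := by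
  induction h with
  | assign | loadSym | reenc | skip | loopDone => rfl
  | store B =>
    have : A ≠ B := by simpa [Cmd.writes] using hA
    funext k
    simp [State.write, this]
  | seq _ _ _ _ _ _ _ _ _ _ _ _ ih₁ ih₂ =>
    simp only [Cmd.writes, List.mem_append, not_or] at hA
    rw [ih₂ hA.2, ih₁ hA.1]
  | ite _ _ _ _ _ _ _ _ _ _ _ _ _ ih₁ ih₂ =>
    simp only [Cmd.writes, List.mem_append, not_or] at hA
    rw [ih₂ hA.2, ih₁ hA.1]
  | loopStep _ _ _ _ _ _ _ _ _ _ _ _ _ ih₁ ih₂ => rw [ih₂ hA, ih₁ hA]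
  | par _ _ _ _ _ _ _ _ _ _ _ _ ih => rw [ih hA]; rfl

/-- Running processors are lists of one length `d`, and nested loops only start longer ones. So
shorter lists are never touched, and at length `d` only assigned registers change; this is why
`Cmd.sets` may ignore the body of a parallel loop. -/
theorem Exec.reg_frame {c : Cmd} {S : Finset Proc} {σ σ' : State β} {t w : ℕ}
    (h : Exec I c S σ σ' t w) {d : ℕ} (hS : ∀ p ∈ S, p.length = d) (p : Proc) :
    (p.length < d → σ'.reg p = σ.reg p) ∧
      (p.length ≤ d → ∀ r, r ∉ c.sets → σ'.reg p r = σ.reg p r) := by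
  induction h generalizing d with
  | store | loadSym | reenc | skip | loopDone =>
    exact ⟨fun _ => rfl, fun _ _ _ => rfl⟩
  | assign r e S σ =>
    refine ⟨fun hp => ?_, fun _ r' hr => ?_⟩
    · funext r'
      have : p ∉ S := fun h => by have := hS p h; omega
      simp [State.setReg, this]
    · have : r' ≠ r := by simpa [Cmd.sets] using hr
      simp [State.setReg, this]
  | seq _ _ _ _ _ _ _ _ _ _ _ _ ih₁ ih₂ =>
    refine ⟨fun hp => by rw [(ih₂ hS).1 hp, (ih₁ hS).1 hp], fun hp r hr => ?_⟩
    simp only [Cmd.sets, List.mem_append, not_or] at hr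
    rw [(ih₂ hS).2 hp r hr.2, (ih₁ hS).2 hp r hr.1]
  | ite e _ _ S σ _ _ _ _ _ _ _ _ ih₁ ih₂ =>
    have h₁ : ∀ p ∈ σ.sel S e, p.length = d := fun p hp => hS p (Finset.mem_filter.1 hp).1
    have h₂ : ∀ p ∈ σ.unsel S e, p.length = d := fun p hp => hS p (Finset.mem_filter.1 hp).1
    refine ⟨fun hp => by rw [(ih₂ h₂).1 hp, (ih₁ h₁).1 hp], fun hp r hr => ?_⟩
    simp only [Cmd.sets, List.mem_append, not_or] at hr
    rw [(ih₂ h₂).2 hp r hr.2, (ih₁ h₁).2 hp r hr.1]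
  | loopStep e _ S σ _ _ _ _ _ _ _ _ _ ih₁ ih₂ =>
    have h₁ : ∀ p ∈ σ.sel S e, p.length = d := fun p hp => hS p (Finset.mem_filter.1 hp).1
    refine ⟨fun hp => by rw [(ih₂ h₁).1 hp, (ih₁ h₁).1 hp], fun hp r hr => ?_⟩
    rw [(ih₂ h₁).2 hp r hr, (ih₁ h₁).2 hp r hr]
  | par r lo hi c S S' σ _ _ _ h' _ ih =>
    have h₁ : ∀ p ∈ S', p.length = d + 1 := h' ▸ length_of_mem_children hS
    have h₂ : p.length ≤ d → (σ.fork S' r).reg p = σ.reg p := by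
      intro hp
      have : p ∉ S' := fun h => by have := h₁ p h; omega
      simp [State.fork, this]
    refine ⟨fun hp => by rw [(ih h₁).1 (by omega), h₂ hp.le], fun hp r' _ => ?_⟩
    rw [(ih h₁).1 (by omega), h₂ hp]

/-- The program `c`, started by the processors in `S` in the state `σ`, halts within time `T` and
work `N` in a state that satisfies `Q`. -/
def Runs (I : Input β) (c : Cmd) (S : Finset Proc) (σ : State β) (T N : ℕ)
    (Q : State β → Prop) : Prop :=
  ∃ σ' t w, Exec I c S σ σ' t w ∧ t ≤ T ∧ w ≤ N ∧ Q σ'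

namespace Runs

variable {c c₁ c₂ : Cmd} {S : Finset Proc} {σ : State β} {T N T₁ N₁ T₂ N₂ : ℕ}
  {Q Q₁ : State β → Prop}

theorem mono (h : Runs I c S σ T N Q) (hT : T ≤ T₁) (hN : N ≤ N₁) : Runs I c S σ T₁ N₁ Q := by
  obtain ⟨σ', t, w, he, ht, hw, hQ⟩ := h
  exact ⟨σ', t, w, he, ht.trans hT, hw.trans hN, hQ⟩

/-- Registers and arrays to which the program does not assign are unchanged. -/
theorem frame (h : Runs I c S σ T N Q) {d : ℕ} (hS : ∀ p ∈ S, p.length = d)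
    (hQ : ∀ σ', Q σ' → (∀ A, A ∉ c.writes → σ'.mem A = σ.mem A) →
      (∀ p : Proc, p.length ≤ d → ∀ r, r ∉ c.sets → σ'.reg p r = σ.reg p r) → Q₁ σ') :
    Runs I c S σ T N Q₁ := by
  obtain ⟨σ', t, w, he, ht, hw, h⟩ := h
  exact ⟨σ', t, w, he, ht, hw, hQ σ' h (fun A hA => he.mem_frame hA)
    (fun p hp => (he.reg_frame hS p).2 hp)⟩

theorem imp (h : Runs I c S σ T N Q) (hQ : ∀ σ', Q σ' → Q₁ σ') : Runs I c S σ T N Q₁ := by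
  obtain ⟨σ', t, w, he, ht, hw, h⟩ := h
  exact ⟨σ', t, w, he, ht, hw, hQ σ' h⟩

theorem seq (h₁ : Runs I c₁ S σ T₁ N₁ Q₁) (h₂ : ∀ σ', Q₁ σ' → Runs I c₂ S σ' T₂ N₂ Q) :
    Runs I (c₁ ;; c₂) S σ (T₁ + T₂) (N₁ + N₂) Q := by
  obtain ⟨σ₁, t₁, w₁, he₁, ht₁, hw₁, hQ₁⟩ := h₁
  obtain ⟨σ₂, t₂, w₂, he₂, ht₂, hw₂, hQ₂⟩ := h₂ σ₁ hQ₁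
  exact ⟨σ₂, _, _, .seq _ _ _ _ _ _ _ _ _ _ he₁ he₂, by omega, by omega, hQ₂⟩

theorem par {r : Reg} {lo hi : Expr} {S' : Finset Proc}
    (hS' : S' = children S (fun p => σ.eval p lo) (fun p => σ.eval p hi))
    (h : Runs I c S' (σ.fork S' r) T N Q) :
    Runs I (.par r lo hi c) S σ (lo.size + hi.size + 1 + T)
      (S.card * (lo.size + hi.size + 1) + S'.card + N) Q := by
  obtain ⟨σ₁, t₁, w₁, he₁, ht₁, hw₁, hQ₁⟩ := h
  exact ⟨σ₁, _, _, .par _ _ _ _ _ _ _ _ _ _ hS' he₁, by omega, by omega, hQ₁⟩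

theorem ite {e : Expr} (h₁ : Runs I c₁ (σ.sel S e) σ T₁ N₁ Q₁)
    (h₂ : ∀ σ', Q₁ σ' → Runs I c₂ (σ.unsel S e) σ' T₂ N₂ Q) :
    Runs I (.ite e c₁ c₂) S σ (e.size + 1 + T₁ + T₂) (S.card * (e.size + 1) + N₁ + N₂) Q := by
  obtain ⟨σ₁, t₁, w₁, he₁, ht₁, hw₁, hQ₁⟩ := h₁
  obtain ⟨σ₂, t₂, w₂, he₂, ht₂, hw₂, hQ₂⟩ := h₂ σ₁ hQ₁
  exact ⟨σ₂, _, _, .ite _ _ _ _ _ _ _ _ _ _ _ he₁ he₂, by omega, by omega, hQ₂⟩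

/-- A loop that all processors leave after the same number `K` of rounds. -/
theorem loop {e : Expr} {K : ℕ} {J : ℕ → State β → Prop} {N : ℕ → ℕ} (hS : S.Nonempty)
    (htrue : ∀ k < K, ∀ σ, J k σ → ∀ p ∈ S, σ.eval p e ≠ 0)
    (hfalse : ∀ σ, J K σ → ∀ p ∈ S, σ.eval p e = 0)
    (hstep : ∀ k < K, ∀ σ, J k σ → Runs I c S σ T (N k) (J (k + 1)))
    (h₀ : J 0 σ) :
    Runs I (.loop e c) S σ ((K + 1) * (e.size + 1 + T))
      ((K + 1) * (S.card * (e.size + 1)) + ∑ k ∈ Finset.range K, N k) (J K) := by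
  induction K generalizing σ J N with
  | zero =>
    refine ⟨σ, _, _, .loopDone _ _ _ _ ?_, by nlinarith, by simp, h₀⟩
    rw [State.sel, Finset.filter_eq_empty_iff]
    intro p hp
    simpa using hfalse σ h₀ p hp
  | succ K ih =>
    have hsel : σ.sel S e = S := Finset.filter_true_of_mem (htrue 0 (by omega) σ h₀)
    obtain ⟨σ₁, t₁, w₁, he₁, ht₁, hw₁, hJ⟩ := hstep 0 (by omega) σ h₀
    obtain ⟨σ₂, t₂, w₂, he₂, ht₂, hw₂, hJ₂⟩ := ih (σ := σ₁) (J := fun k => J (k + 1))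
      (N := fun k => N (k + 1)) (fun k hk => htrue (k + 1) (by omega)) hfalse
      (fun k hk => hstep (k + 1) (by omega)) hJ
    refine ⟨σ₂, _, _, .loopStep _ _ _ _ _ _ _ _ _ _ (hsel.symm ▸ hS) (hsel.symm ▸ he₁)
      (hsel.symm ▸ he₂), by nlinarith, ?_, hJ₂⟩
    rw [Finset.sum_range_succ']
    nlinarith

end Runs

/-! ### Programs without loops -/

/-- The final state of a program without loops and parallel loops. -/
noncomputable def Cmd.run (I : Input β) : Cmd → Finset Proc → State β → State β
  | .assign r e, S, σ => σ.setReg S r (fun p => σ.eval p e)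
  | .store A a e, S, σ => σ.write S A (fun p => σ.eval p a) (fun p => σ.eval p e)
  | .loadSym s k i, S, σ => σ.setSReg S s (fun p => sym (I.str (σ.eval p k)) (σ.eval p i))
  | .seq c₁ c₂, S, σ => c₂.run I S (c₁.run I S σ)
  | .ite e c₁ c₂, S, σ => c₂.run I (σ.unsel S e) (c₁.run I (σ.sel S e) σ)
  | _, _, σ => σ

/-- Programs without loops, parallel loops and re-encodings. -/
def Cmd.straight : Cmd → Bool
  | .assign _ _ => true
  | .store _ _ _ => true
  | .loadSym _ _ _ => true
  | .seq c₁ c₂ => c₁.straight && c₂.straight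
  | .ite _ c₁ c₂ => c₁.straight && c₂.straight
  | .skip => true
  | _ => false

/-- The time of a program without loops, parallel loops and re-encodings. -/
def Cmd.cost : Cmd → ℕ
  | .assign _ e => e.size + 1
  | .store _ a e => a.size + e.size + 1
  | .loadSym _ k i => k.size + i.size + 1
  | .seq c₁ c₂ => c₁.cost + c₂.cost
  | .ite e c₁ c₂ => e.size + 1 + c₁.cost + c₂.cost
  | _ => 1

/-- Such a program always halts, and charging both branches of a conditional to every processor
makes the cost a constant of the program text. Only the final state is left to compute. -/
theorem Exec.of_straight {c : Cmd} (hc : c.straight = true) (S : Finset Proc) (σ : State β) :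
    ∃ t w, Exec I c S σ (c.run I S σ) t w ∧ t ≤ c.cost ∧ w ≤ S.card * c.cost := by
  induction c generalizing S σ with
  | assign r e => exact ⟨_, _, .assign _ _ _ _, le_rfl, le_rfl⟩
  | store A a e => exact ⟨_, _, .store _ _ _ _ _, le_rfl, le_rfl⟩
  | loadSym s k i => exact ⟨_, _, .loadSym _ _ _ _ _, le_rfl, le_rfl⟩
  | skip => exact ⟨_, _, .skip _ _, le_rfl, by simp [Cmd.cost]⟩
  | seq c₁ c₂ ih₁ ih₂ =>
    simp only [Cmd.straight, Bool.and_eq_true] at hc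
    obtain ⟨t₁, w₁, he₁, ht₁, hw₁⟩ := ih₁ hc.1 S σ
    obtain ⟨t₂, w₂, he₂, ht₂, hw₂⟩ := ih₂ hc.2 S (c₁.run I S σ)
    refine ⟨_, _, .seq _ _ _ _ _ _ _ _ _ _ he₁ he₂, ?_, ?_⟩
    · simp only [Cmd.cost]; omega
    · simp only [Cmd.cost, mul_add]; omega
  | ite e c₁ c₂ ih₁ ih₂ =>
    simp only [Cmd.straight, Bool.and_eq_true] at hc
    obtain ⟨t₁, w₁, he₁, ht₁, hw₁⟩ := ih₁ hc.1 (σ.sel S e) σ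
    obtain ⟨t₂, w₂, he₂, ht₂, hw₂⟩ := ih₂ hc.2 (σ.unsel S e) (c₁.run I (σ.sel S e) σ)
    have h₁ := Nat.mul_le_mul_right c₁.cost (Finset.card_filter_le S (fun p => σ.eval p e ≠ 0))
    have h₂ := Nat.mul_le_mul_right c₂.cost (Finset.card_filter_le S (fun p => σ.eval p e = 0))
    refine ⟨_, _, .ite _ _ _ _ _ _ _ _ _ _ _ he₁ he₂, ?_, ?_⟩
    · simp only [Cmd.cost]; omega
    · simp only [Cmd.cost, mul_add]
      simp only [State.sel, State.unsel] at hw₁ hw₂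
      omega
  | reenc | loop | par => simp [Cmd.straight] at hc

theorem Runs.of_straight {c : Cmd} (hc : c.straight = true) (S : Finset Proc) (σ : State β) :
    Runs I c S σ c.cost (S.card * c.cost) (fun σ' => σ' = c.run I S σ) := by
  obtain ⟨t, w, he, ht, hw⟩ := Exec.of_straight (I := I) hc S σ
  exact ⟨_, t, w, he, ht, hw, rfl⟩

theorem State.write_mem_ne (σ : State β) (S : Finset Proc) {A A' : Arr} (h : A' ≠ A)
    (a v : Proc → ℕ) : (σ.write S A a v).mem A' = σ.mem A' := by
  funext k
  simp [State.write, h]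

theorem State.write_mem_of_forall_ne (σ : State β) {S : Finset Proc} {A : Arr} {a : Proc → ℕ}
    (v : Proc → ℕ) {k : ℕ} (h : ∀ p ∈ S, a p ≠ k) : (σ.write S A a v).mem A k = σ.mem A k := by
  have : ¬ (S.filter (fun p => a p = k)).Nonempty := by
    rintro ⟨p, hp⟩
    rw [Finset.mem_filter] at hp
    exact h p hp.1 hp.2
  simp only [State.write]
  rw [dif_neg (fun h => this h.2)]

/-- The priority rule in the form in which it is used: every competitor of `p` either writes the
same value or comes later in the order. -/
theorem State.write_mem_of_le (σ : State β) {S : Finset Proc} {A : Arr} {a : Proc → ℕ}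
    (v : Proc → ℕ) {p : Proc} (hp : p ∈ S) (h : ∀ p' ∈ S, a p' = a p → v p' = v p ∨ p ≤ p') :
    (σ.write S A a v).mem A (a p) = v p := by
  have hne : (S.filter (fun p' => a p' = a p)).Nonempty := ⟨p, Finset.mem_filter.2 ⟨hp, rfl⟩⟩
  simp only [State.write]
  rw [dif_pos ⟨trivial, hne⟩]
  have h₁ := Finset.min'_mem _ hne
  rw [Finset.mem_filter] at h₁
  rcases h _ h₁.1 h₁.2 with h₂ | h₂
  · exact h₂
  · exact congrArg v (le_antisymm
      (Finset.min'_le (S.filter (fun p' => a p' = a p)) p (Finset.mem_filter.2 ⟨hp, rfl⟩)) h₂)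

theorem State.write_mem_of_inj (σ : State β) {S : Finset Proc} {A : Arr} {a : Proc → ℕ}
    (v : Proc → ℕ) {p : Proc} (hp : p ∈ S) (h : ∀ p' ∈ S, a p' = a p → p' = p) :
    (σ.write S A a v).mem A (a p) = v p :=
  σ.write_mem_of_le v hp fun p' hp' h' => Or.inl (congrArg v (h p' hp' h'))

theorem State.fork_reg (σ : State β) {S' : Finset Proc} (r : Reg) {p : Proc} {k : ℕ}
    (h : p ++ [k] ∈ S') (r' : Reg) :
    (σ.fork S' r).reg (p ++ [k]) r' = if r' = r then k else σ.reg p r' := by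
  simp [State.fork, h]

end Machine

/-! ### Programs that do not change the shared memory -/

section Local

variable {β : Type*} {I : Input β}

/-- The registers of one processor. -/
@[ext] structure Loc (β : Type*) where
  reg : Reg → ℕ
  sreg : SReg → Option β

/-- The registers of processor `p`. -/
def State.loc (σ : State β) (p : Proc) : Loc β := ⟨σ.reg p, σ.sreg p⟩

open Classical in
/-- The value of an expression, given the shared memory and the registers of the processor. -/
noncomputable def Loc.eval (M : Arr → ℕ → ℕ) (L : Loc β) : Expr → ℕ
  | .lit k => k
  | .reg r => L.reg r
  | .ld A a => M A (L.eval M a)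
  | .op o a b => o.eval (L.eval M a) (L.eval M b)
  | .symEq s t => if L.sreg s = L.sreg t then 1 else 0

/-- Register `r` is set to `v`. -/
def Loc.set (L : Loc β) (r : Reg) (v : ℕ) : Loc β :=
  { L with reg := fun r' => if r' = r then v else L.reg r' }

/-- Symbol register `s` is set to `v`. -/
def Loc.setSym (L : Loc β) (s : SReg) (v : Option β) : Loc β :=
  { L with sreg := fun s' => if s' = s then v else L.sreg s' }

theorem State.eval_eq (σ : State β) (p : Proc) (e : Expr) :
    σ.eval p e = (σ.loc p).eval σ.mem e := by
  induction e with
  | lit | reg | symEq => rfl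
  | ld A a ih => simp [State.eval, Loc.eval, ih]
  | op o a b iha ihb => simp [State.eval, Loc.eval, iha, ihb]

/-- A Hoare triple for programs that run on each processor separately: on every processor for which
`pre` holds, `post` holds in the end; the time is at most `T`, and the work is at most `N` per
processor. -/
def Triple (I : Input β) (M : Arr → ℕ → ℕ) (c : Cmd) (pre post : Proc → Loc β → Prop)
    (T N : ℕ) : Prop :=
  ∀ (S : Finset Proc) (σ : State β), σ.mem = M → (∀ p ∈ S, pre p (σ.loc p)) →
    ∃ σ' t w, Exec I c S σ σ' t w ∧ σ'.mem = M ∧ (∀ p ∉ S, σ'.loc p = σ.loc p) ∧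
      (∀ p ∈ S, post p (σ'.loc p)) ∧ t ≤ T ∧ w ≤ S.card * N

namespace Triple

variable {M : Arr → ℕ → ℕ} {c c₁ c₂ : Cmd} {pre pre' mid post post' : Proc → Loc β → Prop}
  {T N T₁ N₁ T₂ N₂ : ℕ}

theorem runs (h : Triple I M c pre post T N) {S : Finset Proc} {σ : State β} (hM : σ.mem = M)
    (hpre : ∀ p ∈ S, pre p (σ.loc p)) :
    Runs I c S σ T (S.card * N) (fun σ' => ∀ p ∈ S, post p (σ'.loc p)) := by
  obtain ⟨σ', t, w, he, -, -, hp, ht, hw⟩ := h S σ hM hpre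
  exact ⟨σ', t, w, he, ht, hw, hp⟩

theorem weaken (h : Triple I M c pre post T N) (hpre : ∀ p L, pre' p L → pre p L)
    (hpost : ∀ p L, post p L → post' p L) : Triple I M c pre' post' T N := by
  intro S σ hM hp
  obtain ⟨σ', t, w, he, hM', hfr, hpo, ht, hw⟩ := h S σ hM fun p hpS => hpre _ _ (hp p hpS)
  exact ⟨σ', t, w, he, hM', hfr, fun p hpS => hpost _ _ (hpo p hpS), ht, hw⟩

theorem of_imp (h : Triple I M c pre post T N) (hpre : ∀ p L, pre' p L → pre p L) :
    Triple I M c pre' post T N := h.weaken hpre fun _ _ h => h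

theorem seq (h₁ : Triple I M c₁ pre mid T₁ N₁) (h₂ : Triple I M c₂ mid post T₂ N₂) :
    Triple I M (c₁ ;; c₂) pre post (T₁ + T₂) (N₁ + N₂) := by
  intro S σ hM hp
  obtain ⟨σ₁, t₁, w₁, he₁, hM₁, hfr₁, hp₁, ht₁, hw₁⟩ := h₁ S σ hM hp
  obtain ⟨σ₂, t₂, w₂, he₂, hM₂, hfr₂, hp₂, ht₂, hw₂⟩ := h₂ S σ₁ hM₁ hp₁
  refine ⟨σ₂, _, _, .seq _ _ _ _ _ _ _ _ _ _ he₁ he₂, hM₂,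
    fun p hpS => (hfr₂ p hpS).trans (hfr₁ p hpS), hp₂, by omega, ?_⟩
  rw [mul_add]; omega

theorem assign (r : Reg) (e : Expr) :
    Triple I M (.assign r e) (fun p L => post p (L.set r (L.eval M e))) post
      (e.size + 1) (e.size + 1) := by
  intro S σ hM hp
  refine ⟨_, _, _, .assign _ _ _ _, hM, fun p hpS => ?_, fun p hpS => ?_, le_rfl, le_rfl⟩
  · simp [State.loc, State.setReg, hpS]
  · have := hp p hpS
    rw [← hM, ← State.eval_eq] at this
    convert this using 1
    ext1
    · funext r'
      simp [State.loc, State.setReg, hpS, Loc.set]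
    · rfl

theorem loadSym (s : SReg) (k i : Expr) :
    Triple I M (.loadSym s k i)
      (fun p L => post p (L.setSym s (sym (I.str (L.eval M k)) (L.eval M i)))) post
      (k.size + i.size + 1) (k.size + i.size + 1) := by
  intro S σ hM hp
  refine ⟨_, _, _, .loadSym _ _ _ _ _, hM, fun p hpS => ?_, fun p hpS => ?_, le_rfl, le_rfl⟩
  · simp [State.loc, State.setSReg, hpS]
  · have := hp p hpS
    rw [← hM, ← State.eval_eq, ← State.eval_eq] at this
    convert this using 1
    ext1
    · rfl
    · funext r'
      simp [State.loc, State.setSReg, hpS, Loc.setSym]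

theorem reenc (s : SReg) (k x i : Expr) (Xt Xw : ℕ) :
    Triple I M (.reenc s k x i)
      (fun p L => post p (L.setSym s (I.re (I.str (L.eval M k)) (L.eval M x) (L.eval M i))) ∧
        I.ξt (I.str (L.eval M k)).length ≤ Xt ∧ I.ξw (I.str (L.eval M k)).length ≤ Xw) post
      (k.size + x.size + i.size + 1 + Xt) (k.size + x.size + i.size + 1 + Xw) := by
  intro S σ hM hp
  refine ⟨_, _, _, .reenc _ _ _ _ _ _, hM, fun p hpS => ?_, fun p hpS => ?_, ?_, ?_⟩
  · simp [State.loc, State.setSReg, hpS]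
  · have := (hp p hpS).1
    simp only [← hM, ← State.eval_eq] at this
    convert this using 1
    ext1
    · rfl
    · funext r'
      simp [State.loc, State.setSReg, hpS, Loc.setSym]
  · refine Nat.add_le_add_left (Finset.sup_le fun p hpS => ?_) _
    have := (hp p hpS).2.1
    rwa [← hM, ← State.eval_eq] at this
  · rw [mul_add _ _ Xw]
    refine Nat.add_le_add_left ?_ _
    rw [← smul_eq_mul]
    refine Finset.sum_le_card_nsmul _ _ _ fun p hpS => ?_
    have := (hp p hpS).2.2
    rwa [← hM, ← State.eval_eq] at this

theorem ite {e : Expr}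
    (h₁ : Triple I M c₁ (fun p L => pre p L ∧ L.eval M e ≠ 0) post T₁ N₁)
    (h₂ : Triple I M c₂ (fun p L => pre p L ∧ L.eval M e = 0) post T₂ N₂) :
    Triple I M (.ite e c₁ c₂) pre post (e.size + 1 + T₁ + T₂) (e.size + 1 + N₁ + N₂) := by
  intro S σ hM hp
  have hs : ∀ p, p ∈ σ.sel S e ↔ p ∈ S ∧ (σ.loc p).eval M e ≠ 0 := fun p => by
    rw [State.sel, Finset.mem_filter, State.eval_eq, hM]
  have hu : ∀ p, p ∈ σ.unsel S e ↔ p ∈ S ∧ (σ.loc p).eval M e = 0 := fun p => by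
    rw [State.unsel, Finset.mem_filter, State.eval_eq, hM]
  obtain ⟨σ₁, t₁, w₁, he₁, hM₁, hfr₁, hp₁, ht₁, hw₁⟩ := h₁ (σ.sel S e) σ hM
    fun p hpS => ⟨hp p ((hs p).1 hpS).1, ((hs p).1 hpS).2⟩
  -- The second branch starts after the first one, but its processors did not take part in the
  -- first, so their registers are still those for which the test was evaluated.
  obtain ⟨σ₂, t₂, w₂, he₂, hM₂, hfr₂, hp₂, ht₂, hw₂⟩ := h₂ (σ.unsel S e) σ₁ hM₁
    fun p hpS => by
      rw [hfr₁ p fun h => ((hs p).1 h).2 ((hu p).1 hpS).2]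
      exact ⟨hp p ((hu p).1 hpS).1, ((hu p).1 hpS).2⟩
  refine ⟨σ₂, _, _, .ite _ _ _ _ _ _ _ _ _ _ _ he₁ he₂, hM₂, fun p hpS => ?_, fun p hpS => ?_,
    by omega, ?_⟩
  · rw [hfr₂ p fun h => hpS ((hu p).1 h).1, hfr₁ p fun h => hpS ((hs p).1 h).1]
  · by_cases h : (σ.loc p).eval M e = 0
    · exact hp₂ p ((hu p).2 ⟨hpS, h⟩)
    · rw [hfr₂ p fun h' => h ((hu p).1 h').2]
      exact hp₁ p ((hs p).2 ⟨hpS, h⟩)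
  · have h₁ := Nat.mul_le_mul_right N₁ (Finset.card_filter_le S (fun p => σ.eval p e ≠ 0))
    have h₂ := Nat.mul_le_mul_right N₂ (Finset.card_filter_le S (fun p => σ.eval p e = 0))
    simp only [State.sel, State.unsel] at hw₁ hw₂
    simp only [mul_add] at *
    omega

/-- Here processors may leave the loop in different rounds. The index of `inv` counts down and
bounds the rounds still needed by one processor; a processor that leaves early keeps its registers,
so its final index stays unspecified. -/
theorem loop {e : Expr} {inv : ℕ → Proc → Loc β → Prop}
    (hstep : ∀ k, Triple I M c (fun p L => inv (k + 1) p L ∧ L.eval M e ≠ 0) (inv k) T N)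
    (hzero : ∀ p L, inv 0 p L → L.eval M e = 0) (K : ℕ) :
    Triple I M (.loop e c) (inv K) (fun p L => L.eval M e = 0 ∧ ∃ k, inv k p L)
      ((K + 1) * (e.size + 1 + T)) ((K + 1) * (e.size + 1 + N)) := by
  induction K with
  | zero =>
    intro S σ hM hp
    have h : ∀ p ∈ S, (σ.loc p).eval M e = 0 := fun p hpS => hzero _ _ (hp p hpS)
    refine ⟨σ, _, _, .loopDone _ _ _ _ ?_, hM, fun _ _ => rfl,
      fun p hpS => ⟨h p hpS, 0, hp p hpS⟩, by omega, by gcongr; omega⟩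
    rw [State.sel, Finset.filter_eq_empty_iff]
    intro p hpS
    simpa [State.eval_eq, hM] using h p hpS
  | succ K ih =>
    intro S σ hM hp
    have hs : ∀ p, p ∈ σ.sel S e ↔ p ∈ S ∧ (σ.loc p).eval M e ≠ 0 := fun p => by
      rw [State.sel, Finset.mem_filter, State.eval_eq, hM]
    rcases (σ.sel S e).eq_empty_or_nonempty with hem | hne
    · refine ⟨σ, _, _, .loopDone _ _ _ _ hem, hM, fun _ _ => rfl,
        fun p hpS => ⟨?_, K + 1, hp p hpS⟩, by nlinarith, by gcongr; nlinarith⟩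
      by_contra h
      have := (hs p).2 ⟨hpS, h⟩
      simp [hem] at this
    obtain ⟨σ₁, t₁, w₁, he₁, hM₁, hfr₁, hp₁, ht₁, hw₁⟩ := hstep K (σ.sel S e) σ hM
      fun p hpS => ⟨hp p ((hs p).1 hpS).1, ((hs p).1 hpS).2⟩
    obtain ⟨σ₂, t₂, w₂, he₂, hM₂, hfr₂, hp₂, ht₂, hw₂⟩ := ih (σ.sel S e) σ₁ hM₁ hp₁
    refine ⟨σ₂, _, _, .loopStep _ _ _ _ _ _ _ _ _ _ hne he₁ he₂, hM₂, fun p hpS => ?_,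
      fun p hpS => ?_, by nlinarith, ?_⟩
    · have : p ∉ σ.sel S e := fun h => hpS ((hs p).1 h).1
      rw [hfr₂ p this, hfr₁ p this]
    · by_cases h : (σ.loc p).eval M e = 0
      · have : p ∉ σ.sel S e := fun h' => ((hs p).1 h').2 h
        rw [hfr₂ p this, hfr₁ p this]
        exact ⟨h, K + 1, hp p hpS⟩
      · exact hp₂ p ((hs p).2 ⟨hpS, h⟩)
    · have h₀ : (σ.sel S e).card ≤ S.card := Finset.card_filter_le _ _
      have h₁ := Nat.mul_le_mul_right N h₀
      have h₂ := Nat.mul_le_mul_right ((K + 1) * (e.size + 1 + N)) h₀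
      calc S.card * (e.size + 1) + w₁ + w₂
          ≤ S.card * (e.size + 1) + S.card * N + S.card * ((K + 1) * (e.size + 1 + N)) := by omega
        _ = _ := by ring

end Triple

end Local

/-! ## Duels and sweeps of candidate positions -/

/-- The facts about a piece of the text on which the search is based. `PS` are the symbols of the
encoded pattern, `TS x` those of the encoding of the text from position `x` on, `cand` are the
candidate positions, `occ` the occurrences, and `W` is the witness table. -/
structure PieceSpec {β : Type*} (m : ℕ) (W : ℕ → ℕ) (PS : ℕ → Option β)
    (TS : ℕ → ℕ → Option β) (cand occ : ℕ → Prop) : Prop where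
  witness_zero : W 0 = 0
  witness_le : ∀ {a}, a < m → W a ≠ 0 → W a + a ≤ m
  witness_add : ∀ {a b}, a + b < m → W a = 0 → W b = 0 → W (a + b) = 0
  cand_pos : ∀ {x}, cand x → 1 ≤ x
  cand_le : ∀ {x}, cand x → x ≤ m
  occ_iff : ∀ {x}, cand x → (occ x ↔ ∀ i, 1 ≤ i → i ≤ m → PS i = TS x i)
  right_wins : ∀ {x x' y}, x ≤ x' → x' < y → cand x → cand x' → cand y → W (x' - x) = 0 →
    W (y - x) ≠ 0 → PS (W (y - x)) = TS y (W (y - x)) → ¬ occ x'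
  shift : ∀ {x y r}, x ≤ y → cand x → cand y → W (y - x) = 0 → r ≤ m →
    (∀ i, 1 ≤ i → i ≤ r → PS i = TS x i) → ∀ i, 1 ≤ i → i ≤ r - (y - x) → PS i = TS y i

/-- If `y'` were an occurrence, its match, shifted to the consistent position `y`, would have length
`m - (y - y')`. The witness satisfies `w ≤ m - (y - x)`, which is smaller, so the symbols at `w`
would have to agree. -/
theorem PieceSpec.left_wins {β : Type*} {m : ℕ} {W : ℕ → ℕ} {PS : ℕ → Option β}
    {TS : ℕ → ℕ → Option β} {cand occ : ℕ → Prop} (h : PieceSpec m W PS TS cand occ)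
    {x y' y : ℕ} (hx : x < y') (hy : y' ≤ y) (cx : cand x) (cy' : cand y') (cy : cand y)
    (h₀ : W (y - y') = 0) (hw : W (y - x) ≠ 0) (hne : PS (W (y - x)) ≠ TS y (W (y - x))) :
    ¬ occ y' := by
  intro ho
  have h₁ := h.shift hy cy' cy h₀ le_rfl ((h.occ_iff cy').1 ho)
  have h₂ := h.cand_le cy
  have h₃ := h.cand_pos cx
  have h₄ := h.witness_le (by omega) hw
  exact hne (h₁ _ (by omega) (by omega))

section Strings

variable {α β : Type*} {rel : List α → List α → Prop} {f : List α → List β}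

theorem substr_one (X : List α) (r : ℕ) : substr X 1 r = X.take r := by simp [substr]

theorem substr_length (X : List α) {x : ℕ} (hx : 1 ≤ x) : substr X x X.length = X.drop (x - 1) := by
  rw [substr, List.take_of_length_le]
  rw [List.length_drop]; omega

theorem IsSCER.take (h : IsSCER rel) {X Y : List α} (hXY : rel X Y) (r : ℕ) :
    rel (X.take r) (Y.take r) := by
  have hl := h.length_eq X Y hXY
  by_cases h₀ : r = 0
  · subst h₀; simpa using h.equiv.refl _
  rcases le_total X.length r with hr | hr
  · rwa [List.take_of_length_le hr, List.take_of_length_le (hl ▸ hr)]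
  · simpa [substr_one] using h.substr_rel X Y hXY 1 r le_rfl (by omega) hr

theorem IsSCER.drop (h : IsSCER rel) {X Y : List α} (hXY : rel X Y) (a : ℕ) :
    rel (X.drop a) (Y.drop a) := by
  have hl := h.length_eq X Y hXY
  rcases lt_or_ge a X.length with ha | ha
  · have := h.substr_rel X Y hXY (a + 1) X.length (by omega) (by omega) le_rfl
    rw [substr_length X (by omega)] at this
    rw [hl, substr_length Y (by omega)] at this
    simpa using this
  · rw [List.drop_eq_nil_of_le ha, List.drop_eq_nil_of_le (hl ▸ ha)]
    exact h.equiv.refl _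

/-- The encoding of a prefix is the prefix of the encoding, so agreement up to `r` is equality of
the encodings of two prefixes. This bridge replaces all comparisons of symbols by the relation
itself. -/
theorem IsEncoding.agree_iff (h : IsEncoding rel f) {X Y : List α} {r : ℕ} (hX : r ≤ X.length)
    (hY : r ≤ Y.length) :
    (∀ i, 1 ≤ i → i ≤ r → sym (f X) i = sym (f Y) i) ↔ rel (X.take r) (Y.take r) := by
  rw [← h.eq_iff, ← substr_one, ← substr_one, h.prefix_eq X r hX, h.prefix_eq Y r hY, substr_one,
    substr_one]
  constructor
  · intro H
    apply List.ext_getElem?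
    intro i
    rcases lt_or_ge i r with hi | hi
    · have := H (i + 1) (by omega) (by omega)
      simpa [sym, List.getElem?_take, hi] using this
    · simp [not_lt.2 hi]
  · intro H i hi hir
    have := congrArg (fun L => L[i - 1]?) H
    simpa [sym, List.getElem?_take, show i - 1 < r by omega, show i ≠ 0 by omega] using this

/-- Any two strings with the same encoding are equivalent, hence so are their suffixes, and these
have equal encodings again. The preimage chosen in `reencode` is therefore irrelevant. -/
theorem reencode_eq (hrel : IsSCER rel) (hf : IsEncoding rel f) (X : List α) {x : ℕ} (hx : 1 ≤ x)
    (i : ℕ) : reencode f (f X) x i = sym (f (X.drop (x - 1))) i := by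
  have h : ∃ Y, f Y = f X := ⟨X, rfl⟩
  rw [reencode, dif_pos h, substr_length _ hx]
  congr 1
  rw [hf.eq_iff]
  exact hrel.drop ((hf.eq_iff _ _).1 h.choose_spec) _

/-- Having no witness means agreement on the whole overlap of length `m - a`. Witnesses are at least
1, so the entry 0 is unambiguous. -/
theorem witness_eq_zero_iff (hf : IsEncoding rel f) {P : List α}
    {W : ℕ → ℕ} (hW : IsWitnessTable f P W) {a : ℕ} (ha : a < P.length) :
    W a = 0 ↔ rel (P.drop a) (P.take (P.length - a)) := by
  have h : witnesses f P a = ∅ ↔ rel (P.drop a) (P.take (P.length - a)) := by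
    have := hf.agree_iff (X := P.drop a) (Y := P) (r := P.length - a) (by simp) (by simp)
    rw [List.take_of_length_le (by simp)] at this
    rw [← this, Set.eq_empty_iff_forall_notMem]
    simp only [witnesses, Set.mem_ofPred_eq, substr_length P (Nat.succ_pos a), Nat.succ_eq_add_one,
      Nat.add_sub_cancel]
    constructor
    · intro H i hi hi'
      by_contra hne
      exact H i ⟨hi, by omega, hne⟩
    · rintro H i ⟨hi, hi', hne⟩
      exact hne (H i hi (by omega))
  rw [← h]
  refine ⟨fun h₀ => ?_, (hW a ha).2⟩
  by_contra hne
  have := (hW a ha).1 (Set.nonempty_iff_ne_empty.2 hne)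
  rw [h₀] at this
  exact absurd this.1 (by omega)

theorem mem_witnesses_of_ne_zero {P : List α} {W : ℕ → ℕ} (hW : IsWitnessTable f P W) {a : ℕ}
    (ha : a < P.length) (h : W a ≠ 0) : W a ∈ witnesses f P a := by
  refine (hW a ha).1 (Set.nonempty_iff_ne_empty.2 fun hne => h ((hW a ha).2 hne))

theorem piece_eq (T : List α) (m q : ℕ) : piece T m q = (T.drop (q * m)).take (2 * m - 1) := by
  rw [piece, substr]
  congr 1; omega

/-- The only place where strings, the relation and the encoding enter the analysis of the search;
each field comes from taking prefixes and suffixes of known equivalences and composing them. -/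
theorem pieceSpec (hrel : IsSCER rel) (hf : IsEncoding rel f) {P T : List α} {W : ℕ → ℕ}
    (hP : 1 ≤ P.length) (hW : IsWitnessTable f P W) (q : ℕ) :
    PieceSpec P.length W (sym (f P)) (reencode f (f (piece T P.length q)))
      (fun x => 1 ≤ x ∧ x ≤ P.length ∧ q * P.length + x + P.length ≤ T.length + 1)
      (fun x => IsOccurrence rel P T (q * P.length + x)) := by
  set m := P.length with hm
  set X := piece T m q with hX
  have hXl : X.length = min (2 * m - 1) (T.length - q * m) := by simp [hX, piece_eq]
  have hsym : ∀ {A B}, rel A B → rel B A := hrel.equiv.symm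
  have htr : ∀ {A B C}, rel A B → rel B C → rel A C := hrel.equiv.trans
  -- The overlap of the pieces is just long enough: from a candidate position `x ≤ m` on, the piece
  -- still contains `m` symbols.
  have hagree : ∀ {x r}, 1 ≤ x → q * m + x + m ≤ T.length + 1 → x ≤ m → r ≤ m →
      ((∀ i, 1 ≤ i → i ≤ r → sym (f P) i = reencode f (f X) x i) ↔
        rel (P.take r) ((X.drop (x - 1)).take r)) := by
    intro x r hx hxn hxm hr
    rw [← hf.agree_iff hr (by rw [List.length_drop, hXl]; omega)]
    simp only [reencode_eq hrel hf X hx]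
  have hocc : ∀ {x}, 1 ≤ x → x ≤ m → q * m + x + m ≤ T.length + 1 →
      (IsOccurrence rel P T (q * m + x) ↔ rel P ((X.drop (x - 1)).take m)) := by
    intro x hx hxm hxn
    rw [IsOccurrence, ← hm]
    have : substr T (q * m + x) (q * m + x + m - 1) = (X.drop (x - 1)).take m := by
      rw [substr, hX, piece_eq, List.drop_take, List.drop_drop, List.take_take]
      congr 2 <;> omega
    rw [this]
    exact ⟨fun h => h.2.2, fun h => ⟨by omega, hxn, h⟩⟩
  have hmP : P.take m = P := List.take_length
  have hdt : ∀ (A : List α) (a r : ℕ), (A.take r).drop a = (A.drop a).take (r - a) :=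
    fun A a r => List.drop_take ..
  constructor
  · rw [witness_eq_zero_iff hf hW hP]
    simpa using hrel.equiv.refl _
  · intro a ha h
    exact (mem_witnesses_of_ne_zero hW ha h).2.1
  · intro a b hab ha hb
    rw [witness_eq_zero_iff hf hW (by omega)] at *
    -- Cut `b` symbols off the equivalence for `a`, shorten the one for `b`, and compose them at the
    -- substring of `P` that starts after `b` symbols.
    have h₁ := hrel.drop ha b
    have h₂ := hrel.take hb (m - a - b)
    rw [List.drop_drop, hdt] at h₁
    rw [List.take_take] at h₂
    rw [Nat.min_eq_left (by omega)] at h₂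
    rw [Nat.sub_add_eq]
    exact htr h₁ h₂
  · exact fun h => h.1
  · exact fun h => h.2.1
  · rintro x ⟨h₁, h₂, h₃⟩
    rw [hagree h₁ h₃ h₂ le_rfl, hocc h₁ h₂ h₃, hmP]
  · rintro x x' y hxx' hx'y ⟨h₁, h₂, h₃⟩ ⟨h₁', h₂', h₃'⟩ ⟨g₁, g₂, g₃⟩ h₀ hw heq ho
    have hmem := mem_witnesses_of_ne_zero hW (a := y - x) (by omega) hw
    rw [hocc h₁' h₂' h₃'] at ho
    rw [witness_eq_zero_iff hf hW (by omega)] at h₀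
    -- Suppose that `x'` is an occurrence. Then the part of `P` after `y - x'` symbols is equivalent
    -- to the text at `y` (`k₁`), and by consistency of `x` and `x'` also to the part of `P` after
    -- `y - x` symbols (`k₂`). So that last part agrees at the witness with the text at `y`, hence
    -- with `P`, which the witness forbids.
    have k₁ := hrel.take (hrel.drop ho (y - x')) (m - (y - x))
    have k₂ := hrel.drop h₀ (y - x')
    rw [hdt, List.drop_drop, List.take_take, Nat.min_eq_left (by omega),
      show x' - 1 + (y - x') = y - 1 by omega] at k₁
    rw [hdt, List.drop_drop, show x' - x + (y - x') = y - x by omega,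
      show P.length - (x' - x) - (y - x') = m - (y - x) by omega] at k₂
    have k₃ := htr k₂ k₁
    rw [show P.drop (y - x) = (P.drop (y - x)).take (m - (y - x)) by
      rw [List.take_of_length_le]; simp [hm], ← hf.agree_iff (by simp [hm])
      (by rw [List.length_drop, hXl]; omega)] at k₃
    obtain ⟨e₁, e₂, e₃⟩ := hmem
    rw [substr_length P (by omega), Nat.add_sub_cancel, k₃ _ e₁ (by omega), heq,
      reencode_eq hrel hf X g₁] at e₃
    exact e₃ rfl
  · rintro x y r hxy ⟨h₁, h₂, h₃⟩ ⟨g₁, g₂, g₃⟩ h₀ hr h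
    rw [hagree h₁ h₃ h₂ hr] at h
    rw [hagree g₁ g₃ g₂ (by omega)]
    rw [witness_eq_zero_iff hf hW (by omega)] at h₀
    -- The part of the matched prefix that starts after `y - x` symbols lies at `y` in the text, and
    -- by consistency it is equivalent to a prefix of `P`.
    have k₁ := hrel.drop h (y - x)
    have k₂ := hrel.take h₀ (r - (y - x))
    rw [hdt, hdt, List.drop_drop, show x - 1 + (y - x) = y - 1 by omega] at k₁
    rw [List.take_take, Nat.min_eq_left (by omega)] at k₂
    exact htr (hsym k₂) k₁

end Strings

/-! ## Merging two lists of candidates -/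

/-! ### Size and evaluation of expressions. -/

section Eval

variable {β : Type*} (σ : State β) (p : Proc) (M : Arr → ℕ → ℕ) (L : Loc β)

@[simp] theorem Expr.size_zero : (0 : Expr).size = 1 := rfl
@[simp] theorem Expr.size_one : (1 : Expr).size = 1 := rfl
@[simp] theorem Expr.size_two : (2 : Expr).size = 1 := rfl
@[simp] theorem Expr.size_reg (r : Reg) : (Expr.reg r).size = 1 := rfl
@[simp] theorem Expr.size_symEq (s t : SReg) : (Expr.symEq s t).size = 1 := rfl
@[simp] theorem Expr.size_ld (A : Arr) (a : Expr) : (Expr.ld A a).size = a.size + 1 := rfl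
@[simp] theorem Expr.size_op (o : BinOp) (a b : Expr) :
    (Expr.op o a b).size = a.size + b.size + 1 := rfl
@[simp] theorem Expr.size_add (a b : Expr) : (a + b).size = a.size + b.size + 1 := rfl
@[simp] theorem Expr.size_sub (a b : Expr) : (a - b).size = a.size + b.size + 1 := rfl
@[simp] theorem Expr.size_mul (a b : Expr) : (a * b).size = a.size + b.size + 1 := rfl
@[simp] theorem Expr.size_div (a b : Expr) : (a / b).size = a.size + b.size + 1 := rfl
@[simp] theorem Expr.size_mod (a b : Expr) : (a % b).size = a.size + b.size + 1 := rfl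

@[simp] theorem State.eval_zero : σ.eval p (0 : Expr) = 0 := rfl
@[simp] theorem State.eval_one : σ.eval p (1 : Expr) = 1 := rfl
@[simp] theorem State.eval_two : σ.eval p (2 : Expr) = 2 := rfl
@[simp] theorem State.eval_reg (r : Reg) : σ.eval p (.reg r) = σ.reg p r := rfl
@[simp] theorem State.eval_ld (A : Arr) (a : Expr) :
    σ.eval p (.ld A a) = σ.mem A (σ.eval p a) := rfl
@[simp] theorem State.eval_add (a b : Expr) : σ.eval p (a + b) = σ.eval p a + σ.eval p b := rfl
@[simp] theorem State.eval_sub (a b : Expr) : σ.eval p (a - b) = σ.eval p a - σ.eval p b := rfl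
@[simp] theorem State.eval_mul (a b : Expr) : σ.eval p (a * b) = σ.eval p a * σ.eval p b := rfl
@[simp] theorem State.eval_div (a b : Expr) : σ.eval p (a / b) = σ.eval p a / σ.eval p b := rfl
@[simp] theorem State.eval_mod (a b : Expr) : σ.eval p (a % b) = σ.eval p a % σ.eval p b := rfl
@[simp] theorem State.eval_op_mul (a b : Expr) :
    σ.eval p (a ∧ₑ b) = σ.eval p a * σ.eval p b := rfl
theorem State.eval_le (a b : Expr) :
    σ.eval p (a ≤ₑ b) = if σ.eval p a ≤ σ.eval p b then 1 else 0 := rfl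
@[simp] theorem State.eval_le_eq_zero (a b : Expr) :
    σ.eval p (a ≤ₑ b) = 0 ↔ ¬ σ.eval p a ≤ σ.eval p b := by simp [State.eval, BinOp.eval]
@[simp] theorem State.eval_lt_eq_zero (a b : Expr) :
    σ.eval p (a <ₑ b) = 0 ↔ ¬ σ.eval p a < σ.eval p b := by simp [State.eval, BinOp.eval]
@[simp] theorem State.eval_eq_eq_zero (a b : Expr) :
    σ.eval p (a =ₑ b) = 0 ↔ σ.eval p a ≠ σ.eval p b := by simp [State.eval, BinOp.eval]
@[simp] theorem State.eval_symEq_eq_zero (s t : SReg) :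
    σ.eval p (.symEq s t) = 0 ↔ σ.sreg p s ≠ σ.sreg p t := by simp [State.eval]

@[simp] theorem Loc.eval_zero : L.eval M (0 : Expr) = 0 := rfl
@[simp] theorem Loc.eval_one : L.eval M (1 : Expr) = 1 := rfl
@[simp] theorem Loc.eval_two : L.eval M (2 : Expr) = 2 := rfl
@[simp] theorem Loc.eval_reg (r : Reg) : L.eval M (.reg r) = L.reg r := rfl
@[simp] theorem Loc.eval_ld (A : Arr) (a : Expr) : L.eval M (.ld A a) = M A (L.eval M a) := rfl
@[simp] theorem Loc.eval_add (a b : Expr) : L.eval M (a + b) = L.eval M a + L.eval M b := rfl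
@[simp] theorem Loc.eval_sub (a b : Expr) : L.eval M (a - b) = L.eval M a - L.eval M b := rfl
@[simp] theorem Loc.eval_mul (a b : Expr) : L.eval M (a * b) = L.eval M a * L.eval M b := rfl
@[simp] theorem Loc.eval_div (a b : Expr) : L.eval M (a / b) = L.eval M a / L.eval M b := rfl
@[simp] theorem Loc.eval_op_mul (a b : Expr) :
    L.eval M (a ∧ₑ b) = L.eval M a * L.eval M b := rfl
@[simp] theorem Loc.eval_lt_eq_zero (a b : Expr) :
    L.eval M (a <ₑ b) = 0 ↔ ¬ L.eval M a < L.eval M b := by simp [Loc.eval, BinOp.eval]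
@[simp] theorem Loc.eval_eq_eq_zero (a b : Expr) :
    L.eval M (a =ₑ b) = 0 ↔ L.eval M a ≠ L.eval M b := by simp [Loc.eval, BinOp.eval]
@[simp] theorem Loc.eval_symEq_eq_zero (s t : SReg) :
    L.eval M (.symEq s t) = 0 ↔ L.sreg s ≠ L.sreg t := by simp [Loc.eval]

@[simp] theorem Loc.set_reg (r r' : Reg) (v : ℕ) :
    (L.set r v).reg r' = if r' = r then v else L.reg r' := rfl
@[simp] theorem Loc.setSym_reg (s : SReg) (v : Option β) : (L.setSym s v).reg = L.reg := rfl
@[simp] theorem Loc.setSym_sreg (s s' : SReg) (v : Option β) :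
    (L.setSym s v).sreg s' = if s' = s then v else L.sreg s' := rfl

end Eval

/-- Weakest-precondition form of `Triple.ite`: the two preconditions are independent, so unification
can compute them when a program is assembled from its end. -/
theorem Triple.ite' {β : Type*} {I : Input β} {M : Arr → ℕ → ℕ} {c₁ c₂ : Cmd}
    {pre₁ pre₂ post : Proc → Loc β → Prop} {T₁ N₁ T₂ N₂ : ℕ} {e : Expr}
    (h₁ : Triple I M c₁ pre₁ post T₁ N₁) (h₂ : Triple I M c₂ pre₂ post T₂ N₂) :
    Triple I M (.ite e c₁ c₂)
      (fun p L => (L.eval M e ≠ 0 → pre₁ p L) ∧ (L.eval M e = 0 → pre₂ p L)) post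
      (e.size + 1 + T₁ + T₂) (e.size + 1 + N₁ + N₂) :=
  .ite (h₁.of_imp fun _ _ h => h.1.1 h.2) (h₂.of_imp fun _ _ h => h.1.2 h.2)

theorem Triple.mono {β : Type*} {I : Input β} {M : Arr → ℕ → ℕ} {c : Cmd}
    {pre post : Proc → Loc β → Prop} {T N T' N' : ℕ} (h : Triple I M c pre post T N)
    (hT : T ≤ T') (hN : N ≤ N') : Triple I M c pre post T' N' := by
  intro S σ hM hp
  obtain ⟨σ', t, w, he, hM', hfr, hpo, ht, hw⟩ := h S σ hM hp
  exact ⟨σ', t, w, he, hM', hfr, hpo, ht.trans hT, hw.trans (by gcongr)⟩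

/-- A sorted list `A[1 : n]` of pairwise consistent candidates. -/
structure IsCandList (W : ℕ → ℕ) (cand : ℕ → Prop) (A : ℕ → ℕ) (n : ℕ) : Prop where
  lt : ∀ {i j}, 1 ≤ i → i < j → j ≤ n → A i < A j
  zero : ∀ {i j}, 1 ≤ i → i < j → j ≤ n → W (A j - A i) = 0
  cand : ∀ {i}, 1 ≤ i → i ≤ n → cand (A i)

/-- Two lists of candidates that can be merged. -/
structure Mergeable {β : Type*} (m : ℕ) (W : ℕ → ℕ) (PS : ℕ → Option β)
    (TS : ℕ → ℕ → Option β) (cand occ : ℕ → Prop) (A B : ℕ → ℕ) (la lb : ℕ) : Prop where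
  spec : PieceSpec m W PS TS cand occ
  left : IsCandList W cand A la
  right : IsCandList W cand B lb
  lt : ∀ {i j}, 1 ≤ i → i ≤ la → 1 ≤ j → j ≤ lb → A i < B j

/-- `A[1 : l]` and `B[r : lb]` are consistent, and the other elements of the lists are not
occurrences. -/
structure IsMerge (W : ℕ → ℕ) (occ : ℕ → Prop) (A B : ℕ → ℕ) (la lb l r : ℕ) : Prop where
  l_le : l ≤ la
  r_pos : 1 ≤ r
  r_le : r ≤ lb + 1
  zero : ∀ i j, 1 ≤ i → i ≤ l → r ≤ j → j ≤ lb → W (B j - A i) = 0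
  left : ∀ i, l < i → i ≤ la → ¬ occ (A i)
  right : ∀ j, 1 ≤ j → j < r → ¬ occ (B j)

/-- Invariant of the binary search over the rows. -/
structure RowSearch (W : ℕ → ℕ) (occ : ℕ → Prop) (A B : ℕ → ℕ) (la lb k l r : ℕ) : Prop where
  lt : l < r
  le : r ≤ la + 1
  gap : r - l ≤ 2 ^ k
  hi : ∀ i, r ≤ i → i ≤ la → ¬ occ (A i)
  lo : l = 0 ∨ ∀ j, 1 ≤ j → j ≤ lb → W (B j - A l) = 0 ∨ ¬ occ (B j)

/-- Invariant of the binary search in row `i`. -/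
structure ColSearch (W : ℕ → ℕ) (occ : ℕ → Prop) (A B : ℕ → ℕ) (la lb k i obs l r : ℕ) :
    Prop where
  lt : l < r
  le : r ≤ lb + 1
  gap : obs = 0 → r - l ≤ 2 ^ k
  zero : ∀ j, r ≤ j → j ≤ lb → W (B j - A i) = 0
  lose : ∀ j, 1 ≤ j → j ≤ l → ¬ occ (B j)
  obs : obs ≠ 0 → ∀ i', i ≤ i' → i' ≤ la → ¬ occ (A i')

/-- Invariant of the search for the first zero of row `i`. -/
structure ZeroSearch (W : ℕ → ℕ) (A B : ℕ → ℕ) (lb k i l r : ℕ) : Prop where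
  lt : l < r
  le : r ≤ lb + 1
  gap : r - l ≤ 2 ^ k
  zero : ∀ j, r ≤ j → j ≤ lb → i = 0 ∨ W (B j - A i) = 0
  ne : ∀ j, 1 ≤ j → j ≤ l → i ≠ 0 ∧ W (B j - A i) ≠ 0

theorem ZeroSearch.left_of_zero {W A B : ℕ → ℕ} {lb k i l r : ℕ}
    (h : ZeroSearch W A B lb (k + 1) i l r) (hlr : l + 1 < r)
    (h₀ : ∀ j, (l + r) / 2 ≤ j → j ≤ lb → i = 0 ∨ W (B j - A i) = 0) :
    ZeroSearch W A B lb k i l ((l + r) / 2) := by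
  obtain ⟨h₁, h₂, h₃, h₄, h₅⟩ := h
  rw [pow_succ] at h₃
  exact ⟨by omega, by omega, by omega, h₀, h₅⟩

theorem ZeroSearch.right_of_ne {W A B : ℕ → ℕ} {lb k i l r : ℕ}
    (h : ZeroSearch W A B lb (k + 1) i l r) (hlr : l + 1 < r)
    (h₀ : ∀ j, 1 ≤ j → j ≤ (l + r) / 2 → i ≠ 0 ∧ W (B j - A i) ≠ 0) :
    ZeroSearch W A B lb k i ((l + r) / 2) r := by
  obtain ⟨h₁, h₂, h₃, h₄, h₅⟩ := h
  rw [pow_succ] at h₃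
  exact ⟨by omega, by omega, by omega, h₄, h₀⟩

/-! ### The staircase of zeros and the binary searches in the duel matrix. -/

namespace Mergeable

variable {β : Type*} {m : ℕ} {W : ℕ → ℕ} {PS : ℕ → Option β} {TS : ℕ → ℕ → Option β}
  {cand occ : ℕ → Prop} {A B : ℕ → ℕ} {la lb : ℕ}

/-- The offset to the later column is the old offset plus the distance of two consistent elements of
`ℬ`, and consistency is additive. So a row, once zero, stays zero. -/
theorem W_right (h : Mergeable m W PS TS cand occ A B la lb) {i j j' : ℕ} (hi : 1 ≤ i)
    (hi' : i ≤ la) (hj : 1 ≤ j) (hjj' : j ≤ j') (hj' : j' ≤ lb) (h₀ : W (B j - A i) = 0) :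
    W (B j' - A i) = 0 := by
  rcases hjj'.eq_or_lt with rfl | hlt
  · exact h₀
  have h₁ := h.right.zero hj hlt hj'
  have h₂ := h.right.lt hj hlt hj'
  have h₃ := h.lt hi hi' hj (hjj'.trans hj')
  have h₄ := h.spec.cand_le (h.right.cand (hj.trans hjj') hj')
  have h₅ := h.spec.cand_pos (h.left.cand hi hi')
  have := h.spec.witness_add (by omega) h₁ h₀
  rwa [show B j' - B j + (B j - A i) = B j' - A i by omega] at this

/-- The same argument with two elements of `𝒜`: zeros also propagate to smaller row indices, which
completes the staircase. -/
theorem W_left (h : Mergeable m W PS TS cand occ A B la lb) {i i' j : ℕ} (hi : 1 ≤ i)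
    (hii' : i ≤ i') (hi' : i' ≤ la) (hj : 1 ≤ j) (hj' : j ≤ lb) (h₀ : W (B j - A i') = 0) :
    W (B j - A i) = 0 := by
  rcases hii'.eq_or_lt with rfl | hlt
  · exact h₀
  have h₁ := h.left.zero hi hlt hi'
  have h₂ := h.left.lt hi hlt hi'
  have h₃ := h.lt (hi.trans hii') hi' hj hj'
  have h₄ := h.spec.cand_le (h.right.cand hj hj')
  have h₅ := h.spec.cand_pos (h.left.cand hi (hii'.trans hi'))
  have := h.spec.witness_add (by omega) h₀ h₁
  rwa [show B j - A i' + (A i' - A i) = B j - A i by omega] at this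

theorem colSearch_zero (h : Mergeable m W PS TS cand occ A B la lb) {k i l r : ℕ}
    (hc : ColSearch W occ A B la lb (k + 1) i 0 l r) (hlr : l + 1 < r) (hi : 1 ≤ i) (hi' : i ≤ la)
    (h₀ : W (B ((l + r) / 2) - A i) = 0) :
    ColSearch W occ A B la lb k i 0 l ((l + r) / 2) := by
  obtain ⟨h₁, h₂, h₃, h₄, h₅, h₆⟩ := hc
  have := h₃ rfl
  rw [pow_succ] at this
  exact ⟨by omega, by omega, fun _ => by omega,
    fun j hj hj' => h.W_right hi hi' (by omega) hj hj' h₀, h₅, h₆⟩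

/-- All elements of `𝒜[i:]` are consistent with `𝒜[i]`, so one lost duel of `𝒜[i]` refutes them all
through `right_wins`. The search stops here, and for this reason the bound on the gap is only
required while `obs = 0`. -/
theorem colSearch_right (h : Mergeable m W PS TS cand occ A B la lb) {k i l r : ℕ}
    (hc : ColSearch W occ A B la lb (k + 1) i 0 l r) (hlr : l + 1 < r) (hi : 1 ≤ i)
    (h₀ : W (B ((l + r) / 2) - A i) ≠ 0) (hw : PS (W (B ((l + r) / 2) - A i)) =
      TS (B ((l + r) / 2)) (W (B ((l + r) / 2) - A i))) :
    ColSearch W occ A B la lb k i 1 l r := by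
  obtain ⟨h₁, h₂, h₃, h₄, h₅, h₆⟩ := hc
  refine ⟨h₁, h₂, by simp, h₄, h₅, fun _ i' hi' hi'a => ?_⟩
  have hA : A i ≤ A i' ∧ W (A i' - A i) = 0 := by
    rcases hi'.eq_or_lt with rfl | hlt
    · simp [h.spec.witness_zero]
    · exact ⟨(h.left.lt hi hlt hi'a).le, h.left.zero hi hlt hi'a⟩
  exact h.spec.right_wins hA.1 (h.lt (hi.trans hi') hi'a (by omega) (by omega))
    (h.left.cand hi (hi'.trans hi'a)) (h.left.cand (hi.trans hi') hi'a)
    (h.right.cand (by omega) (by omega)) hA.2 h₀ hw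

/-- A duel won by `𝒜[i]` refutes the inspected column and, by consistency inside `ℬ`, everything to
its left. The columns on the left need not be inspected. -/
theorem colSearch_left (h : Mergeable m W PS TS cand occ A B la lb) {k i l r : ℕ}
    (hc : ColSearch W occ A B la lb (k + 1) i 0 l r) (hlr : l + 1 < r) (hi : 1 ≤ i) (hi' : i ≤ la)
    (h₀ : W (B ((l + r) / 2) - A i) ≠ 0) (hw : PS (W (B ((l + r) / 2) - A i)) ≠
      TS (B ((l + r) / 2)) (W (B ((l + r) / 2) - A i))) :
    ColSearch W occ A B la lb k i 0 ((l + r) / 2) r := by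
  obtain ⟨h₁, h₂, h₃, h₄, h₅, h₆⟩ := hc
  have := h₃ rfl
  rw [pow_succ] at this
  refine ⟨by omega, h₂, fun _ => by omega, h₄, fun j hj hj' => ?_, h₆⟩
  have hB : B j ≤ B ((l + r) / 2) ∧ W (B ((l + r) / 2) - B j) = 0 := by
    rcases hj'.eq_or_lt with rfl | hlt
    · simp [h.spec.witness_zero]
    · exact ⟨(h.right.lt hj hlt (by omega)).le, h.right.zero hj hlt (by omega)⟩
  exact h.spec.left_wins (h.lt hi hi' hj (by omega)) hB.1 (h.left.cand hi hi')
    (h.right.cand hj (by omega)) (h.right.cand (by omega) (by omega)) hB.2 h₀ hw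

theorem rowSearch_hi {k k' i l r obs l' r' : ℕ}
    (hr : RowSearch W occ A B la lb (k + 1) l r) (hlr : l + 1 < r) (hi : i = (l + r) / 2)
    (hc : ColSearch W occ A B la lb k' i obs l' r') (hobs : obs ≠ 0) :
    RowSearch W occ A B la lb k l i := by
  obtain ⟨h₁, h₂, h₃, h₄, h₅⟩ := hr
  rw [pow_succ] at h₃
  exact ⟨by omega, by omega, by omega, hc.obs hobs, h₅⟩

/-- With the bounds adjacent, every column is either in the zero part or already refuted. The row
may still contain a 1 in a column that was never inspected; this does no harm, since that column has
been refuted as well. -/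
theorem rowSearch_lo {k k' i l r l' r' : ℕ}
    (hr : RowSearch W occ A B la lb (k + 1) l r) (hlr : l + 1 < r) (hi : i = (l + r) / 2)
    (hc : ColSearch W occ A B la lb k' i 0 l' r') (hlr' : ¬ l' + 1 < r') :
    RowSearch W occ A B la lb k i r := by
  obtain ⟨h₁, h₂, h₃, h₄, h₅⟩ := hr
  rw [pow_succ] at h₃
  refine ⟨by omega, by omega, by omega, h₄, Or.inr fun j hj hj' => ?_⟩
  rcases lt_or_ge l' j with h | h
  · exact Or.inl (hc.zero j (by omega) hj')
  · exact Or.inr (hc.lose j hj h)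

/-- Zeros of row `l` pass to all smaller rows by `W_left`, which gives consistency of what is kept.
A dropped column is nonzero in row `l`, hence refuted by the invariant of the row search. For `l =
0` the invariant `ZeroSearch.ne` allows no column to be dropped. -/
theorem isMerge (h : Mergeable m W PS TS cand occ A B la lb) {k k' l r l' r' : ℕ}
    (hr : RowSearch W occ A B la lb k l r) (hlr : ¬ l + 1 < r)
    (hz : ZeroSearch W A B lb k' l l' r') (hlr' : ¬ l' + 1 < r') :
    IsMerge W occ A B la lb l r' := by
  obtain ⟨h₁, h₂, h₃, h₄, h₅⟩ := hr
  obtain ⟨g₁, g₂, g₃, g₄, g₅⟩ := hz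
  refine ⟨by omega, by omega, g₂, fun i j hi hil hj hj' => ?_, fun i hi hi' => h₄ i (by omega) hi',
    fun j hj hj' => ?_⟩
  · exact h.W_left hi hil (by omega) (by omega) hj' ((g₄ j hj hj').resolve_left (by omega))
  · have := g₅ j hj (by omega)
    exact ((h₅.resolve_left this.1) j hj (by omega)).resolve_left this.2

end Mergeable

/-- The registers that `merge` changes. -/
def mergeRegs : List Reg := [.l1, .r1, .l2, .r2, .m1, .m2, .obs, .w]

section MergeProgram

variable {β : Type*} {I : Input β} {M : Arr → ℕ → ℕ} {m Xt Xw : ℕ} {ρ : Proc → Reg → ℕ}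
  {cand occ : Proc → ℕ → Prop}

/-- What `merge` needs of the registers of a processor. -/
structure MergeReady (I : Input β) (M : Arr → ℕ → ℕ) (m Xt Xw : ℕ) (cand occ : ℕ → Prop)
    (ρ : Reg → ℕ) : Prop where
  mergeable : Mergeable m (M .W) (sym (I.str 0)) (I.re (I.str (ρ .q + 1))) cand occ
    (fun i => M .D (ρ .s + i)) (fun j => M .D (ρ .s + ρ .h + j)) (ρ .la) (ρ .lb)
  time : ∀ x, cand x → I.ξt (I.str (ρ .q + 1)).length ≤ Xt
  work : ∀ x, cand x → I.ξw (I.str (ρ .q + 1)).length ≤ Xw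

def MergeFrame (ρ : Reg → ℕ) (L : Loc β) : Prop := ∀ r, r ∉ mergeRegs → L.reg r = ρ r

theorem MergeFrame.set {ρ : Reg → ℕ} {L : Loc β} (h : MergeFrame ρ L) {r : Reg} (hr : r ∈ mergeRegs)
    (v : ℕ) : MergeFrame ρ (L.set r v) := by
  intro r' hr'
  rw [Loc.set_reg, if_neg (by rintro rfl; exact hr' hr), h r' hr']

theorem MergeFrame.setSym {ρ : Reg → ℕ} {L : Loc β} (h : MergeFrame ρ L) (s : SReg)
    (v : Option β) : MergeFrame ρ (L.setSym s v) := h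

/-- The nested sum mirrors the text of `merge`: two nested searches of at most `K + 1` loop tests
each, followed by a single one; `X` is the cost of one re-encoding. -/
theorem merge_bound (K X : ℕ) :
    2 + (4 + ((K + 1) * (6 + (6 + (2 + (2 + (4 + ((K + 1) * (10 + (6 + (13 + (6 + (3 + (11 + X +
      6)))))) + 6)))))) + (2 + (4 + (K + 1) * 37)))) ≤ 130 * (K + 1) ^ 2 * (X + 1) := by
  ring_nf
  nlinarith [Nat.zero_le (K ^ 2 * X), Nat.zero_le (K * X), Nat.zero_le (K ^ 2)]

/-- Each search halves an interval whose initial length `la + 1` or `lb + 1` is at most `2 ^ K`, so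
the exponent in the invariants serves as the countdown of `Triple.loop`. -/
theorem merge_triple {K : ℕ} {S : Finset Proc}
    (hla : ∀ p ∈ S, ρ p .la + 1 ≤ 2 ^ K) (hlb : ∀ p ∈ S, ρ p .lb + 1 ≤ 2 ^ K)
    (hready : ∀ p ∈ S, MergeReady I M m Xt Xw (cand p) (occ p) (ρ p)) :
    Triple I M merge (fun p L => p ∈ S ∧ MergeFrame (ρ p) L)
      (fun p L => MergeFrame (ρ p) L ∧
        IsMerge (M .W) (occ p) (fun i => M .D (ρ p .s + i))
          (fun j => M .D (ρ p .s + ρ p .h + j)) (ρ p .la) (ρ p .lb) (L.reg .l1) (L.reg .r2))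
      (130 * (K + 1) ^ 2 * (Xt + 1)) (130 * (K + 1) ^ 2 * (Xw + 1)) := by
  let A : Proc → ℕ → ℕ := fun p i => M .D (ρ p .s + i)
  let B : Proc → ℕ → ℕ := fun p j => M .D (ρ p .s + ρ p .h + j)
  let row : ℕ → Proc → Loc β → Prop := fun k p L => (p ∈ S ∧ MergeFrame (ρ p) L) ∧
    RowSearch (M .W) (occ p) (A p) (B p) (ρ p .la) (ρ p .lb) k (L.reg .l1) (L.reg .r1)
  let col : ℕ → ℕ → Proc → Loc β → Prop := fun k k' p L => row k p L ∧
    L.reg .l1 + 1 < L.reg .r1 ∧ L.reg .m1 = (L.reg .l1 + L.reg .r1) / 2 ∧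
    ColSearch (M .W) (occ p) (A p) (B p) (ρ p .la) (ρ p .lb) k' (L.reg .m1) (L.reg .obs)
      (L.reg .l2) (L.reg .r2)
  let zer : ℕ → Proc → Loc β → Prop := fun k p L => (∃ k', row k' p L) ∧
    ¬ L.reg .l1 + 1 < L.reg .r1 ∧
    ZeroSearch (M .W) (A p) (B p) (ρ p .lb) k (L.reg .l1) (L.reg .l2) (L.reg .r2)
  have hfr : ∀ {p : Proc} {L : Loc β} {r : Reg} {v : ℕ}, r ∈ mergeRegs →
      p ∈ S ∧ MergeFrame (ρ p) L → p ∈ S ∧ MergeFrame (ρ p) (L.set r v) :=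
    fun hr h => ⟨h.1, h.2.set hr _⟩
  have hreg : ∀ {p : Proc} {L : Loc β}, MergeFrame (ρ p) L → L.reg .s = ρ p .s ∧
      L.reg .h = ρ p .h ∧ L.reg .q = ρ p .q ∧ L.reg .la = ρ p .la ∧ L.reg .lb = ρ p .lb :=
    fun h => ⟨h _ (by decide), h _ (by decide), h _ (by decide), h _ (by decide),
      h _ (by decide)⟩
  -- The inner search is carried out for each state `k + 1` of the outer countdown and leaves the
  -- outer invariant untouched.
  have hin : ∀ k, _ := fun k => Triple.loop (I := I) (M := M) (inv := col (k + 1))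
    (e := (Reg.l2 + 1 <ₑ Reg.r2) ∧ₑ (Reg.obs =ₑ 0))
    (fun k' => Triple.of_imp (.seq (.assign .m2 ((Reg.l2 + Reg.r2) / 2))
      (.seq (.assign .w (.ld .W (.ld .D (Reg.s + Reg.h + Reg.m2) - .ld .D (Reg.s + Reg.m1))))
      (.ite' (e := Reg.w =ₑ 0) (.assign .r2 Reg.m2) (.seq (.loadSym .c 0 Reg.w)
      (.seq (.reenc .d (Reg.q + 1) (.ld .D (Reg.s + Reg.h + Reg.m2)) Reg.w Xt Xw)
      (.ite' (e := .symEq .c .d) (.assign .obs 1) (.assign .l2 Reg.m2)))))))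
      (fun p L hL => by
        obtain ⟨⟨⟨⟨hS, hF⟩, hr⟩, hlt, hm, hc⟩, hne⟩ := hL
        obtain ⟨hs, hh, hq, -, -⟩ := hreg hF
        obtain ⟨hlt', hobs⟩ : L.reg .l2 + 1 < L.reg .r2 ∧ L.reg .obs = 0 := by
          simpa using hne
        have hR := hready p hS
        have h₁ : 1 ≤ L.reg .m1 := by omega
        have h₂ : L.reg .m1 ≤ ρ p .la := by have := hr.le; omega
        rw [hobs] at hc
        have h₄ := hR.mergeable.colSearch_zero hc hlt' h₁ h₂
        have h₅ := hR.mergeable.colSearch_right hc hlt' h₁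
        have h₆ := hR.mergeable.colSearch_left hc hlt' h₁ h₂
        -- The cost bounds are only available for pieces that contain a candidate; the element of
        -- `𝒜` in the current row is one.
        have h₇ := hR.time _ (hR.mergeable.left.cand h₁ h₂)
        have h₈ := hR.work _ (hR.mergeable.left.cand h₁ h₂)
        have hF₂ := hF.set (r := .m2) (by decide) ((L.reg .l2 + L.reg .r2) / 2)
        have hF₃ := hF₂.set (r := .w) (by decide)
          (M .W (B p ((L.reg .l2 + L.reg .r2) / 2) - A p (L.reg .m1)))
        simp only [A, B] at h₄ h₅ h₆ hF₃
        simp only [col, row, Loc.set_reg, Loc.eval_reg, Loc.eval_add, Loc.eval_div, Loc.eval_ld,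
          Loc.eval_sub, Loc.eval_zero, Loc.eval_one, Loc.eval_two, hs, hh, hq, hobs, reduceCtorEq,
          if_true, if_false, Loc.setSym_reg, Loc.setSym_sreg, Loc.eval_eq_eq_zero,
          Loc.eval_symEq_eq_zero, ne_eq, not_not]
        refine ⟨fun h => ?_, fun h => ⟨⟨fun h' => ?_, fun h' => ?_⟩, h₇, h₈⟩⟩
        · exact ⟨⟨⟨hS, hF₃.set (by decide) _⟩, hr⟩, hlt, hm, h₄ h⟩
        · exact ⟨⟨⟨hS, ((hF₃.setSym _ _).setSym _ _).set (by decide) _⟩, hr⟩, hlt, hm, h₅ h h'⟩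
        · exact ⟨⟨⟨hS, ((hF₃.setSym _ _).setSym _ _).set (by decide) _⟩, hr⟩, hlt, hm, h₆ h h'⟩))
    -- At countdown 0 either a 1 has been seen or the interval has length at most `2 ^ 0`; both make
    -- the test fail.
    (fun p L hL => by
      obtain ⟨-, -, -, hc⟩ := hL
      have h₁ := hc.lt
      have h₂ := hc.gap
      simp
      by_contra h
      have := h₂ (by omega)
      omega) K
  have hout := Triple.loop (I := I) (M := M) (inv := row) (e := Reg.l1 + 1 <ₑ Reg.r1)
    (fun k => Triple.of_imp (.seq (.assign .m1 ((Reg.l1 + Reg.r1) / 2))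
      (.seq (.assign .obs 0) (.seq (.assign .l2 0) (.seq (.assign .r2 (Reg.lb + 1))
      (.seq ((hin k).weaken (fun _ _ h => h) (fun p L hL => by
        obtain ⟨hne, k', ⟨⟨hS, hF⟩, hr⟩, hlt, hm, hc⟩ := hL
        have hne' : L.reg .r2 ≤ L.reg .l2 + 1 ∨ ¬ L.reg .obs = 0 := by simpa using hne
        simp only [row, Loc.set_reg, Loc.eval_reg, ne_eq, reduceCtorEq, if_true, if_false]
        refine ⟨fun h => ?_, fun h => ?_⟩
        · exact ⟨⟨hS, hF.set (by decide) _⟩, Mergeable.rowSearch_hi hr hlt hm hc h⟩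
        · rw [h] at hc
          exact ⟨⟨hS, hF.set (by decide) _⟩, Mergeable.rowSearch_lo hr hlt hm hc (by omega)⟩))
      (.ite' (e := Reg.obs) (.assign .r1 Reg.m1) (.assign .l1 Reg.m1)))))))
      (fun p L hL => by
        obtain ⟨⟨⟨hS, hF⟩, hr⟩, hne⟩ := hL
        obtain ⟨-, -, -, -, hlb'⟩ := hreg hF
        have hlt : L.reg .l1 + 1 < L.reg .r1 := by simpa using hne
        simp only [col, row, Loc.set_reg, Loc.eval_reg, Loc.eval_add, Loc.eval_div, Loc.eval_zero,
          Loc.eval_one, Loc.eval_two, reduceCtorEq, if_true, if_false, hlb', true_and]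
        refine ⟨⟨⟨hS, ?_⟩, hr⟩, hlt, ⟨by omega, le_rfl, fun _ => hlb p hS,
          fun j h₁ h₂ => by omega, fun j h₁ h₂ => by omega, fun h => absurd rfl h⟩⟩
        exact (((hF.set (by decide) _).set (by decide) _).set (by decide) _).set (by decide) _))
    (fun p L hL => by
      have h₁ := hL.2.lt
      have h₂ := hL.2.gap
      simp
      omega) K
  have hzer := Triple.loop (I := I) (M := M) (inv := zer) (e := Reg.l2 + 1 <ₑ Reg.r2)
    (fun k => Triple.of_imp (.seq (.assign .m2 ((Reg.l2 + Reg.r2) / 2))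
      (.ite' (e := Reg.l1 =ₑ 0) (.assign .r2 Reg.m2)
      (.ite' (e := .ld .W (.ld .D (Reg.s + Reg.h + Reg.m2) - .ld .D (Reg.s + Reg.l1)) =ₑ 0)
      (.assign .r2 Reg.m2) (.assign .l2 Reg.m2)))) (fun p L hL => by
        obtain ⟨⟨⟨k', ⟨hS, hF⟩, hr⟩, hnlt, hz⟩, hne⟩ := hL
        obtain ⟨hs, hh, -, -, -⟩ := hreg hF
        have hlt : L.reg .l2 + 1 < L.reg .r2 := by simpa using hne
        have hR := (hready p hS).mergeable
        have h₁ := hr.lt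
        have h₂ := hr.le
        have hF₂ : ∀ {r v w}, r ∈ mergeRegs → MergeFrame (ρ p) ((L.set .m2 v).set r w) :=
          fun hr => (hF.set (by decide) _).set hr _
        simp only [zer, row, Loc.set_reg, Loc.eval_reg, Loc.eval_add, Loc.eval_div, Loc.eval_ld,
          Loc.eval_sub, Loc.eval_zero, Loc.eval_two, hs, hh, reduceCtorEq, if_true,
          if_false, Loc.eval_eq_eq_zero, ne_eq, not_not]
        refine ⟨fun h => ?_, fun h => ⟨fun h' => ?_, fun h' => ?_⟩⟩
        · exact ⟨⟨k', ⟨hS, hF₂ (by decide)⟩, hr⟩, hnlt,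
            hz.left_of_zero hlt fun j _ _ => Or.inl h⟩
        · exact ⟨⟨k', ⟨hS, hF₂ (by decide)⟩, hr⟩, hnlt, hz.left_of_zero hlt fun j hj hj' =>
            Or.inr (hR.W_right (by omega) (by omega) (by have := hz.lt; omega) hj hj' h')⟩
        · exact ⟨⟨k', ⟨hS, hF₂ (by decide)⟩, hr⟩, hnlt, hz.right_of_ne hlt fun j hj hj' =>
            ⟨h, fun h₀ => h' (hR.W_right (by omega) (by omega) hj hj'
              (by have := hz.le; omega) h₀)⟩⟩))
    (fun p L hL => by
      obtain ⟨-, -, hz⟩ := hL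
      have h₁ := hz.lt
      have h₂ := hz.gap
      simp
      omega) K
  refine Triple.mono (Triple.of_imp (.seq (.assign .l1 0) (.seq (.assign .r1 (Reg.la + 1))
    (.seq (hout.weaken (fun _ _ h => h) (fun p L hL => by
      obtain ⟨hne, k', ⟨hS, hF⟩, hr⟩ := hL
      obtain ⟨-, -, -, -, hlb'⟩ := hreg hF
      have hnlt : ¬ L.reg .l1 + 1 < L.reg .r1 := by simpa using hne
      simp only [zer, row, Loc.set_reg, Loc.eval_reg, Loc.eval_add, Loc.eval_zero, Loc.eval_one,
        reduceCtorEq, if_true, if_false, hlb']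
      exact ⟨⟨k', ⟨hS, (hF.set (by decide) _).set (by decide) _⟩, hr⟩, hnlt,
        ⟨by omega, le_rfl, hlb p hS, fun j _ _ => by omega, fun j _ _ => by omega⟩⟩))
    (.seq (.assign .l2 0) (.seq (.assign .r2 (Reg.lb + 1))
    (hzer.weaken (fun _ _ h => h) (fun p L hL => by
      obtain ⟨hne, k, ⟨k', ⟨hS, hF⟩, hr⟩, hnlt, hz⟩ := hL
      have hne' : ¬ L.reg .l2 + 1 < L.reg .r2 := by simpa using hne
      exact ⟨hF, (hready p hS).mergeable.isMerge hr hnlt hz hne'⟩)))))))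
    (fun p L hL => by
      obtain ⟨hS, hF⟩ := hL
      obtain ⟨-, -, -, hla', -⟩ := hreg hF
      simp only [row, Loc.set_reg, Loc.eval_reg, Loc.eval_add, Loc.eval_zero, Loc.eval_one,
        reduceCtorEq, if_true, if_false, hla']
      exact ⟨⟨hS, (hF.set (by decide) _).set (by decide) _⟩, ⟨by omega, le_rfl, hla p hS,
        fun j _ _ => by omega, Or.inl rfl⟩⟩)) ?_ ?_
  all_goals
    simp only [Expr.size_zero, Expr.size_one, Expr.size_two, Expr.size_reg, Expr.size_symEq,
      Expr.size_ld, Expr.size_op, Expr.size_add, Expr.size_sub, Expr.size_div]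
  · have := merge_bound K Xt
    linarith
  · have := merge_bound K Xw
    linarith

end MergeProgram

/-! ## The dueling stage -/

/-- `A[1 : n]` is the list of the surviving candidates in the block `lo + 1, …, hi`. -/
structure IsBlock (W : ℕ → ℕ) (cand occ : ℕ → Prop) (A : ℕ → ℕ) (n lo hi : ℕ) : Prop where
  list : IsCandList W cand A n
  lo_lt : ∀ {i}, 1 ≤ i → i ≤ n → lo < A i
  le_hi : ∀ {i}, 1 ≤ i → i ≤ n → A i ≤ hi
  complete : ∀ {x}, lo < x → x ≤ hi → cand x → occ x → ∃ i, 1 ≤ i ∧ i ≤ n ∧ A i = x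

namespace IsBlock

variable {W : ℕ → ℕ} {cand occ : ℕ → Prop} {A B : ℕ → ℕ} {n lo hi la lb h l r : ℕ}

theorem congr {A' : ℕ → ℕ} (hb : IsBlock W cand occ A n lo hi)
    (hA : ∀ i, 1 ≤ i → i ≤ n → A' i = A i) : IsBlock W cand occ A' n lo hi := by
  constructor
  · constructor
    · intro i j h₁ h₂ h₃
      rw [hA i h₁ (by omega), hA j (by omega) h₃]
      exact hb.list.lt h₁ h₂ h₃
    · intro i j h₁ h₂ h₃
      rw [hA i h₁ (by omega), hA j (by omega) h₃]
      exact hb.list.zero h₁ h₂ h₃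
    · intro i h₁ h₂
      rw [hA i h₁ h₂]
      exact hb.list.cand h₁ h₂
  · intro i h₁ h₂
    rw [hA i h₁ h₂]
    exact hb.lo_lt h₁ h₂
  · intro i h₁ h₂
    rw [hA i h₁ h₂]
    exact hb.le_hi h₁ h₂
  · intro x h₁ h₂ h₃ h₄
    obtain ⟨i, k₁, k₂, k₃⟩ := hb.complete h₁ h₂ h₃ h₄
    exact ⟨i, k₁, k₂, (hA i k₁ k₂).trans k₃⟩

theorem add_le (hb : IsBlock W cand occ A n lo hi) : ∀ {i}, 1 ≤ i → i ≤ n → lo + i ≤ A i := by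
  intro i h₁ h₂
  induction i, h₁ using Nat.le_induction with
  | base => exact hb.lo_lt le_rfl h₂
  | succ i h₁ ih =>
    have := ih (by omega)
    have : A i < A (i + 1) := hb.list.lt h₁ (Nat.lt_succ_self i) h₂
    omega

theorem lo_add_le (hb : IsBlock W cand occ A n lo hi) (h : lo ≤ hi) : lo + n ≤ hi := by
  rcases Nat.eq_zero_or_pos n with rfl | hn
  · simpa using h
  · exact (hb.add_le hn le_rfl).trans (hb.le_hi hn le_rfl)

/-- The last block may extend beyond position `m`, but candidates do not. So the stored list stays
inside the cells of its own piece. -/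
theorem lo_add_le_of_cand (hb : IsBlock W cand occ A n lo hi) {m : ℕ} (h : lo ≤ m)
    (hm : ∀ x, cand x → x ≤ m) : lo + n ≤ m := by
  rcases Nat.eq_zero_or_pos n with rfl | hn
  · simpa using h
  · exact (hb.add_le hn le_rfl).trans (hm _ (hb.list.cand hn le_rfl))

theorem of_empty (h : ∀ x, cand x → x ≤ lo) : IsBlock W cand occ A 0 lo hi :=
  ⟨⟨fun _ _ _ => by omega, fun _ _ _ => by omega, fun _ _ => by omega⟩, fun _ _ => by omega,
    fun _ _ => by omega, fun h₁ _ h₂ => by have := h _ h₂; omega⟩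

theorem single {x : ℕ} (hx : cand x) (hxl : x = lo + 1) (hA : A 1 = x) :
    IsBlock W cand occ A 1 lo (lo + 1) := by
  have h : ∀ {i}, 1 ≤ i → i ≤ 1 → A i = x := fun h₁ h₂ => by rw [le_antisymm h₂ h₁, hA]
  exact ⟨⟨fun _ _ _ => by omega, fun _ _ _ => by omega, fun h₁ h₂ => by rwa [h h₁ h₂]⟩,
    fun h₁ h₂ => by rw [h h₁ h₂]; omega, fun h₁ h₂ => by rw [h h₁ h₂]; omega,
    fun h₁ h₂ _ _ => ⟨1, le_rfl, le_rfl, by omega⟩⟩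

theorem mergeable {β : Type*} {m : ℕ} {PS : ℕ → Option β} {TS : ℕ → ℕ → Option β} {mid : ℕ}
    (hspec : PieceSpec m W PS TS cand occ) (hA : IsBlock W cand occ A la lo mid)
    (hB : IsBlock W cand occ B lb mid hi) : Mergeable m W PS TS cand occ A B la lb :=
  ⟨hspec, hA.list, hB.list, fun h₁ h₂ h₃ h₄ => (hA.le_hi h₁ h₂).trans_lt (hB.lo_lt h₃ h₄)⟩

theorem merge {mid : ℕ} (hA : IsBlock W cand occ A la lo mid)
    (hB : IsBlock W cand occ B lb mid hi) (hlo : lo ≤ mid) (hhi : mid ≤ hi)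
    (hM : IsMerge W occ A B la lb l r) :
    IsBlock W cand occ (fun t => if t ≤ l then A t else B (t - l - 1 + r)) (l + (lb + 1 - r)) lo
      hi := by
  obtain ⟨h₁, h₂, h₃, h₄, h₅, h₆⟩ := hM
  constructor
  · constructor
    · intro i j hi hij hj
      split_ifs with k₁ k₂ k₂
      · exact hA.list.lt hi hij (by omega)
      · exact (hA.le_hi hi (by omega)).trans_lt (hB.lo_lt (by omega) (by omega))
      · omega
      · exact hB.list.lt (by omega) (by omega) (by omega)
    · intro i j hi hij hj
      split_ifs with k₁ k₂ k₂
      · exact hA.list.zero hi hij (by omega)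
      · omega
      · exact h₄ _ _ hi (by omega) (by omega) (by omega)
      · exact hB.list.zero (by omega) (by omega) (by omega)
    · intro i hi hi'
      split_ifs with k₁
      · exact hA.list.cand hi (by omega)
      · exact hB.list.cand (by omega) (by omega)
  · intro i hi hi'
    split_ifs with k₁
    · exact hA.lo_lt hi (by omega)
    · exact hlo.trans_lt (hB.lo_lt (by omega) (by omega))
  · intro i hi hi'
    split_ifs with k₁
    · exact (hA.le_hi hi (by omega)).trans hhi
    · exact hB.le_hi (by omega) (by omega)
  · intro x hx hx' hc ho
    rcases le_or_gt x mid with h | h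
    · obtain ⟨i, k₁, k₂, k₃⟩ := hA.complete hx h hc ho
      have : i ≤ l := by
        by_contra hi
        exact h₅ i (by omega) k₂ (k₃ ▸ ho)
      exact ⟨i, k₁, by omega, by simp [this, k₃]⟩
    · obtain ⟨j, k₁, k₂, k₃⟩ := hB.complete h hx' hc ho
      have : r ≤ j := by
        by_contra hj
        exact h₆ j k₁ (by omega) (k₃ ▸ ho)
      refine ⟨l + (j - r) + 1, by omega, by omega, ?_⟩
      rw [if_neg (by omega), show l + (j - r) + 1 - l - 1 + r = j by omega, k₃]

end IsBlock

/-- Since `x - 1 < m`, the quotient of `q * m + x - 1` by `m` is `q`. This keeps the cells of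
different pieces apart, and later also those of different blocks. -/
theorem addr_inj {m q q' x x' : ℕ} (hx : 1 ≤ x) (hxm : x ≤ m) (hx' : 1 ≤ x') (hxm' : x' ≤ m)
    (h : q * m + x = q' * m + x') : q = q' ∧ x = x' := by
  have h₁ : ∀ {q x}, 1 ≤ x → x ≤ m → (q * m + x - 1) / m = q := by
    intro q x hx hxm
    rw [show q * m + x - 1 = (x - 1) + q * m by omega, Nat.add_mul_div_right _ _ (by omega),
      Nat.div_eq_of_lt (by omega), zero_add]
  have h₂ : q = q' := by rw [← h₁ (q := q) hx hxm, h, h₁ hx' hxm']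
  subst h₂
  exact ⟨rfl, by omega⟩

/-- The processors of the pieces `0, …, Q`. -/
def pieces (Q : ℕ) : Finset Proc := children {[]} (fun _ => 0) (fun _ => Q)

theorem mem_pieces {Q : ℕ} {p : Proc} : p ∈ pieces Q ↔ ∃ q ≤ Q, p = [q] := by
  simp [pieces, mem_children, eq_comm]

theorem length_of_mem_pieces {Q : ℕ} : ∀ p ∈ pieces Q, p.length = 1 := by
  intro p hp
  obtain ⟨q, -, rfl⟩ := mem_pieces.1 hp
  rfl

theorem card_pieces (Q : ℕ) : (pieces Q).card = Q + 1 := by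
  simp [pieces, card_children]

theorem mem_children_pieces {Q : ℕ} {lo hi : Proc → ℕ} {p : Proc} :
    p ∈ children (pieces Q) lo hi ↔ ∃ q x, q ≤ Q ∧ lo [q] ≤ x ∧ x ≤ hi [q] ∧ p = [q, x] := by
  rw [mem_children]
  constructor
  · rintro ⟨p₀, hp₀, x, h₁, h₂, rfl⟩
    obtain ⟨q, hq, rfl⟩ := mem_pieces.1 hp₀
    exact ⟨q, x, hq, h₁, h₂, rfl⟩
  · rintro ⟨q, x, hq, h₁, h₂, rfl⟩
    exact ⟨[q], mem_pieces.2 ⟨q, hq, rfl⟩, x, h₁, h₂, rfl⟩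

section Machine

variable {β : Type*} {I : Input β}

@[simp] theorem State.fork_mem (σ : State β) (S' : Finset Proc) (r : Reg) :
    (σ.fork S' r).mem = σ.mem := rfl

theorem State.fork_reg_pair (σ : State β) {S' : Finset Proc} (r : Reg) {q x : ℕ}
    (h : [q, x] ∈ S') (r' : Reg) :
    (σ.fork S' r).reg [q, x] r' = if r' = r then x else σ.reg [q] r' :=
  σ.fork_reg (p := [q]) r h r'

theorem State.fork_reg_triple (σ : State β) {S' : Finset Proc} (r : Reg) {q x y : ℕ}
    (h : [q, x, y] ∈ S') (r' : Reg) :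
    (σ.fork S' r).reg [q, x, y] r' = if r' = r then y else σ.reg [q, x] r' :=
  σ.fork_reg (p := [q, x]) r h r'

/-- Programs associate to the right, while proofs like to treat an initial segment as one command;
regrouping changes neither time nor work. -/
theorem Runs.seq_assoc {c₁ c₂ c₃ : Cmd} {S : Finset Proc} {σ : State β} {T N : ℕ}
    {Q : State β → Prop} (h : Runs I ((c₁ ;; c₂) ;; c₃) S σ T N Q) :
    Runs I (c₁ ;; (c₂ ;; c₃)) S σ T N Q := by
  obtain ⟨σ', t, w, he, ht, hw, hQ⟩ := h
  cases he with
  | seq _ _ _ _ _ _ _ _ _ _ h₁ h₃ =>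
    cases h₁ with
    | seq _ _ _ _ _ _ _ _ _ _ h₁ h₂ =>
      exact ⟨σ', _, _, .seq _ _ _ _ _ _ _ _ _ _ h₁ (.seq _ _ _ _ _ _ _ _ _ _ h₂ h₃),
        by omega, by omega, hQ⟩

theorem Runs.par_straight {r : Reg} {lo hi : Expr} {c : Cmd} (hc : c.straight = true)
    {S S' : Finset Proc} {σ : State β}
    (hS' : S' = children S (fun p => σ.eval p lo) (fun p => σ.eval p hi)) :
    Runs I (.par r lo hi c) S σ (lo.size + hi.size + 1 + c.cost)
      (S.card * (lo.size + hi.size + 1) + S'.card * (1 + c.cost))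
      (fun σ' => σ' = c.run I S' (σ.fork S' r)) :=
  (Runs.par hS' (.of_straight hc _ _)).mono le_rfl (by rw [mul_add S'.card]; omega)

/-- The registers that are set before the stages start. -/
structure IsPieceState (m n Q : ℕ) (σ : State β) : Prop where
  q : ∀ q ≤ Q, σ.reg [q] .q = q
  base : ∀ q ≤ Q, σ.reg [q] .base = q * m
  m : ∀ q ≤ Q, σ.reg [q] .m = m
  n : ∀ q ≤ Q, σ.reg [q] .n = n

theorem IsPieceState.congr {m n Q : ℕ} {σ σ' : State β} (h : IsPieceState m n Q σ)
    (h' : ∀ q, ∀ r ∈ [Reg.q, .base, .m, .n], σ'.reg [q] r = σ.reg [q] r) :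
    IsPieceState m n Q σ' :=
  ⟨fun q hq => by rw [h' q _ (by decide), h.q q hq],
    fun q hq => by rw [h' q _ (by decide), h.base q hq],
    fun q hq => by rw [h' q _ (by decide), h.m q hq],
    fun q hq => by rw [h' q _ (by decide), h.n q hq]⟩

/-- The parallel loop over the positions of a piece. -/
def positions (Q m : ℕ) : Finset Proc := children (pieces Q) (fun _ => 1) (fun _ => m)

theorem mem_positions {Q m : ℕ} {p : Proc} :
    p ∈ positions Q m ↔ ∃ q x, q ≤ Q ∧ 1 ≤ x ∧ x ≤ m ∧ p = [q, x] := mem_children_pieces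

theorem pair_mem_positions {Q m q x : ℕ} : [q, x] ∈ positions Q m ↔ q ≤ Q ∧ 1 ≤ x ∧ x ≤ m := by
  rw [mem_positions]
  constructor
  · rintro ⟨q, x, h₁, h₂, h₃, h⟩
    cases h
    exact ⟨h₁, h₂, h₃⟩
  · rintro ⟨h₁, h₂, h₃⟩
    exact ⟨q, x, h₁, h₂, h₃, rfl⟩

theorem card_positions (Q m : ℕ) : (positions Q m).card = (Q + 1) * m := by
  simp [positions, card_children, card_pieces]

theorem children_pieces_congr {Q k : ℕ} {lo hi : Proc → ℕ} (h₁ : ∀ q ≤ Q, lo [q] = 1)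
    (h₂ : ∀ q ≤ Q, hi [q] = k) : positions Q k = children (pieces Q) lo hi := by
  ext p
  rw [mem_positions, mem_children_pieces]
  constructor
  · rintro ⟨q, x, hq, h⟩
    exact ⟨q, x, hq, by rwa [h₁ q hq, h₂ q hq]⟩
  · rintro ⟨q, x, hq, h⟩
    exact ⟨q, x, hq, by rwa [h₁ q hq, h₂ q hq] at h⟩

/-- Writing the cells `q * m + x - d`. -/
theorem State.write_pair (σ : State β) {Q m d q x : ℕ} (hd : d ≤ 1) {S : Finset Proc}
    (hS : S ⊆ positions Q m) {A : Arr}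
    {a v : Proc → ℕ} (ha : ∀ q x, [q, x] ∈ S → a [q, x] = q * m + x - d) (h : [q, x] ∈ S) :
    (σ.write S A a v).mem A (q * m + x - d) = v [q, x] := by
  rw [← ha q x h]
  refine σ.write_mem_of_inj v h fun p' hp' hpa => ?_
  obtain ⟨q', x', hq', hx', hxm', rfl⟩ := mem_positions.1 (hS hp')
  obtain ⟨hq, hx, hxm⟩ := pair_mem_positions.1 (hS h)
  rw [ha _ _ hp', ha _ _ h] at hpa
  obtain ⟨rfl, rfl⟩ := addr_inj hx' hxm' hx hxm (show q' * m + x' = q * m + x by omega)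
  rfl

/-- The invariant of the dueling stage for blocks of size `h`. -/
def DuelInv (W : ℕ → ℕ) (cand occ : ℕ → ℕ → Prop) (m Q h : ℕ) (M : Arr → ℕ → ℕ) : Prop :=
  ∀ q ≤ Q, ∀ j, j * h < m → IsBlock W (cand q) (occ q) (fun i => M .D (q * m + j * h + i))
    (M .Len (q * m + j * h)) (j * h) (j * h + h)

theorem duel_init {W : ℕ → ℕ} {m n Q : ℕ} {occ : ℕ → ℕ → Prop} {σ : State β}
    (hσ : IsPieceState m n Q σ) :
    Runs I (.par .x 1 Reg.m (
      .store .D (Reg.base + Reg.x) Reg.x ;;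
      .store .Len (Reg.base + Reg.x - 1) (Reg.base + Reg.x + Reg.m ≤ₑ Reg.n + 1))) (pieces Q) σ
      30 ((Q + 1) * m * 21 + (Q + 1) * 3)
      (fun σ' => DuelInv W (fun q x => 1 ≤ x ∧ x ≤ m ∧ q * m + x + m ≤ n + 1) occ m Q 1
        σ'.mem) := by
  have hS := children_pieces_congr (Q := Q) (k := m) (lo := fun p => σ.eval p 1)
    (hi := fun p => σ.eval p Reg.m) (fun q hq => rfl) (fun q hq => hσ.m q hq)
  refine ((Runs.par_straight (by rfl) hS).imp ?_).mono ?_ ?_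
  · rintro σ' rfl q hq j hj
    have hmem : [q, j + 1] ∈ positions Q m := pair_mem_positions.2 ⟨hq, by omega, by omega⟩
    set τ := σ.fork (positions Q m) .x with hτ
    have hreg : ∀ q x, [q, x] ∈ positions Q m → τ.reg [q, x] .base = q * m ∧
        τ.reg [q, x] .x = x ∧ τ.reg [q, x] .m = m ∧ τ.reg [q, x] .n = n := by
      intro q x h
      have hq := (pair_mem_positions.1 h).1
      simp [hτ, σ.fork_reg_pair _ h, hσ.base q hq, hσ.m q hq, hσ.n q hq]
    have hD : (τ.write (positions Q m) .D (fun p => τ.eval p (Reg.base + Reg.x))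
        (fun p => τ.eval p Reg.x)).mem .D (q * m + (j + 1) - 0) = j + 1 := by
      rw [τ.write_pair (Nat.zero_le _) (Finset.Subset.refl _) _ hmem]
      · exact (hreg q _ hmem).2.1
      · intro q x h
        simp [hreg q x h]
    -- The second store runs after the first one, so the claim is made for any state with the same
    -- registers. `Len` is addressed by the start of the block, one less than its first position,
    -- hence the offset 1 in `write_pair`.
    have hL : ∀ τ' : State β, τ'.reg = τ.reg → (τ'.write (positions Q m) .Len
        (fun p => τ'.eval p (Reg.base + Reg.x - 1))
        (fun p => τ'.eval p (Reg.base + Reg.x + Reg.m ≤ₑ Reg.n + 1))).mem .Len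
          (q * m + (j + 1) - 1) = if q * m + (j + 1) + m ≤ n + 1 then 1 else 0 := by
      intro τ' hτ'
      rw [τ'.write_pair le_rfl (Finset.Subset.refl _) _ hmem]
      · simp [State.eval_le, hτ', hreg q _ hmem]
      · intro q x h
        simp [hτ', hreg q x h]
    have hL' := hL (τ.write (positions Q m) .D (fun p => τ.eval p (Reg.base + Reg.x))
      (fun p => τ.eval p Reg.x)) rfl
    simp only [Cmd.run, mul_one]
    rw [State.write_mem_ne _ _ (by decide)]
    rw [show q * m + (j + 1) - 1 = q * m + j by omega] at hL'
    rw [hL']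
    split_ifs with hc
    · exact IsBlock.single (x := j + 1) (by omega) rfl hD
    · exact IsBlock.of_empty fun x hx => by omega
  · simp [Cmd.cost]
  · rw [card_pieces, card_positions]
    simp [Cmd.cost]
    nlinarith

/-- One round of the dueling stage without the doubling of the block size. -/
def duelRound : Cmd :=
  .par .j 1 ((Reg.m + 2 * Reg.h - 1) / (2 * Reg.h)) (
    (.s ≔ Reg.base + (Reg.j - 1) * (2 * Reg.h)) ;;
    (.la ≔ .ld .Len Reg.s) ;;
    .ite ((Reg.j - 1) * (2 * Reg.h) + Reg.h <ₑ Reg.m)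
      (.lb ≔ .ld .Len (Reg.s + Reg.h))
      (.lb ≔ 0) ;;
    merge ;;
    .par .i Reg.r2 Reg.lb (
      .store .D (Reg.s + Reg.l1 + (Reg.i - Reg.r2) + 1) (.ld .D (Reg.s + Reg.h + Reg.i))) ;;
    .store .Len Reg.s (Reg.l1 + (Reg.lb + 1 - Reg.r2)))

/-- Everything up to the end of `merge` leaves the shared memory unchanged and is covered by one
triple. The memory changes only when the survivors of `ℬ` are moved and the new length is stored. -/
theorem duel_round {m n Q L h Xt Xw : ℕ} {cand occ : ℕ → ℕ → Prop} {σ : State β}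
    (hσ : IsPieceState m n Q σ) (hh : ∀ q ≤ Q, σ.reg [q] .h = h) (hpos : 0 < h) (hhm : h < m)
    (hL : m ≤ 2 ^ L)
    (hspec : ∀ q ≤ Q, PieceSpec m (σ.mem .W) (sym (I.str 0)) (I.re (I.str (q + 1))) (cand q)
      (occ q))
    (ht : ∀ q ≤ Q, ∀ x, cand q x → I.ξt (I.str (q + 1)).length ≤ Xt)
    (hw : ∀ q ≤ Q, ∀ x, cand q x → I.ξw (I.str (q + 1)).length ≤ Xw)
    (hinv : DuelInv (σ.mem .W) cand occ m Q h σ.mem) :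
    Runs I duelRound (pieces Q) σ (300 * (L + 1) ^ 2 * (Xt + 1))
      ((Q + 1) * (m / (2 * h) + 1) * (300 * (L + 1) ^ 2 * (Xw + 1)) + (Q + 1) * m * 50)
      (fun σ' => DuelInv (σ.mem .W) cand occ m Q (2 * h) σ'.mem) := by
  set J := (m + 2 * h - 1) / (2 * h) with hJ
  set S := positions Q J with hSdef
  have hS : S = children (pieces Q) (fun p => σ.eval p 1)
      (fun p => σ.eval p ((Reg.m + 2 * Reg.h - 1) / (2 * Reg.h))) :=
    children_pieces_congr (fun q hq => rfl) (fun q hq => by simp [hσ.m q hq, hh q hq, hJ])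
  set τ := σ.fork S .j with hτ
  set M := σ.mem with hM
  have hJ' : ∀ j, 1 ≤ j → (j ≤ J ↔ (j - 1) * (2 * h) < m) := by
    intro j hj
    obtain ⟨j, rfl⟩ : ∃ i, j = i + 1 := ⟨j - 1, by omega⟩
    rw [hJ, Nat.le_div_iff_mul_le (by omega), Nat.add_sub_cancel, add_mul, one_mul]
    omega
  have hreg : ∀ {q j}, [q, j] ∈ S → τ.reg [q, j] .base = q * m ∧ τ.reg [q, j] .j = j ∧
      τ.reg [q, j] .m = m ∧ τ.reg [q, j] .h = h ∧ τ.reg [q, j] .q = q := by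
    intro q j hm
    have hq := (pair_mem_positions.1 hm).1
    simp [hτ, σ.fork_reg_pair _ hm, hσ.base q hq, hσ.m q hq, hσ.q q hq, hh q hq]
  let s : Proc → ℕ := fun p => τ.reg p .base + (τ.reg p .j - 1) * (2 * τ.reg p .h)
  -- The registers that `merge` will find, after `s`, `la` and `lb` have been set.
  let ρ : Proc → Reg → ℕ := fun p r =>
    if r = .lb then
      if (τ.reg p .j - 1) * (2 * τ.reg p .h) + τ.reg p .h < τ.reg p .m then
        M .Len (s p + τ.reg p .h) else 0
    else if r = .la then M .Len (s p) else if r = .s then s p else τ.reg p r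
  have hs : ∀ {q j}, [q, j] ∈ S → s [q, j] = q * m + (j - 1) * (2 * h) := by
    intro q j hm
    simp [s, hreg hm]
  have hρ : ∀ {q j}, [q, j] ∈ S → ρ [q, j] .s = q * m + (j - 1) * (2 * h) ∧
      ρ [q, j] .h = h ∧ ρ [q, j] .q = q ∧
      ρ [q, j] .la = M .Len (q * m + (j - 1) * (2 * h)) ∧ ρ [q, j] .lb =
      if (j - 1) * (2 * h) + h < m then M .Len (q * m + (j - 1) * (2 * h) + h) else 0 := by
    intro q j hm
    simp [ρ, hs hm, hreg hm]
  have hblocks : ∀ {q j}, [q, j] ∈ S →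
      IsBlock (M .W) (cand q) (occ q) (fun i => M .D (ρ [q, j] .s + i)) (ρ [q, j] .la)
        ((j - 1) * (2 * h)) ((j - 1) * (2 * h) + h) ∧
      IsBlock (M .W) (cand q) (occ q) (fun i => M .D (ρ [q, j] .s + ρ [q, j] .h + i))
        (ρ [q, j] .lb) ((j - 1) * (2 * h) + h) ((j - 1) * (2 * h) + 2 * h) := by
    intro q j hm
    obtain ⟨hq, hj, hjJ⟩ := pair_mem_positions.1 hm
    obtain ⟨e₁, e₂, e₃, e₄, e₅⟩ := hρ hm
    rw [e₁, e₂, e₄, e₅]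
    have hlt := (hJ' j hj).1 hjJ
    -- Counted from 0, the block `j - 1` of size `2h` consists of the blocks `2(j - 1)` and `2(j -
    -- 1) + 1` of size `h`. If the second one starts at or beyond `m`, it contains no candidate and
    -- the empty list represents it.
    constructor
    · have := hinv q hq (2 * (j - 1)) (by rw [mul_assoc, mul_left_comm]; exact hlt)
      rwa [mul_assoc, mul_left_comm] at this
    · split_ifs with hc
      · have := hinv q hq (2 * (j - 1) + 1) (by rw [add_mul, mul_assoc, mul_left_comm]; omega)
        rw [add_mul, mul_assoc, mul_left_comm, one_mul] at this
        simp only [← add_assoc] at this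
        rwa [add_assoc _ h h, ← two_mul] at this
      · exact IsBlock.of_empty fun x hx => ((hspec q hq).cand_le hx).trans (by omega)
  have hlen : ∀ {q j}, [q, j] ∈ S → ρ [q, j] .la ≤ h ∧ ρ [q, j] .lb ≤ h := by
    intro q j hm
    have h₁ := (hblocks hm).1.lo_add_le (by omega)
    have h₂ := (hblocks hm).2.lo_add_le (by omega)
    omega
  have hready : ∀ p ∈ S, MergeReady I M m Xt Xw (cand (p.headD 0)) (occ (p.headD 0)) (ρ p) := by
    intro p hp
    obtain ⟨q, j, hq, hj, hjJ, rfl⟩ := mem_positions.1 hp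
    have hb := hblocks hp
    refine ⟨?_, ?_, ?_⟩
    · rw [(hρ hp).2.2.1]
      exact IsBlock.mergeable (hspec q hq) hb.1 hb.2
    · rw [(hρ hp).2.2.1]
      exact ht q hq
    · rw [(hρ hp).2.2.1]
      exact hw q hq
  have hmerge := merge_triple (K := L) (S := S)
    (fun p hp => by
      obtain ⟨q, j, hq, hj, hjJ, rfl⟩ := mem_positions.1 hp
      have := (hlen hp).1
      omega)
    (fun p hp => by
      obtain ⟨q, j, hq, hj, hjJ, rfl⟩ := mem_positions.1 hp
      have := (hlen hp).2
      omega) hready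
  have hpre := Triple.seq (Triple.of_imp (pre' := fun p L => p ∈ S ∧ L.reg = τ.reg p)
    (.seq (.seq (.assign .s (Reg.base + (Reg.j - 1) * (2 * Reg.h))) (.assign .la (.ld .Len Reg.s)))
    (.ite' (e := (Reg.j - 1) * (2 * Reg.h) + Reg.h <ₑ Reg.m)
      (.assign .lb (.ld .Len (Reg.s + Reg.h))) (.assign .lb 0))) (fun p L hL => by
        obtain ⟨hp, hL⟩ := hL
        simp only [Loc.set_reg, Loc.eval_reg, Loc.eval_add, Loc.eval_mul, Loc.eval_sub, Loc.eval_ld,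
          Loc.eval_zero, Loc.eval_one, Loc.eval_two, reduceCtorEq, if_true, if_false, hL,
          Loc.eval_lt_eq_zero, ne_eq, not_not]
        refine ⟨fun hc => ⟨hp, fun r _ => ?_⟩, fun hc => ⟨hp, fun r _ => ?_⟩⟩ <;>
          simp only [Loc.set_reg, ρ, hc, if_true, if_false, hL, s])) hmerge
  have hSlen : ∀ p ∈ S, p.length = 2 := by
    rw [hS]
    exact length_of_mem_children length_of_mem_pieces
  have hbody₁ := (hpre.runs (S := S) (σ := τ) rfl fun p hp => ⟨hp, rfl⟩).frame hSlen
    (Q₁ := fun σ₁ => σ₁.mem = M ∧ ∀ {q j}, [q, j] ∈ S →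
      ((∀ r, r ∉ mergeRegs → σ₁.reg [q, j] r = ρ [q, j] r) ∧
      IsMerge (M .W) (occ q) (fun i => M .D (ρ [q, j] .s + i))
        (fun i => M .D (ρ [q, j] .s + ρ [q, j] .h + i)) (ρ [q, j] .la) (ρ [q, j] .lb)
        (σ₁.reg [q, j] .l1) (σ₁.reg [q, j] .r2)))
    (fun σ₁ h₁ h₂ _ => ⟨funext fun A => h₂ A (by cases A <;> decide), fun hm => h₁ _ hm⟩)
  have hbody : Runs I _ S τ _ (S.card * (200 * (L + 1) ^ 2 * (Xw + 1)) + (Q + 1) * m * 40)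
    (fun σ' => DuelInv (M .W) cand occ m Q (2 * h) σ'.mem) :=
    (Runs.seq_assoc (Runs.seq_assoc (Runs.seq_assoc (Runs.seq hbody₁
      (T₂ := 30) (N₂ := S.card * 20 + (Q + 1) * m * 40)
      (c₂ := .par .i Reg.r2 Reg.lb (
        .store .D (Reg.s + Reg.l1 + (Reg.i - Reg.r2) + 1) (.ld .D (Reg.s + Reg.h + Reg.i))) ;;
        .store .Len Reg.s (Reg.l1 + (Reg.lb + 1 - Reg.r2)))
      (fun σ₁ h₁ => by
        obtain ⟨hM₁, h₁⟩ := h₁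
        have hreg₁ : ∀ {q j}, [q, j] ∈ S → σ₁.reg [q, j] .s = q * m + (j - 1) * (2 * h) ∧
            σ₁.reg [q, j] .h = h ∧ σ₁.reg [q, j] .lb = ρ [q, j] .lb := by
          intro q j hm
          obtain ⟨k, -⟩ := h₁ hm
          exact ⟨(k _ (by decide)).trans (hρ hm).1, (k _ (by decide)).trans (hρ hm).2.1,
            k _ (by decide)⟩
        have hmrg : ∀ {q j}, [q, j] ∈ S → IsBlock (M .W) (cand q) (occ q)
            (fun t => if t ≤ σ₁.reg [q, j] .l1 then M .D (q * m + (j - 1) * (2 * h) + t) else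
              M .D (q * m + (j - 1) * (2 * h) + h +
                (t - σ₁.reg [q, j] .l1 - 1 + σ₁.reg [q, j] .r2)))
            (σ₁.reg [q, j] .l1 + (ρ [q, j] .lb + 1 - σ₁.reg [q, j] .r2)) ((j - 1) * (2 * h))
            ((j - 1) * (2 * h) + 2 * h) := by
          intro q j hm
          have := (hblocks hm).1.merge (hblocks hm).2 (by omega) (by omega) (h₁ hm).2
          rwa [(hρ hm).1, (hρ hm).2.1] at this
        have hsize : ∀ {q j}, [q, j] ∈ S →
            σ₁.reg [q, j] .l1 + (ρ [q, j] .lb + 1 - σ₁.reg [q, j] .r2) ≤ 2 * h ∧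
            (j - 1) * (2 * h) + (σ₁.reg [q, j] .l1 + (ρ [q, j] .lb + 1 - σ₁.reg [q, j] .r2)) ≤ m := by
          intro q j hm
          obtain ⟨hq, hj, hjJ⟩ := pair_mem_positions.1 hm
          have k₁ := (hmrg hm).lo_add_le (by omega)
          have k₂ := (hmrg hm).lo_add_le_of_cand ((hJ' j hj).1 hjJ).le
            (fun x hx => (hspec q hq).cand_le hx)
          omega
        -- Addresses are decoded twice by `addr_inj`: first into piece and position, then into block
        -- and offset.
        have hinj : ∀ {q j t q' j' t'}, [q, j] ∈ S → [q', j'] ∈ S → 1 ≤ t → t ≤ 2 * h →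
            (j - 1) * (2 * h) + t ≤ m → 1 ≤ t' → t' ≤ 2 * h → (j' - 1) * (2 * h) + t' ≤ m →
            q * m + (j - 1) * (2 * h) + t = q' * m + (j' - 1) * (2 * h) + t' →
            q = q' ∧ j = j' ∧ t = t' := by
          intro q j t q' j' t' hm hm' k₁ k₂ k₃ k₁' k₂' k₃' heq
          rw [add_assoc, add_assoc] at heq
          obtain ⟨rfl, heq'⟩ := addr_inj (by omega) k₃ (by omega) k₃' heq
          obtain ⟨hjj, rfl⟩ := addr_inj k₁ k₂ k₁' k₂' heq'
          have := (pair_mem_positions.1 hm).2.1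
          have := (pair_mem_positions.1 hm').2.1
          exact ⟨rfl, by omega, rfl⟩
        set S₃ := children S (fun p => σ₁.eval p Reg.r2) (fun p => σ₁.eval p Reg.lb) with hS₃
        have hmem₃ : ∀ {p}, p ∈ S₃ ↔ ∃ q j i, [q, j] ∈ S ∧ σ₁.reg [q, j] .r2 ≤ i ∧
            i ≤ ρ [q, j] .lb ∧ p = [q, j, i] := by
          intro p
          rw [hS₃, mem_children]
          constructor
          · rintro ⟨p₀, hp₀, i, k₁, k₂, rfl⟩
            obtain ⟨q, j, -, -, -, rfl⟩ := mem_positions.1 hp₀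
            exact ⟨q, j, i, hp₀, k₁, by rw [← (hreg₁ hp₀).2.2]; exact k₂, rfl⟩
          · rintro ⟨q, j, i, hp₀, k₁, k₂, rfl⟩
            exact ⟨[q, j], hp₀, i, k₁, by rw [← (hreg₁ hp₀).2.2] at k₂; exact k₂, rfl⟩
        have hcard : S₃.card ≤ S.card * h := by
          rw [hS₃, card_children, ← smul_eq_mul]
          refine Finset.sum_le_card_nsmul _ _ _ fun p hp => ?_
          obtain ⟨q, j, -, -, -, rfl⟩ := mem_positions.1 hp
          have k₁ := (hlen hp).2
          have k₂ := (h₁ hp).2.r_pos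
          simp only [State.eval_reg, (hreg₁ hp).2.2]
          omega
        -- Moving the survivors costs at most `h` processors per merge, and `J * h` is at most `2m`
        -- because `h < m`.
        have hcard' : S.card * h ≤ (Q + 1) * m * 2 := by
          rw [hSdef, card_positions, mul_assoc, mul_assoc]
          refine Nat.mul_le_mul_left _ ?_
          have k₁ : J * (2 * h) ≤ m + 2 * h - 1 := Nat.div_mul_le_self _ _
          have k₂ : J * (2 * h) = 2 * (J * h) := by ring
          omega
        refine ((Runs.par_straight (by rfl) hS₃).frame hSlen
          (Q₁ := fun σ₂ => (∀ {q j}, [q, j] ∈ S → (∀ r, σ₂.reg [q, j] r = σ₁.reg [q, j] r) ∧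
            ∀ t, 1 ≤ t → t ≤ σ₁.reg [q, j] .l1 + (ρ [q, j] .lb + 1 - σ₁.reg [q, j] .r2) →
            σ₂.mem .D (q * m + (j - 1) * (2 * h) + t) = if t ≤ σ₁.reg [q, j] .l1 then
              M .D (q * m + (j - 1) * (2 * h) + t) else
              M .D (q * m + (j - 1) * (2 * h) + h +
                (t - σ₁.reg [q, j] .l1 - 1 + σ₁.reg [q, j] .r2))))
          (fun σ₂ h₂ _ hr₂ => ?_)).seq (fun σ₂ h₂ => (Runs.of_straight (by rfl) _ _).imp ?_)
          |>.mono ?_ ?_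
        · intro q j hm
          refine ⟨fun r => hr₂ [q, j] le_rfl r (by simp [Cmd.sets]), fun t k₁ k₂ => ?_⟩
          subst h₂
          have hreg₃ : ∀ {q j i}, [q, j, i] ∈ S₃ → [q, j] ∈ S →
              (σ₁.fork S₃ .i).reg [q, j, i] .s = q * m + (j - 1) * (2 * h) ∧
              (σ₁.fork S₃ .i).reg [q, j, i] .h = h ∧ (σ₁.fork S₃ .i).reg [q, j, i] .i = i ∧
              (σ₁.fork S₃ .i).reg [q, j, i] .l1 = σ₁.reg [q, j] .l1 ∧
              (σ₁.fork S₃ .i).reg [q, j, i] .r2 = σ₁.reg [q, j] .r2 := by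
            intro q j i h₃ hm
            simp [σ₁.fork_reg_triple _ h₃, hreg₁ hm]
          have haddr : ∀ {q' j' i'}, [q', j'] ∈ S → σ₁.reg [q', j'] .r2 ≤ i' →
              i' ≤ ρ [q', j'] .lb → (σ₁.fork S₃ .i).eval [q', j', i']
                (Reg.s + Reg.l1 + (Reg.i - Reg.r2) + 1) = q * m + (j - 1) * (2 * h) + t →
              q' = q ∧ j' = j ∧ σ₁.reg [q', j'] .l1 + (i' - σ₁.reg [q', j'] .r2) + 1 = t := by
            intro q' j' i' hm' g₁ g₂ heq
            simp [hreg₃ (hmem₃.2 ⟨q', j', i', hm', g₁, g₂, rfl⟩) hm'] at heq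
            have := hsize hm'
            have := hsize hm
            exact hinj hm' hm (by omega) (by omega) (by omega) (by omega) (by omega) (by omega)
              (by omega)
          simp only [Cmd.run]
          -- The moved elements go to offsets beyond `l1`, so the first `l1` entries survive. Source
          -- and target may overlap, but all reads of a step precede its writes.
          split_ifs with hlt
          · rw [State.write_mem_of_forall_ne, ← hM₁]
            · rfl
            · intro p hp heq
              obtain ⟨q', j', i', hm', g₁, g₂, rfl⟩ := hmem₃.1 hp
              obtain ⟨rfl, rfl, g₃⟩ := haddr hm' g₁ g₂ heq
              omega
          · obtain ⟨i, hi⟩ : ∃ i, i = t - σ₁.reg [q, j] .l1 - 1 + σ₁.reg [q, j] .r2 := ⟨_, rfl⟩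
            have hp : [q, j, i] ∈ S₃ := hmem₃.2 ⟨q, j, i, hm, by omega, by omega, rfl⟩
            have ha : (σ₁.fork S₃ .i).eval [q, j, i] (Reg.s + Reg.l1 + (Reg.i - Reg.r2) + 1) =
                q * m + (j - 1) * (2 * h) + t := by
              simp [hreg₃ hp hm]
              omega
            rw [← ha, State.write_mem_of_inj _ _ hp, ← hi, ← hM₁]
            · simp [hreg₃ hp hm]
            · intro p' hp' heq
              obtain ⟨q', j', i', hm', g₁, g₂, rfl⟩ := hmem₃.1 hp'
              obtain ⟨rfl, rfl, g₃⟩ := haddr hm' g₁ g₂ (heq.trans ha)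
              have : i' = i := by omega
              rw [this]
        · rintro _ rfl q hq j hj
          have hm : [q, j + 1] ∈ S :=
            pair_mem_positions.2 ⟨hq, by omega, (hJ' (j + 1) (by omega)).2 hj⟩
          have hreg₂ : ∀ {q j}, [q, j] ∈ S → σ₂.eval [q, j] Reg.s = q * m + (j - 1) * (2 * h) := by
            intro q j hm
            rw [State.eval_reg, (h₂ hm).1, (hreg₁ hm).1]
          simp only [Cmd.run]
          have hLen : (σ₂.write S .Len (fun p => σ₂.eval p Reg.s)
              (fun p => σ₂.eval p (Reg.l1 + (Reg.lb + 1 - Reg.r2)))).mem .Len (q * m + j * (2 * h)) =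
              σ₁.reg [q, j + 1] .l1 + (ρ [q, j + 1] .lb + 1 - σ₁.reg [q, j + 1] .r2) := by
            have ha := hreg₂ hm
            rw [Nat.add_sub_cancel] at ha
            rw [← ha, State.write_mem_of_inj _ _ hm]
            · simp [(h₂ hm).1, (hreg₁ hm).2.2]
            · intro p' hp' heq
              obtain ⟨q', j', hq', hj', hjJ', rfl⟩ := mem_positions.1 hp'
              rw [hreg₂ hp', hreg₂ hm] at heq
              have := (hJ' j' hj').1 hjJ'
              -- `hinj` expects offsets from 1 on; adding 1 to the two block starts turns them into
              -- addresses with offset 1.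
              obtain ⟨rfl, rfl, -⟩ := hinj hp' hm le_rfl (by omega) (by omega) le_rfl (by omega)
                (by rw [Nat.add_sub_cancel]; omega) (congrArg (· + 1) heq)
              rfl
          rw [hLen]
          refine (hmrg hm).congr fun t k₁ k₂ => ?_
          rw [State.write_mem_ne _ _ (by decide)]
          exact (h₂ hm).2 t k₁ k₂
        · simp [Cmd.cost]
        · simp [Cmd.cost]
          nlinarith))))).mono le_rfl (by
            simp only [Expr.size_zero, Expr.size_one, Expr.size_two, Expr.size_reg, Expr.size_ld,
              Expr.size_op, Expr.size_add, Expr.size_sub, Expr.size_mul]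
            nlinarith [Nat.zero_le (S.card * (L ^ 2 * Xw)), Nat.zero_le (S.card * (L * Xw)),
              Nat.zero_le (S.card * Xw), Nat.zero_le (S.card * L), Nat.zero_le (S.card * L ^ 2)])
  refine ((Runs.par hS hbody).mono ?_ ?_)
  · simp only [Expr.size_zero, Expr.size_one, Expr.size_two, Expr.size_reg, Expr.size_ld,
      Expr.size_op, Expr.size_add, Expr.size_sub, Expr.size_mul, Expr.size_div]
    have : 1 ≤ (L + 1) ^ 2 * (Xt + 1) := Nat.succ_le_of_lt (by positivity)
    nlinarith
  · have hcard : S.card ≤ (Q + 1) * (m / (2 * h) + 1) := by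
      rw [hSdef, card_positions]
      refine Nat.mul_le_mul_left _ ?_
      rw [hJ, ← Nat.add_div_right m (by omega)]
      exact Nat.div_le_div_right (by omega)
    have h₁ : S.card * (200 * (L + 1) ^ 2 * (Xw + 1)) ≤
        (Q + 1) * (m / (2 * h) + 1) * (200 * (L + 1) ^ 2 * (Xw + 1)) :=
      Nat.mul_le_mul_right _ hcard
    have h₂ : 1 ≤ (L + 1) ^ 2 * (Xw + 1) := Nat.succ_le_of_lt (by positivity)
    have h₃ : S.card ≤ (Q + 1) * (m / (2 * h) + 1) * ((L + 1) ^ 2 * (Xw + 1)) :=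
      hcard.trans (Nat.le_mul_of_pos_right _ h₂)
    have h₄ : (Q + 1) * 2 ≤ (Q + 1) * m := Nat.mul_le_mul_left _ (by omega)
    rw [card_pieces]
    simp only [Expr.size_one, Expr.size_two, Expr.size_reg, Expr.size_add, Expr.size_sub,
      Expr.size_mul, Expr.size_div]
    nlinarith

end Machine

/-! ### All rounds of the dueling stage and the marking of the survivors. -/

section Machine

variable {β : Type*} {I : Input β}

/-- Bounds the number of merges over all rounds, up to one extra merge per round. The summand `m / 2
^ L` makes the induction close, because twice its half is at most itself. -/
theorem sum_div_two_pow_le (m L : ℕ) :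
    ∑ k ∈ Finset.range L, m / (2 * 2 ^ k) + m / 2 ^ L ≤ m := by
  induction L with
  | zero => simp
  | succ L ih =>
    rw [Finset.sum_range_succ, ← pow_succ']
    have h₁ : m / 2 ^ (L + 1) = m / 2 ^ L / 2 := by rw [pow_succ, Nat.div_div_eq_div_mul]
    omega

/-- The array `C` marks pairwise consistent candidates, among them all occurrences. -/
structure IsSieve (W : ℕ → ℕ) (cand occ : ℕ → Prop) (m : ℕ) (C : ℕ → ℕ) : Prop where
  bool : ∀ {x}, 1 ≤ x → x ≤ m → C x = 0 ∨ C x = 1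
  isCand : ∀ {x}, 1 ≤ x → x ≤ m → C x = 1 → cand x
  zero : ∀ {x y}, 1 ≤ x → x < y → y ≤ m → C x = 1 → C y = 1 → W (y - x) = 0
  complete : ∀ {x}, cand x → occ x → C x = 1

theorem IsBlock.isSieve {W : ℕ → ℕ} {cand occ : ℕ → Prop} {A C : ℕ → ℕ} {n m h : ℕ}
    (hb : IsBlock W cand occ A n 0 h) (hmh : m ≤ h) (hc : ∀ x, cand x → 1 ≤ x ∧ x ≤ m)
    (h₁ : ∀ i, 1 ≤ i → i ≤ n → C (A i) = 1)
    (h₀ : ∀ x, 1 ≤ x → x ≤ m → (∀ i, 1 ≤ i → i ≤ n → A i ≠ x) → C x = 0) :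
    IsSieve W cand occ m C := by
  have key : ∀ x, 1 ≤ x → x ≤ m → C x = 1 → ∃ i, 1 ≤ i ∧ i ≤ n ∧ A i = x := by
    intro x hx hxm hC
    by_contra h
    push Not at h
    have := h₀ x hx hxm h
    omega
  constructor
  · intro x hx hxm
    by_cases h : ∃ i, 1 ≤ i ∧ i ≤ n ∧ A i = x
    · obtain ⟨i, k₁, k₂, rfl⟩ := h
      exact Or.inr (h₁ i k₁ k₂)
    · push Not at h
      exact Or.inl (h₀ x hx hxm h)
  · intro x hx hxm hC
    obtain ⟨i, k₁, k₂, rfl⟩ := key x hx hxm hC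
    exact hb.list.cand k₁ k₂
  · intro x y hx hxy hym hCx hCy
    obtain ⟨i, k₁, k₂, rfl⟩ := key x hx (by omega) hCx
    obtain ⟨j, k₃, k₄, rfl⟩ := key y (by omega) hym hCy
    rcases lt_trichotomy i j with h | h | h
    · exact hb.list.zero k₁ h k₄
    · subst h; omega
    · have := hb.list.lt k₃ h k₂
      omega
  · intro x hcx ho
    obtain ⟨k₁, k₂⟩ := hc x hcx
    obtain ⟨i, k₃, k₄, rfl⟩ := hb.complete (by omega) (by omega) hcx ho
    exact h₁ i k₃ k₄

/-- Storing a constant at all positions of all pieces. -/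
theorem store_positions {m n Q : ℕ} {σ : State β} (hσ : IsPieceState m n Q σ) (A : Arr) :
    Runs I (.par .x 1 Reg.m (.store A (Reg.base + Reg.x) 0)) (pieces Q) σ 8
      ((Q + 1) * m * 6 + (Q + 1) * 3)
      (fun σ' => ∀ q ≤ Q, ∀ x, 1 ≤ x → x ≤ m → σ'.mem A (q * m + x) = 0) := by
  have hS := children_pieces_congr (Q := Q) (k := m) (lo := fun p => σ.eval p 1)
    (hi := fun p => σ.eval p Reg.m) (fun q hq => rfl) (fun q hq => hσ.m q hq)
  refine ((Runs.par_straight (by rfl) hS).imp ?_).mono ?_ ?_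
  · rintro σ' rfl q hq x hx hxm
    have hmem : [q, x] ∈ positions Q m := pair_mem_positions.2 ⟨hq, hx, hxm⟩
    simp only [Cmd.run]
    have := (σ.fork (positions Q m) .x).write_pair (A := A) (Nat.zero_le 1) (Finset.Subset.refl _)
      (a := fun p => (σ.fork (positions Q m) .x).eval p (Reg.base + Reg.x))
      (v := fun p => (σ.fork (positions Q m) .x).eval p 0) (fun q x h => by
        simp [σ.fork_reg_pair _ h, hσ.base q (pair_mem_positions.1 h).1]) hmem
    exact this
  · simp [Cmd.cost]
  · rw [card_pieces, card_positions]
    simp [Cmd.cost]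
    nlinarith

theorem mark_survivors {m n Q h : ℕ} {W : ℕ → ℕ} {cand occ : ℕ → ℕ → Prop} {σ : State β}
    (hσ : IsPieceState m n Q σ) (hm : 0 < m) (hmh : m ≤ h)
    (hcand : ∀ q ≤ Q, ∀ x, cand q x → 1 ≤ x ∧ x ≤ m)
    (hinv : DuelInv W cand occ m Q h σ.mem)
    (hC : ∀ q ≤ Q, ∀ x, 1 ≤ x → x ≤ m → σ.mem .C (q * m + x) = 0) :
    Runs I (.par .i 1 (.ld .Len Reg.base) (.store .C (Reg.base + .ld .D (Reg.base + Reg.i)) 1))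
      (pieces Q) σ 12 ((Q + 1) * m * 9 + (Q + 1) * 4)
      (fun σ' => ∀ q ≤ Q, IsSieve W (cand q) (occ q) m (fun x => σ'.mem .C (q * m + x))) := by
  have hb : ∀ q ≤ Q, IsBlock W (cand q) (occ q) (fun i => σ.mem .D (q * m + i))
      (σ.mem .Len (q * m)) 0 h := fun q hq => by simpa using hinv q hq 0 (by omega)
  set S := children (pieces Q) (fun p => σ.eval p 1) (fun p => σ.eval p (.ld .Len Reg.base))
    with hS
  have hmem : ∀ {q i}, [q, i] ∈ S ↔ q ≤ Q ∧ 1 ≤ i ∧ i ≤ σ.mem .Len (q * m) := by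
    intro q i
    rw [hS, mem_children_pieces]
    constructor
    · rintro ⟨q, i, hq, h₁, h₂, h⟩
      cases h
      simp only [State.eval_one, State.eval_ld, State.eval_reg, hσ.base q hq] at h₁ h₂
      exact ⟨hq, h₁, h₂⟩
    · rintro ⟨hq, h₁, h₂⟩
      exact ⟨q, i, hq, h₁, by simpa [hσ.base q hq] using h₂, rfl⟩
  have hmem' : ∀ {p}, p ∈ S → ∃ q i, p = [q, i] := by
    intro p hp
    rw [hS, mem_children_pieces] at hp
    obtain ⟨q, i, -, -, -, rfl⟩ := hp
    exact ⟨q, i, rfl⟩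
  have haddr : ∀ {q i}, [q, i] ∈ S → (σ.fork S .i).eval [q, i]
      (Reg.base + .ld .D (Reg.base + Reg.i)) = q * m + σ.mem .D (q * m + i) := by
    intro q i h
    simp [σ.fork_reg_pair _ h, hσ.base q (hmem.1 h).1]
  have hD : ∀ {q i}, [q, i] ∈ S → 1 ≤ σ.mem .D (q * m + i) ∧ σ.mem .D (q * m + i) ≤ m := by
    intro q i h
    obtain ⟨hq, h₁, h₂⟩ := hmem.1 h
    exact hcand q hq _ ((hb q hq).list.cand h₁ h₂)
  refine ((Runs.par_straight (by rfl) hS).imp ?_).mono ?_ ?_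
  · rintro σ' rfl q hq
    simp only [Cmd.run]
    refine (hb q hq).isSieve hmh (hcand q hq) (fun i h₁ h₂ => ?_) (fun x hx hxm hne => ?_)
    · have hp : [q, i] ∈ S := hmem.2 ⟨hq, h₁, h₂⟩
      rw [← haddr hp]
      -- Every processor writes the value 1, so conflicts need no further argument.
      exact State.write_mem_of_le _ _ hp fun _ _ _ => Or.inl rfl
    · rw [State.write_mem_of_forall_ne]
      · exact hC q hq x hx hxm
      · intro p hp heq
        obtain ⟨q', i, rfl⟩ := hmem' hp
        rw [haddr hp] at heq
        obtain ⟨rfl, rfl⟩ := addr_inj (hD hp).1 (hD hp).2 hx hxm heq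
        exact hne i (hmem.1 hp).2.1 (hmem.1 hp).2.2 rfl
  · simp [Cmd.cost]
  · have : S.card ≤ (Q + 1) * m := by
      rw [hS, card_children, ← card_pieces Q, ← smul_eq_mul]
      refine Finset.sum_le_card_nsmul _ _ _ fun p hp => ?_
      obtain ⟨q, hq, rfl⟩ := mem_pieces.1 hp
      have := (hb q hq).lo_add_le_of_cand (Nat.zero_le m) fun x hx => (hcand q hq x hx).2
      simpa [hσ.base q hq] using this
    rw [card_pieces]
    simp [Cmd.cost]
    nlinarith

theorem duelingStage_runs {m n Q Xt Xw : ℕ} {occ : ℕ → ℕ → Prop} {σ : State β}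
    (hσ : IsPieceState m n Q σ) (hm : 2 ≤ m)
    (hspec : ∀ q ≤ Q, PieceSpec m (σ.mem .W) (sym (I.str 0)) (I.re (I.str (q + 1)))
      (fun x => 1 ≤ x ∧ x ≤ m ∧ q * m + x + m ≤ n + 1) (occ q))
    (ht : ∀ q ≤ Q, q * m + m ≤ n → I.ξt (I.str (q + 1)).length ≤ Xt)
    (hw : ∀ q ≤ Q, q * m + m ≤ n → I.ξw (I.str (q + 1)).length ≤ Xw) :
    Runs I duelingStage (pieces Q) σ (400 * (Nat.clog 2 m + 1) ^ 3 * (Xt + 1))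
      ((Q + 1) * m * (800 * (Nat.clog 2 m + 1) ^ 2 * (Xw + 1)))
      (fun σ' => IsPieceState m n Q σ' ∧ (∀ q ≤ Q, σ'.reg [q] .h = 2 ^ Nat.clog 2 m) ∧
        σ'.mem .W = σ.mem .W ∧
        ∀ q ≤ Q, IsSieve (σ.mem .W) (fun x => 1 ≤ x ∧ x ≤ m ∧ q * m + x + m ≤ n + 1) (occ q) m
          (fun x => σ'.mem .C (q * m + x))) := by
  set L := Nat.clog 2 m with hL
  set W := σ.mem .W with hW
  let cand : ℕ → ℕ → Prop := fun q x => 1 ≤ x ∧ x ≤ m ∧ q * m + x + m ≤ n + 1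
  have hmL : m ≤ 2 ^ L := Nat.le_pow_clog (by norm_num) m
  let J : ℕ → State β → Prop := fun k σ => IsPieceState m n Q σ ∧
    (∀ q ≤ Q, σ.reg [q] .h = 2 ^ k) ∧ σ.mem .W = W ∧ DuelInv W cand occ m Q (2 ^ k) σ.mem
  have hinit := (duel_init (I := I) (W := W) (occ := occ) hσ).frame length_of_mem_pieces
    (Q₁ := fun σ₁ => IsPieceState m n Q σ₁ ∧ σ₁.mem .W = W ∧ DuelInv W cand occ m Q 1 σ₁.mem)
    (fun σ₁ h₁ h₂ h₃ => ⟨hσ.congr fun q r _ => h₃ [q] le_rfl r (by simp [Cmd.sets]),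
      h₂ _ (by decide), h₁⟩)
  have hone : ∀ σ₁, IsPieceState m n Q σ₁ ∧ σ₁.mem .W = W ∧ DuelInv W cand occ m Q 1 σ₁.mem →
      Runs I (.h ≔ 1) (pieces Q) σ₁ 2 ((Q + 1) * 2) (J 0) := by
    rintro σ₁ ⟨h₁, h₂, h₃⟩
    refine (((Runs.of_straight (by rfl) _ _).frame length_of_mem_pieces ?_).mono ?_ ?_)
    · rintro σ₂ rfl h₄ h₅
      refine ⟨h₁.congr fun q r hr => h₅ [q] le_rfl r ?_, fun q hq => ?_, h₂, h₃⟩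
      · rintro h
        simp only [Cmd.sets, List.mem_singleton] at h
        subst h
        simp at hr
      · simp [Cmd.run, State.setReg, mem_pieces.2 ⟨q, hq, rfl⟩]
    · simp [Cmd.cost]
    · simp [Cmd.cost, card_pieces]
  have hstep : ∀ k < L, ∀ σ₁, J k σ₁ → Runs I (duelRound ;; (.h ≔ 2 * Reg.h)) (pieces Q) σ₁
      (300 * (L + 1) ^ 2 * (Xt + 1) + 4)
      ((Q + 1) * (m / (2 * 2 ^ k) + 1) * (300 * (L + 1) ^ 2 * (Xw + 1)) + (Q + 1) * m * 50 +
        (Q + 1) * 4) (J (k + 1)) := by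
    rintro k hk σ₁ ⟨h₁, h₂, h₃, h₄⟩
    -- `k` is smaller than the least exponent whose power of two reaches `m`.
    have hkm : 2 ^ k < m := by
      by_contra h
      have := Nat.clog_le_of_le_pow (b := 2) (not_lt.1 h)
      omega
    have hround := duel_round (I := I) (Xt := Xt) (Xw := Xw) (cand := cand) (occ := occ) h₁ h₂
      (by positivity) hkm hmL (by rw [h₃]; exact hspec)
      (fun q hq x hx => ht q hq (by have := hx.2.2; have := hx.1; omega))
      (fun q hq x hx => hw q hq (by have := hx.2.2; have := hx.1; omega)) (by rw [h₃]; exact h₄)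
    rw [h₃] at hround
    refine (hround.frame length_of_mem_pieces (Q₁ := fun σ₂ => IsPieceState m n Q σ₂ ∧
        (∀ q ≤ Q, σ₂.reg [q] .h = 2 ^ k) ∧ σ₂.mem .W = W ∧
        DuelInv W cand occ m Q (2 * 2 ^ k) σ₂.mem)
      (fun σ₂ k₁ k₂ k₃ => ⟨h₁.congr fun q r _ => k₃ [q] le_rfl r (by simp [duelRound, Cmd.sets]),
        fun q hq => (k₃ [q] le_rfl _ (by simp [duelRound, Cmd.sets])).trans (h₂ q hq),
        (k₂ _ (by decide)).trans h₃, k₁⟩)).seq ?_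
    rintro σ₂ ⟨k₁, k₂, k₃, k₄⟩
    refine (((Runs.of_straight (by rfl) _ _).frame length_of_mem_pieces ?_).mono ?_ ?_)
    · rintro σ₃ rfl h₆ h₅
      refine ⟨k₁.congr fun q r hr => h₅ [q] le_rfl r ?_, fun q hq => ?_, k₃, ?_⟩
      · rintro h
        simp only [Cmd.sets, List.mem_singleton] at h
        subst h
        simp at hr
      · simp [Cmd.run, State.setReg, mem_pieces.2 ⟨q, hq, rfl⟩, k₂ q hq, pow_succ']
      · rw [pow_succ']
        exact k₄
    · simp [Cmd.cost]
    · simp [Cmd.cost, card_pieces]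
  have hloop : ∀ σ₁, J 0 σ₁ → Runs I (.loop (Reg.h <ₑ Reg.m) (duelRound ;; (.h ≔ 2 * Reg.h)))
      (pieces Q) σ₁ _ _ (J L) := fun σ₁ h₁ => by
    refine Runs.loop ⟨[0], mem_pieces.2 ⟨0, Nat.zero_le _, rfl⟩⟩ (fun k hk σ₂ h₂ p hp => ?_)
      (fun σ₂ h₂ p hp => ?_) hstep h₁
    · obtain ⟨q, hq, rfl⟩ := mem_pieces.1 hp
      have hkm : 2 ^ k < m := by
        by_contra h
        have := Nat.clog_le_of_le_pow (b := 2) (not_lt.1 h)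
        omega
      simpa [h₂.2.1 q hq, h₂.1.m q hq] using hkm
    · obtain ⟨q, hq, rfl⟩ := mem_pieces.1 hp
      simpa [h₂.2.1 q hq, h₂.1.m q hq] using hmL
  have hclear : ∀ σ₁, J L σ₁ → Runs I (.par .x 1 Reg.m (.store .C (Reg.base + Reg.x) 0)) (pieces Q)
      σ₁ _ _ (fun σ₂ => J L σ₂ ∧
        ∀ q ≤ Q, ∀ x, 1 ≤ x → x ≤ m → σ₂.mem .C (q * m + x) = 0) := fun σ₁ h₁ =>
    (store_positions h₁.1 .C).frame length_of_mem_pieces fun σ₂ k₁ k₂ k₃ =>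
      ⟨⟨h₁.1.congr fun q r _ => k₃ [q] le_rfl r (by simp [Cmd.sets]),
        fun q hq => (k₃ [q] le_rfl _ (by simp [Cmd.sets])).trans (h₁.2.1 q hq),
        (k₂ _ (by decide)).trans h₁.2.2.1, by
          have := h₁.2.2.2
          unfold DuelInv at this ⊢
          rwa [k₂ .D (by decide), k₂ .Len (by decide)]⟩, k₁⟩
  have hmark : ∀ σ₁, (J L σ₁ ∧ ∀ q ≤ Q, ∀ x, 1 ≤ x → x ≤ m → σ₁.mem .C (q * m + x) = 0) →
      Runs I (.par .i 1 (.ld .Len Reg.base) (.store .C (Reg.base + .ld .D (Reg.base + Reg.i)) 1))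
        (pieces Q) σ₁ _ _ (fun σ' => IsPieceState m n Q σ' ∧ (∀ q ≤ Q, σ'.reg [q] .h = 2 ^ L) ∧
        σ'.mem .W = W ∧ ∀ q ≤ Q, IsSieve W (cand q) (occ q) m
          (fun x => σ'.mem .C (q * m + x))) := fun σ₁ h₁ =>
    (mark_survivors h₁.1.1 (by omega) hmL (fun q hq x hx => ⟨hx.1, hx.2.1⟩) h₁.1.2.2.2
      h₁.2).frame length_of_mem_pieces fun σ₂ k₁ k₂ k₃ =>
      ⟨h₁.1.1.congr fun q r _ => k₃ [q] le_rfl r (by simp [Cmd.sets]),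
        fun q hq => (k₃ [q] le_rfl _ (by simp [Cmd.sets])).trans (h₁.1.2.1 q hq),
        (k₂ _ (by decide)).trans h₁.1.2.2.1, k₁⟩
  refine (hinit.seq fun σ₁ h₁ => (hone σ₁ h₁).seq fun σ₂ h₂ => (hloop σ₂ h₂).seq fun σ₃ h₃ =>
    (hclear σ₃ h₃).seq hmark).mono ?_ ?_
  · simp
    have h₁ : 1 ≤ (L + 1) ^ 2 * (Xt + 1) := Nat.succ_le_of_lt (by positivity)
    have h₂ : (L + 1) ≤ (L + 1) * ((L + 1) ^ 2 * (Xt + 1)) := Nat.le_mul_of_pos_right _ h₁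
    nlinarith
  · have h₁ := (Nat.le_add_right _ _).trans (sum_div_two_pow_le m L)
    have h₂ : L ≤ m := Nat.clog_le_of_le_pow (Nat.lt_two_pow_self (n := m)).le
    rw [Finset.sum_add_distrib, Finset.sum_add_distrib, ← Finset.sum_mul, ← Finset.mul_sum,
      Finset.sum_add_distrib]
    simp [card_pieces]
    set Y := (L + 1) ^ 2 * (Xw + 1) with hY
    set q := Q + 1
    have h₃ : L + 1 ≤ Y := by
      rw [hY, pow_two, mul_assoc]
      exact Nat.le_mul_of_pos_right _ (by positivity)
    have h₄ : q * (∑ x ∈ Finset.range L, m / (2 * 2 ^ x) + L) * (300 * (L + 1) ^ 2 * (Xw + 1)) ≤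
        q * m * (600 * Y) := by
      calc _ ≤ q * (2 * m) * (300 * (L + 1) ^ 2 * (Xw + 1)) := by gcongr; omega
        _ = _ := by rw [hY]; ring
    have h₅ : q * 2 ≤ q * m := Nat.mul_le_mul_left _ hm
    have h₆ : q * m * (L + 1) ≤ q * m * Y := Nat.mul_le_mul_left _ h₃
    have h₇ : q * 2 * (L + 1) ≤ q * m * (L + 1) := Nat.mul_le_mul_right _ h₅
    rw [show 800 * (L + 1) ^ 2 * (Xw + 1) = 800 * Y by rw [hY]; ring]
    nlinarith

end Machine

/-! ## The sweeping stage -/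

/-- Invariant of the sweeping stage for blocks of size `bs`: `R x` symbols are known to match, and
candidates of different blocks have no text position in common that is still to be compared. -/
structure SweepInv {β : Type*} (W : ℕ → ℕ) (PS : ℕ → Option β) (TS : ℕ → ℕ → Option β)
    (cand occ : ℕ → Prop) (m bs : ℕ) (C R : ℕ → ℕ) : Prop where
  sieve : IsSieve W cand occ m C
  le : ∀ {x}, 1 ≤ x → x ≤ m → C x = 1 → R x ≤ m
  agree : ∀ {x}, 1 ≤ x → x ≤ m → C x = 1 → ∀ i, 1 ≤ i → i ≤ R x → PS i = TS x i
  apart : ∀ {x y}, 1 ≤ x → x < y → y ≤ m → C x = 1 → C y = 1 → (x - 1) / bs ≠ (y - 1) / bs →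
    x + m ≤ y + R y
  done : bs = 0 → ∀ {x}, 1 ≤ x → x ≤ m → C x = 1 → R x = m

/-- `Cd b` is the least candidate in the second half of the `b`-th block, or `0`. -/
structure IsPick (m bs : ℕ) (C Cd : ℕ → ℕ) : Prop where
  none : ∀ {x}, 1 ≤ x → x ≤ m → bs / 2 ≤ (x - 1) % bs → Cd ((x - 1) / bs + 1) = 0 → C x ≠ 1
  pos : ∀ {b}, 1 ≤ b → b ≤ (m + bs - 1) / bs → Cd b ≠ 0 → 1 ≤ Cd b ∧ Cd b ≤ m
  block : ∀ {b}, 1 ≤ b → b ≤ (m + bs - 1) / bs → Cd b ≠ 0 → (Cd b - 1) / bs + 1 = b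
  half : ∀ {b}, 1 ≤ b → b ≤ (m + bs - 1) / bs → Cd b ≠ 0 → bs / 2 ≤ (Cd b - 1) % bs
  cand : ∀ {b}, 1 ≤ b → b ≤ (m + bs - 1) / bs → Cd b ≠ 0 → C (Cd b) = 1
  least : ∀ {y}, 1 ≤ y → y ≤ m → bs / 2 ≤ (y - 1) % bs → C y = 1 → Cd ((y - 1) / bs + 1) ≤ y

/-- `R'` has been updated to the length of the longest match for the picked candidates. -/
structure IsProbe {β : Type*} (PS : ℕ → Option β) (TS : ℕ → ℕ → Option β) (m bs : ℕ)
    (Cd R R' : ℕ → ℕ) : Prop where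
  le : ∀ {b}, 1 ≤ b → b ≤ (m + bs - 1) / bs → Cd b ≠ 0 → R' (Cd b) ≤ m
  ge : ∀ {b}, 1 ≤ b → b ≤ (m + bs - 1) / bs → Cd b ≠ 0 → R (Cd b) ≤ R' (Cd b)
  agree : ∀ {b}, 1 ≤ b → b ≤ (m + bs - 1) / bs → Cd b ≠ 0 →
    ∀ i, R (Cd b) < i → i ≤ R' (Cd b) → PS i = TS (Cd b) i
  ne : ∀ {b}, 1 ≤ b → b ≤ (m + bs - 1) / bs → Cd b ≠ 0 → R' (Cd b) < m →
    PS (R' (Cd b) + 1) ≠ TS (Cd b) (R' (Cd b) + 1)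
  other : ∀ {x}, 1 ≤ x → x ≤ m → Cd ((x - 1) / bs + 1) ≠ x → R' x = R x

/-- The effect of a sweep on the candidates and on the lengths of the known matches. -/
structure IsSweep (m bs : ℕ) (Cd C R C' R' : ℕ → ℕ) : Prop where
  kill : ∀ {i}, 1 ≤ i → i ≤ m → Cd ((i - 1) / bs + 1) ≠ 0 → i ≤ Cd ((i - 1) / bs + 1) →
    R (Cd ((i - 1) / bs + 1)) + (Cd ((i - 1) / bs + 1) - i) + 1 ≤ m → C' i = 0
  keep : ∀ {i}, 1 ≤ i → i ≤ m → (Cd ((i - 1) / bs + 1) ≠ 0 → i ≤ Cd ((i - 1) / bs + 1) →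
    m < R (Cd ((i - 1) / bs + 1)) + (Cd ((i - 1) / bs + 1) - i) + 1) → C' i = C i
  shift : ∀ {i}, 1 ≤ i → i ≤ m → Cd ((i - 1) / bs + 1) ≠ 0 → Cd ((i - 1) / bs + 1) ≤ i →
    C' i = 1 → R' i = R (Cd ((i - 1) / bs + 1)) - (i - Cd ((i - 1) / bs + 1))
  other : ∀ {i}, 1 ≤ i → i ≤ m → (Cd ((i - 1) / bs + 1) ≠ 0 → i < Cd ((i - 1) / bs + 1)) →
    R' i = R i

theorem block_le {m bs x : ℕ} (hbs : 0 < bs) (hx : 1 ≤ x) (hxm : x ≤ m) :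
    (x - 1) / bs + 1 ≤ (m + bs - 1) / bs := by
  rw [Nat.le_div_iff_mul_le hbs, add_mul, one_mul]
  have := Nat.div_mul_le_self (x - 1) bs
  omega

/-- Inside one block of size `2c`, the block of size `c` is decided by whether the remainder is
below `c`, and the remainder grows with the position. This describes what a refinement of the
partition newly separates. -/
theorem halves {c i j : ℕ} (hij : i < j) (h : i / (2 * c) = j / (2 * c))
    (hne : i / c ≠ j / c) : i % (2 * c) < c ∧ c ≤ j % (2 * c) := by
  rcases Nat.eq_zero_or_pos c with rfl | hc
  · simp at hne
  have h₁ := Nat.mod_add_div i (2 * c)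
  have h₂ := Nat.mod_add_div j (2 * c)
  rw [← h] at h₂
  have h₃ : ∀ a b, (a + 2 * c * b) / c = a / c + 2 * b := by
    intro a b
    rw [show 2 * c * b = c * (2 * b) by ring, Nat.add_mul_div_left _ _ hc]
  have h₄ := Nat.mod_lt i (show 0 < 2 * c by omega)
  have h₅ := Nat.mod_lt j (show 0 < 2 * c by omega)
  rw [← h₁, ← h₂, h₃, h₃] at hne
  have h₆ : i % (2 * c) < j % (2 * c) := by omega
  by_contra hcon
  apply hne
  congr 1
  rcases lt_or_ge (j % (2 * c)) c with h₇ | h₇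
  · rw [Nat.div_eq_of_lt h₇, Nat.div_eq_of_lt (by omega)]
  · have h₈ : c ≤ i % (2 * c) := by omega
    rw [Nat.div_eq_of_lt_le (k := 1) (m := i % (2 * c)) (by omega) (by omega),
      Nat.div_eq_of_lt_le (k := 1) (by omega) (by omega)]

/-! ### One sweep: its work, and why it preserves the invariant. -/

section Step

variable {β : Type*} {W : ℕ → ℕ} {PS : ℕ → Option β} {TS : ℕ → ℕ → Option β}
  {cand occ : ℕ → Prop} {m bs : ℕ} {C R Cd R₁ C' R' : ℕ → ℕ}

/-- For a picked candidate `x`, the text from `x + R x` up to `x + m` is still to be compared. By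
`apart` this interval begins no earlier than the intervals of the preceding blocks end, so the
lengths add up to at most the right end `E`. -/
theorem SweepInv.work (hinv : SweepInv W PS TS cand occ m bs C R) (hp : IsPick m bs C Cd) {B : ℕ}
    (hB : B ≤ (m + bs - 1) / bs) {E : ℕ}
    (hE : ∀ b, 1 ≤ b → b ≤ B → Cd b ≠ 0 → Cd b + m ≤ E) :
    ∑ b ∈ Finset.Icc 1 B, (if Cd b = 0 then 0 else m - R (Cd b)) ≤ E := by
  induction B generalizing E with
  | zero => simp
  | succ B ih =>
    rw [Finset.sum_Icc_succ_top (by omega)]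
    split_ifs with h
    · exact ih (by omega) fun b h₁ h₂ => hE b h₁ (by omega)
    · have h₁ := hE (B + 1) (by omega) le_rfl h
      have h₂ := hp.pos (by omega) hB h
      have h₃ := hp.cand (by omega) hB h
      have h₄ := hinv.le h₂.1 h₂.2 h₃
      -- The beginning of the last interval is the right end for the preceding blocks.
      have := ih (E := Cd (B + 1) + R (Cd (B + 1))) (by omega) fun b k₁ k₂ k₃ => by
        have g₁ := hp.pos k₁ (by omega) k₃
        have g₂ := hp.block k₁ (by omega) k₃
        have g₃ := hp.block (by omega) hB h
        have hne : (Cd b - 1) / bs < (Cd (B + 1) - 1) / bs := by omega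
        have hlt : Cd b < Cd (B + 1) := by
          by_contra hle
          have := Nat.div_le_div_right (c := bs) (show Cd (B + 1) - 1 ≤ Cd b - 1 by omega)
          omega
        exact hinv.apart g₁.1 hlt h₂.2 (hp.cand k₁ (by omega) k₃) h₃ hne.ne
      omega

/-- Consistency of the survivors transports both the match and the mismatch of the picked candidate
through its block, and the deletions it causes restore `apart` between the two halves. -/
theorem SweepInv.step (hspec : PieceSpec m W PS TS cand occ)
    (hinv : SweepInv W PS TS cand occ m bs C R) (hbs : bs = 1 ∨ ∃ c, 0 < c ∧ bs = 2 * c)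
    (hp : IsPick m bs C Cd) (hr : IsProbe PS TS m bs Cd R R₁)
    (hs : IsSweep m bs Cd C R₁ C' R') : SweepInv W PS TS cand occ m (bs / 2) C' R' := by
  have hbs0 : 0 < bs := by omega
  have hB : ∀ {x}, 1 ≤ x → x ≤ m → (x - 1) / bs + 1 ≤ (m + bs - 1) / bs :=
    fun h₁ h₂ => block_le hbs0 h₁ h₂
  have hprobe : ∀ {b}, 1 ≤ b → b ≤ (m + bs - 1) / bs → Cd b ≠ 0 →
      ∀ i, 1 ≤ i → i ≤ R₁ (Cd b) → PS i = TS (Cd b) i := by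
    intro b h₁ h₂ h₃ i hi hi'
    have h₄ := hp.pos h₁ h₂ h₃
    rcases le_or_gt i (R (Cd b)) with h | h
    · exact hinv.agree h₄.1 h₄.2 (hp.cand h₁ h₂ h₃) i hi h
    · exact hr.agree h₁ h₂ h₃ i h hi'
  have hC : ∀ {i}, 1 ≤ i → i ≤ m → C' i = 1 → C i = 1 := by
    intro i h₁ h₂ h
    by_cases hk : Cd ((i - 1) / bs + 1) ≠ 0 ∧ i ≤ Cd ((i - 1) / bs + 1) ∧
        R₁ (Cd ((i - 1) / bs + 1)) + (Cd ((i - 1) / bs + 1) - i) + 1 ≤ m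
    · rw [hs.kill h₁ h₂ hk.1 hk.2.1 hk.2.2] at h
      omega
    · rwa [hs.keep h₁ h₂ fun k₁ k₂ => by
        by_contra k₃
        exact hk ⟨k₁, k₂, by omega⟩] at h
  have hzero : ∀ {x y}, 1 ≤ x → x ≤ y → y ≤ m → C x = 1 → C y = 1 → W (y - x) = 0 := by
    intro x y h₁ h₂ h₃ h₄ h₅
    rcases h₂.eq_or_lt with rfl | h₂
    · simpa using hspec.witness_zero
    · exact hinv.sieve.zero h₁ h₂ h₃ h₄ h₅
  have hR : ∀ {i}, 1 ≤ i → i ≤ m → C' i = 1 →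
      (Cd ((i - 1) / bs + 1) ≠ 0 ∧ Cd ((i - 1) / bs + 1) ≤ i ∧
        R' i = R₁ (Cd ((i - 1) / bs + 1)) - (i - Cd ((i - 1) / bs + 1))) ∨
      ((Cd ((i - 1) / bs + 1) ≠ 0 → i < Cd ((i - 1) / bs + 1)) ∧ R' i = R i) := by
    intro i h₁ h₂ h
    by_cases hk : Cd ((i - 1) / bs + 1) ≠ 0 ∧ Cd ((i - 1) / bs + 1) ≤ i
    · exact Or.inl ⟨hk.1, hk.2, hs.shift h₁ h₂ hk.1 hk.2 h⟩
    · have hlt : Cd ((i - 1) / bs + 1) ≠ 0 → i < Cd ((i - 1) / bs + 1) := fun h => by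
        by_contra h'
        exact hk ⟨h, by omega⟩
      refine Or.inr ⟨hlt, ?_⟩
      rw [hs.other h₁ h₂ hlt, hr.other h₁ h₂ fun h => ?_]
      exact absurd (hlt (by omega)) (by omega)
  constructor
  · constructor
    · intro i h₁ h₂
      by_cases hk : Cd ((i - 1) / bs + 1) ≠ 0 ∧ i ≤ Cd ((i - 1) / bs + 1) ∧
          R₁ (Cd ((i - 1) / bs + 1)) + (Cd ((i - 1) / bs + 1) - i) + 1 ≤ m
      · exact Or.inl (hs.kill h₁ h₂ hk.1 hk.2.1 hk.2.2)
      · rw [hs.keep h₁ h₂ fun k₁ k₂ => by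
          by_contra k₃
          exact hk ⟨k₁, k₂, by omega⟩]
        exact hinv.sieve.bool h₁ h₂
    · exact fun h₁ h₂ h => hinv.sieve.isCand h₁ h₂ (hC h₁ h₂ h)
    · exact fun h₁ h₂ h₃ h h' => hinv.sieve.zero h₁ h₂ h₃ (hC h₁ (by omega) h) (hC (by omega) h₃ h')
    · intro i hc ho
      have h₁ := hspec.cand_pos hc
      have h₂ := hspec.cand_le hc
      have h₃ := hinv.sieve.complete hc ho
      rw [hs.keep h₁ h₂ fun k₁ k₂ => ?_, h₃]
      -- Suppose that an occurrence `i` is deleted by the picked `x`. Its match, shifted to `x`, has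
      -- length `m - (x - i)`, at least `R₁ x + 1`, and so contradicts the mismatch found there.
      by_contra k₃
      set b := (i - 1) / bs + 1
      have hb : 1 ≤ b := Nat.le_add_left 1 _
      have g₁ := hp.pos hb (hB h₁ h₂) k₁
      have g₂ := hp.cand hb (hB h₁ h₂) k₁
      refine hr.ne hb (hB h₁ h₂) k₁ (by omega) ?_
      exact hspec.shift k₂ hc (hinv.sieve.isCand g₁.1 g₁.2 g₂) (hzero h₁ k₂ g₁.2 h₃ g₂) le_rfl
        ((hspec.occ_iff hc).1 ho) _ (by omega) (by omega)
  · intro i h₁ h₂ h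
    rcases hR h₁ h₂ h with ⟨k₁, k₂, k₃⟩ | ⟨k₁, k₃⟩
    · have := hr.le (Nat.le_add_left 1 _) (hB h₁ h₂) k₁
      omega
    · rw [k₃]
      exact hinv.le h₁ h₂ (hC h₁ h₂ h)
  · intro i h₁ h₂ h
    rcases hR h₁ h₂ h with ⟨k₁, k₂, k₃⟩ | ⟨k₁, k₃⟩
    · rw [k₃]
      have hb : 1 ≤ (i - 1) / bs + 1 := Nat.le_add_left 1 _
      have g₁ := hp.pos hb (hB h₁ h₂) k₁
      have g₂ := hp.cand hb (hB h₁ h₂) k₁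
      exact hspec.shift k₂ (hinv.sieve.isCand g₁.1 g₁.2 g₂) (hinv.sieve.isCand h₁ h₂ (hC h₁ h₂ h))
        (hzero g₁.1 k₂ h₂ g₂ (hC h₁ h₂ h)) (hr.le hb (hB h₁ h₂) k₁)
        (hprobe hb (hB h₁ h₂) k₁)
    · rw [k₃]
      exact hinv.agree h₁ h₂ (hC h₁ h₂ h)
  · intro i j hi hij hj hCi hCj hne
    have hj₁ : 1 ≤ j := by omega
    have him : i ≤ m := by omega
    have hb : 1 ≤ (j - 1) / bs + 1 := Nat.le_add_left 1 _
    by_cases hsame : (i - 1) / bs = (j - 1) / bs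
    -- The pair is newly separated: `i` lies in the first half and `j` in the second, so a candidate
    -- `x` was picked with `i < x ≤ j`. Since `i` was not deleted, `i + m ≤ x + R₁ x`, and the new
    -- value at `j` satisfies `j + R' j ≥ x + R₁ x`, also when the subtraction truncates.
    · obtain ⟨c, hc, rfl⟩ : ∃ c, 0 < c ∧ bs = 2 * c := by
        rcases hbs with rfl | h
        · simp at hsame; omega
        · exact h
      rw [Nat.mul_div_cancel_left c (by omega)] at hne
      obtain ⟨k₁, k₂⟩ := halves (by omega) hsame hne
      have hx₀ : Cd ((j - 1) / (2 * c) + 1) ≠ 0 := fun h =>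
        hp.none hj₁ hj (by omega) h (hC hj₁ hj hCj)
      have hx₁ := hp.least hj₁ hj (by omega) (hC hj₁ hj hCj)
      have hx₂ := hp.block hb (hB hj₁ hj) hx₀
      have hx₃ := hp.half hb (hB hj₁ hj) hx₀
      have hx₄ := hp.pos hb (hB hj₁ hj) hx₀
      have hR' := hs.shift hj₁ hj hx₀ hx₁ hCj
      have hkill := hs.kill hi him
      rw [hsame] at hkill
      generalize Cd ((j - 1) / (2 * c) + 1) = x at *
      have hix : i < x := by
        have e₁ := Nat.mod_add_div (i - 1) (2 * c)
        have e₂ := Nat.mod_add_div (x - 1) (2 * c)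
        rw [show (x - 1) / (2 * c) = (i - 1) / (2 * c) by omega] at e₂
        omega
      have : ¬ (R₁ x + (x - i) + 1 ≤ m) := fun h => by
        have := hkill hx₀ hix.le h
        omega
      omega
    -- The pair was separated before. If `j` received its value from the pick `x` of its block, then
    -- `i < x` and the old invariant for `i` and `x` suffices, because `R` at `x` has only grown;
    -- otherwise the value at `j` is the old one.
    · rcases hR hj₁ hj hCj with ⟨k₁, k₂, k₃⟩ | ⟨k₁, k₃⟩
      · have g₁ := hp.pos hb (hB hj₁ hj) k₁
        have g₂ := hp.cand hb (hB hj₁ hj) k₁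
        have g₃ := hp.block hb (hB hj₁ hj) k₁
        have g₄ := hr.ge hb (hB hj₁ hj) k₁
        generalize Cd ((j - 1) / bs + 1) = x at *
        have hle := Nat.div_le_div_right (c := bs) (show i - 1 ≤ j - 1 by omega)
        have hlt : i < x := by
          by_contra h
          have := Nat.div_le_div_right (c := bs) (show x - 1 ≤ i - 1 by omega)
          omega
        have := hinv.apart hi hlt g₁.2 (hC hi him hCi) g₂ (by omega)
        omega
      · rw [k₃]
        exact hinv.apart hi hij hj (hC hi him hCi) (hC hj₁ hj hCj) hsame
  -- With blocks of size 1 every candidate is its own pick; unless its match has length `m`, it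
  -- deletes itself.
  · intro h0 i h₁ h₂ h
    have hbs1 : bs = 1 := by omega
    subst hbs1
    simp only [Nat.div_one] at *
    have e : i - 1 + 1 = i := by omega
    have hx₀ : Cd (i - 1 + 1) ≠ 0 := fun h' =>
      hp.none h₁ h₂ (by omega) (by simpa using h') (hC h₁ h₂ h)
    have hbl := hp.block (b := i - 1 + 1) (by omega) (by simpa using by omega) hx₀
    have hx := hp.pos (b := i - 1 + 1) (by omega) (by simpa using by omega) hx₀
    have hle := hr.le (b := i - 1 + 1) (by omega) (by simpa using by omega) hx₀
    simp only [Nat.div_one] at hbl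
    have hxi : Cd (i - 1 + 1) = i := by omega
    have h₃ := hs.shift h₁ h₂ (by simpa using hx₀) (by simpa using hxi.le) h
    have h₄ := hs.kill h₁ h₂ (by simpa using hx₀) (by simpa using hxi.ge)
    simp only [Nat.div_one, hxi] at h₃ h₄ hle
    have : ¬ (R₁ i + (i - i) + 1 ≤ m) := fun h' => by
      have := h₄ h'
      omega
    omega

end Step

section Machine

variable {β : Type*} {I : Input β}

/-- Cells of `Cand` and `Wit` are numbered by blocks; this keeps them within the `m` cells of their
piece. -/
theorem blocks_le {m bs : ℕ} (hbs : 0 < bs) : (m + bs - 1) / bs ≤ m := by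
  refine Nat.le_of_lt_succ (Nat.div_lt_of_lt_mul ?_)
  have := Nat.mul_le_mul_right m hbs
  rw [Nat.mul_succ]
  omega

/-- A piece in the sweeping stage for blocks of size `bs`. -/
structure IsSweepState (m n Q bs : ℕ) (σ : State β) : Prop extends IsPieceState m n Q σ where
  bs : ∀ q ≤ Q, σ.reg [q] .bs = bs

theorem IsSweepState.congr {m n Q bs : ℕ} {σ σ' : State β} (h : IsSweepState m n Q bs σ)
    (h' : ∀ q, ∀ r, σ'.reg [q] r = σ.reg [q] r) : IsSweepState m n Q bs σ' :=
  ⟨h.toIsPieceState.congr fun q r _ => h' q r, fun q hq => (h' q _).trans (h.bs q hq)⟩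

theorem IsSweepState.blocks {m n Q bs : ℕ} {σ : State β} (h : IsSweepState m n Q bs σ) :
    positions Q ((m + bs - 1) / bs) = children (pieces Q) (fun p => σ.eval p 1)
      (fun p => σ.eval p ((Reg.m + Reg.bs - 1) / Reg.bs)) :=
  children_pieces_congr (fun _ _ => rfl) fun q hq => by simp [h.m q hq, h.bs q hq]

theorem IsPieceState.positions {m n Q : ℕ} {σ : State β} (h : IsPieceState m n Q σ) :
    positions Q m = children (pieces Q) (fun p => σ.eval p 1) (fun p => σ.eval p Reg.m) :=
  children_pieces_congr (fun _ _ => rfl) fun q hq => h.m q hq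

theorem positions_mono {Q m m' : ℕ} (h : m ≤ m') : positions Q m ⊆ positions Q m' := by
  intro p hp
  obtain ⟨q, x, h₁, h₂, h₃, rfl⟩ := mem_positions.1 hp
  exact pair_mem_positions.2 ⟨h₁, h₂, h₃.trans h⟩

/-- Each processor addresses its own cell, so there is no conflict, and the guarded store can be
read off cell by cell. -/
theorem State.run_ite_store (σ : State β) {Q m : ℕ} {S : Finset Proc} (hS : S ⊆ positions Q m)
    (e : Expr) (A : Arr) {a : Expr} (v : Expr)
    (ha : ∀ q x, [q, x] ∈ S → σ.eval [q, x] a = q * m + x) {q x : ℕ} (hx : 1 ≤ x) (hxm : x ≤ m) :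
    ((Cmd.ite e (.store A a v) .skip).run I S σ).mem A (q * m + x) =
      if [q, x] ∈ S ∧ σ.eval [q, x] e ≠ 0 then σ.eval [q, x] v else σ.mem A (q * m + x) := by
  have hsub : σ.sel S e ⊆ S := Finset.filter_subset _ _
  have hmem : [q, x] ∈ σ.sel S e ↔ [q, x] ∈ S ∧ σ.eval [q, x] e ≠ 0 := Finset.mem_filter
  simp only [Cmd.run]
  split_ifs with h
  · exact σ.write_pair (Nat.zero_le 1) (hsub.trans hS) (fun q x h => ha q x (hsub h)) (hmem.2 h)
  · refine σ.write_mem_of_forall_ne _ fun p hp hpa => h ?_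
    obtain ⟨q', x', -, hx', hxm', rfl⟩ := mem_positions.1 (hS (hsub hp))
    rw [ha _ _ (hsub hp)] at hpa
    obtain ⟨rfl, rfl⟩ := addr_inj hx' hxm' hx hxm hpa
    exact hmem.1 hp

/-! ### The sweeping stage: choosing one candidate per block -/

theorem sweep_clear {m n Q bs : ℕ} {σ : State β} (hσ : IsSweepState m n Q bs σ) (hbs : 0 < bs) :
    Runs I (.par .b 1 ((Reg.m + Reg.bs - 1) / Reg.bs) (.store .Cand (Reg.base + Reg.b) 0))
      (pieces Q) σ 14 ((Q + 1) * m * 6 + (Q + 1) * 9)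
      (fun σ' => ∀ q ≤ Q, ∀ b, 1 ≤ b → b ≤ (m + bs - 1) / bs → σ'.mem .Cand (q * m + b) = 0) := by
  refine ((Runs.par_straight (by rfl) hσ.blocks).imp ?_).mono ?_ ?_
  · rintro σ' rfl q hq b hb hbB
    set S := positions Q ((m + bs - 1) / bs) with hS
    have hmem : [q, b] ∈ S := pair_mem_positions.2 ⟨hq, hb, hbB⟩
    exact (σ.fork S .b).write_pair (A := .Cand) (Nat.zero_le 1)
      (positions_mono (blocks_le hbs)) (a := fun p => (σ.fork S .b).eval p (Reg.base + Reg.b))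
      (v := fun p => (σ.fork S .b).eval p 0) (fun q x h => by
        rw [← hS] at h
        simp [σ.fork_reg_pair _ h, hσ.base q (pair_mem_positions.1 h).1]) hmem
  · simp [Cmd.cost]
  · have := Nat.mul_le_mul_left (Q + 1) (blocks_le (m := m) hbs)
    rw [card_pieces, card_positions]
    simp [Cmd.cost]
    nlinarith

/-- The priority rule does the selection: all candidates in the second half of a block write to the
same cell, and the processor of the least position wins. -/
theorem sweep_pick {m n Q bs : ℕ} {σ : State β} (hσ : IsSweepState m n Q bs σ) (hbs : 0 < bs)
    (hCd : ∀ q ≤ Q, ∀ b, 1 ≤ b → b ≤ (m + bs - 1) / bs → σ.mem .Cand (q * m + b) = 0) :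
    Runs I (.par .x 1 Reg.m (
      .ite ((.ld .C (Reg.base + Reg.x) =ₑ 1) ∧ₑ (Reg.bs / 2 ≤ₑ (Reg.x - 1) % Reg.bs))
        (.store .Cand (Reg.base + ((Reg.x - 1) / Reg.bs + 1)) Reg.x)
        .skip)) (pieces Q) σ 40 ((Q + 1) * m * 40 + (Q + 1) * 3)
      (fun σ' => ∀ q ≤ Q, IsPick m bs (fun x => σ.mem .C (q * m + x))
        (fun b => σ'.mem .Cand (q * m + b))) := by
  refine ((Runs.par_straight (by rfl) hσ.positions).imp ?_).mono ?_ ?_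
  · rintro σ' rfl q hq
    set S := positions Q m
    set τ := σ.fork S .x with hτ
    have hreg : ∀ {q x}, [q, x] ∈ S → τ.reg [q, x] .base = q * m ∧ τ.reg [q, x] .x = x ∧
        τ.reg [q, x] .bs = bs := by
      intro q x h
      have hq := (pair_mem_positions.1 h).1
      simp [hτ, σ.fork_reg_pair _ h, hσ.base q hq, hσ.bs q hq]
    set e : Expr := (.ld .C (Reg.base + Reg.x) =ₑ 1) ∧ₑ (Reg.bs / 2 ≤ₑ (Reg.x - 1) % Reg.bs)
      with he
    set a : Expr := Reg.base + ((Reg.x - 1) / Reg.bs + 1) with ha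
    have hsel : ∀ {q x}, [q, x] ∈ τ.sel S e ↔ [q, x] ∈ S ∧ σ.mem .C (q * m + x) = 1 ∧
        bs / 2 ≤ (x - 1) % bs := by
      intro q x
      rw [State.sel, Finset.mem_filter]
      refine and_congr_right fun h => ?_
      have hm : τ.mem = σ.mem := rfl
      simp [he, hreg h, hm]
    have haddr : ∀ {q x}, [q, x] ∈ S → τ.eval [q, x] a = q * m + ((x - 1) / bs + 1) := by
      intro q x h
      simp [ha, hreg h]
    have hS : ∀ {p}, p ∈ τ.sel S e → ∃ q x, p = [q, x] := by
      intro p hp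
      obtain ⟨q, x, -, -, -, rfl⟩ := mem_positions.1 (Finset.mem_filter.1 hp).1
      exact ⟨q, x, rfl⟩
    -- Either nobody writes to the cell, which then keeps the 0 from clearing, or it receives the
    -- least position that competes for it.
    have key : ∀ b, 1 ≤ b → b ≤ (m + bs - 1) / bs →
        (∀ x, [q, x] ∈ τ.sel S e → (x - 1) / bs + 1 ≠ b) ∧
          (τ.write (τ.sel S e) .Cand (fun p => τ.eval p a) (fun p => τ.eval p Reg.x)).mem .Cand
            (q * m + b) = 0 ∨
        ∃ x, [q, x] ∈ τ.sel S e ∧ (x - 1) / bs + 1 = b ∧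
          (∀ y, [q, y] ∈ τ.sel S e → (y - 1) / bs + 1 = b → x ≤ y) ∧
          (τ.write (τ.sel S e) .Cand (fun p => τ.eval p a) (fun p => τ.eval p Reg.x)).mem .Cand
            (q * m + b) = x := by
      intro b hb hbB
      have hbm := hbB.trans (blocks_le hbs)
      have hcell : ∀ {q' x'}, [q', x'] ∈ τ.sel S e → τ.eval [q', x'] a = q * m + b →
          q' = q ∧ (x' - 1) / bs + 1 = b := by
        intro q' x' hp hpa
        have h := (hsel.1 hp).1
        rw [haddr h] at hpa
        have hx := pair_mem_positions.1 h
        exact addr_inj (Nat.le_add_left 1 _)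
          ((block_le hbs hx.2.1 hx.2.2).trans (blocks_le hbs)) hb hbm hpa
      by_cases h : ∃ x, [q, x] ∈ τ.sel S e ∧ (x - 1) / bs + 1 = b
      · right
        classical
        obtain ⟨h₁, h₂⟩ := Nat.find_spec h
        have hmin : ∀ y, [q, y] ∈ τ.sel S e → (y - 1) / bs + 1 = b → Nat.find h ≤ y :=
          fun y k₁ k₂ => Nat.find_min' h ⟨k₁, k₂⟩
        refine ⟨Nat.find h, h₁, h₂, hmin, ?_⟩
        have hx := (hsel.1 h₁).1
        have := τ.write_mem_of_le (A := .Cand) (S := τ.sel S e) (a := fun p => τ.eval p a)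
          (fun p => τ.eval p Reg.x) h₁ (fun p' hp' hpa => by
            obtain ⟨q', x', rfl⟩ := hS hp'
            simp only [haddr hx, h₂] at hpa
            obtain ⟨rfl, k⟩ := hcell hp' hpa
            refine Or.inr ?_
            have := hmin x' hp' k
            rcases this.eq_or_lt with h' | h'
            · rw [h']
            · exact le_of_lt (List.Lex.cons (List.Lex.rel h')))
        simp only [haddr hx, h₂] at this
        rw [this]
        exact (hreg hx).2.1
      · push Not at h
        refine Or.inl ⟨h, ?_⟩
        rw [State.write_mem_of_forall_ne]
        · exact hCd q hq b hb hbB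
        · intro p hp hpa
          obtain ⟨q', x', rfl⟩ := hS hp
          obtain ⟨rfl, k⟩ := hcell hp hpa
          exact h x' hp k
    have hmem : ∀ {x}, 1 ≤ x → x ≤ m → [q, x] ∈ S := fun h₁ h₂ =>
      pair_mem_positions.2 ⟨hq, h₁, h₂⟩
    simp only [Cmd.run]
    set Cd := fun b => (τ.write (τ.sel S e) .Cand (fun p => τ.eval p a)
      (fun p => τ.eval p Reg.x)).mem .Cand (q * m + b)
    have key₁ : ∀ b, 1 ≤ b → b ≤ (m + bs - 1) / bs → Cd b ≠ 0 →
        [q, Cd b] ∈ τ.sel S e ∧ (Cd b - 1) / bs + 1 = b := by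
      intro b h₁ h₂ h₃
      rcases key b h₁ h₂ with ⟨-, h⟩ | ⟨x, k₁, k₂, -, k₃⟩
      · exact absurd h h₃
      · rw [show Cd b = x from k₃]
        exact ⟨k₁, k₂⟩
    constructor
    · intro x hx hxm hh h0 hC
      rcases key _ (Nat.le_add_left 1 _) (block_le hbs hx hxm) with ⟨h, -⟩ | ⟨y, h₁, -, -, h₃⟩
      · exact h x (hsel.2 ⟨hmem hx hxm, hC, hh⟩) rfl
      · have := (pair_mem_positions.1 (hsel.1 h₁).1).2.1
        have := h₃.symm.trans h0
        omega
    · exact fun h₁ h₂ h₃ => (pair_mem_positions.1 (hsel.1 (key₁ _ h₁ h₂ h₃).1).1).2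
    · exact fun h₁ h₂ h₃ => (key₁ _ h₁ h₂ h₃).2
    · exact fun h₁ h₂ h₃ => (hsel.1 (key₁ _ h₁ h₂ h₃).1).2.2
    · exact fun h₁ h₂ h₃ => (hsel.1 (key₁ _ h₁ h₂ h₃).1).2.1
    · intro y hy hym hh hC
      rcases key _ (Nat.le_add_left 1 _) (block_le hbs hy hym) with ⟨-, h⟩ | ⟨x, -, -, h₂, h₃⟩
      · exact h.le.trans (Nat.zero_le y)
      · exact h₃.le.trans (h₂ y (hsel.2 ⟨hmem hy hym, hC, hh⟩) rfl)
  · simp [Cmd.cost]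
  · rw [card_pieces, card_positions]
    simp [Cmd.cost]
    nlinarith

/-! ### The sweeping stage: sweeping the blocks -/

theorem sweep_blocks {m n Q bs : ℕ} {σ : State β} (hσ : IsSweepState m n Q bs σ) :
    Runs I (.par .i 1 Reg.m (
      (.x ≔ .ld .Cand (Reg.base + ((Reg.i - 1) / Reg.bs + 1))) ;;
      .ite Reg.x
        ((.rx ≔ .ld .R (Reg.base + Reg.x)) ;;
         .ite ((Reg.i ≤ₑ Reg.x) ∧ₑ (Reg.rx + (Reg.x - Reg.i) + 1 ≤ₑ Reg.m))
           (.store .C (Reg.base + Reg.i) 0)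
           .skip ;;
         .ite ((Reg.x ≤ₑ Reg.i) ∧ₑ (.ld .C (Reg.base + Reg.i) =ₑ 1))
           (.store .R (Reg.base + Reg.i) (Reg.rx - (Reg.i - Reg.x)))
           .skip)
        .skip)) (pieces Q) σ 70 ((Q + 1) * m * 70 + (Q + 1) * 3)
      (fun σ' => ∀ q ≤ Q, IsSweep m bs (fun b => σ.mem .Cand (q * m + b))
        (fun x => σ.mem .C (q * m + x)) (fun x => σ.mem .R (q * m + x))
        (fun x => σ'.mem .C (q * m + x)) (fun x => σ'.mem .R (q * m + x))) := by
  refine ((Runs.par_straight (by rfl) hσ.positions).imp ?_).mono ?_ ?_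
  · rintro σ' rfl q hq
    set S := positions Q m
    set τ := σ.fork S .i with hτ
    let X : ℕ → ℕ → ℕ := fun q i => σ.mem .Cand (q * m + ((i - 1) / bs + 1))
    set τ₁ := τ.setReg S .x
      (fun p => τ.eval p (.ld .Cand (Reg.base + ((Reg.i - 1) / Reg.bs + 1)))) with hτ₁
    have hreg₁ : ∀ {q i}, [q, i] ∈ S → τ₁.reg [q, i] .base = q * m ∧ τ₁.reg [q, i] .i = i ∧
        τ₁.reg [q, i] .m = m ∧ τ₁.reg [q, i] .x = X q i := by
      intro q i h
      have hq := (pair_mem_positions.1 h).1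
      simp [hτ₁, hτ, State.setReg, h, σ.fork_reg_pair _ h, hσ.base q hq, hσ.bs q hq, hσ.m q hq, X]
    set S₁ := τ₁.sel S Reg.x with hS₁
    have hsub : S₁ ⊆ S := Finset.filter_subset _ _
    have hmem₁ : ∀ {q i}, [q, i] ∈ S₁ ↔ [q, i] ∈ S ∧ X q i ≠ 0 := by
      intro q i
      rw [hS₁, State.sel, Finset.mem_filter]
      refine and_congr_right fun h => ?_
      simp [hreg₁ h]
    -- All processors read the value at the picked candidate before any of them overwrites `R`,
    -- including the candidate itself.
    set τ₂ := τ₁.setReg S₁ .rx (fun p => τ₁.eval p (.ld .R (Reg.base + Reg.x))) with hτ₂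
    have hreg₂ : ∀ {q i}, [q, i] ∈ S₁ → τ₂.reg [q, i] .base = q * m ∧ τ₂.reg [q, i] .i = i ∧
        τ₂.reg [q, i] .m = m ∧ τ₂.reg [q, i] .x = X q i ∧
        τ₂.reg [q, i] .rx = σ.mem .R (q * m + X q i) := by
      intro q i h
      have h' := hsub h
      have hm₁ : τ₁.mem = σ.mem := rfl
      simp [hτ₂, State.setReg, h, hreg₁ h', hm₁]
    have haddr : ∀ q i, [q, i] ∈ S₁ → τ₂.eval [q, i] (Reg.base + Reg.i) = q * m + i := by
      intro q i h
      simp [hreg₂ h]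
    have hm₂ : τ₂.mem = σ.mem := rfl
    set e₁ : Expr := (Reg.i ≤ₑ Reg.x) ∧ₑ (Reg.rx + (Reg.x - Reg.i) + 1 ≤ₑ Reg.m) with he₁
    set e₂ : Expr := (Reg.x ≤ₑ Reg.i) ∧ₑ (.ld .C (Reg.base + Reg.i) =ₑ 1) with he₂
    set τ₃ := (Cmd.ite e₁ (.store .C (Reg.base + Reg.i) 0) .skip).run I S₁ τ₂ with hτ₃
    have hreg₃ : τ₃.reg = τ₂.reg := rfl
    set τ₄ := (Cmd.ite e₂ (.store .R (Reg.base + Reg.i) (Reg.rx - (Reg.i - Reg.x))) .skip).run I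
      S₁ τ₃ with hτ₄
    have hrun : Cmd.run I ((.x ≔ .ld .Cand (Reg.base + ((Reg.i - 1) / Reg.bs + 1))) ;;
        .ite Reg.x
          ((.rx ≔ .ld .R (Reg.base + Reg.x)) ;;
           .ite e₁ (.store .C (Reg.base + Reg.i) 0) .skip ;;
           .ite e₂ (.store .R (Reg.base + Reg.i) (Reg.rx - (Reg.i - Reg.x))) .skip)
          .skip) S τ = τ₄ := rfl
    rw [hrun]
    have hC : ∀ {i}, 1 ≤ i → i ≤ m → τ₄.mem .C (q * m + i) =
        if X q i ≠ 0 ∧ i ≤ X q i ∧ σ.mem .R (q * m + X q i) + (X q i - i) + 1 ≤ m then 0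
        else σ.mem .C (q * m + i) := by
      intro i hi him
      have : τ₄.mem .C = τ₃.mem .C := by
        simp only [hτ₄, Cmd.run]
        exact State.write_mem_ne _ _ (by decide) _ _
      rw [this, hτ₃, State.run_ite_store _ hsub _ _ _ haddr hi him, hm₂]
      refine if_congr ?_ rfl rfl
      have h : [q, i] ∈ S := pair_mem_positions.2 ⟨hq, hi, him⟩
      constructor
      · rintro ⟨h₁, h₂⟩
        refine ⟨(hmem₁.1 h₁).2, ?_⟩
        simpa [he₁, hreg₂ h₁] using h₂
      · rintro ⟨h₁, h₂⟩
        have h₁ := hmem₁.2 ⟨h, h₁⟩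
        refine ⟨h₁, ?_⟩
        simpa [he₁, hreg₂ h₁] using h₂
    -- The second conditional reads `C` after the deletions, so the condition refers to the final
    -- value `τ₄.mem .C`.
    have hR : ∀ {i}, 1 ≤ i → i ≤ m → τ₄.mem .R (q * m + i) =
        if X q i ≠ 0 ∧ X q i ≤ i ∧ τ₄.mem .C (q * m + i) = 1 then
          σ.mem .R (q * m + X q i) - (i - X q i)
        else σ.mem .R (q * m + i) := by
      intro i hi him
      have hR₃ : τ₃.mem .R = σ.mem .R := by
        simp only [hτ₃, Cmd.run]
        exact State.write_mem_ne _ _ (by decide) _ _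
      have hC₄ : τ₄.mem .C = τ₃.mem .C := by
        simp only [hτ₄, Cmd.run]
        exact State.write_mem_ne _ _ (by decide) _ _
      have h : [q, i] ∈ S := pair_mem_positions.2 ⟨hq, hi, him⟩
      have haddr₃ : ∀ q i, [q, i] ∈ S₁ → τ₃.eval [q, i] (Reg.base + Reg.i) = q * m + i := by
        intro q i h
        simp [hreg₃, hreg₂ h]
      rw [hC₄, hτ₄, State.run_ite_store _ hsub _ _ _ haddr₃ hi him, hR₃]
      by_cases hX : X q i = 0
      · rw [if_neg fun k => (hmem₁.1 k.1).2 hX, if_neg fun k => k.1 hX]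
      · have h₁ := hmem₁.2 ⟨h, hX⟩
        refine if_congr ?_ ?_ rfl
        · simp [he₂, h₁, hX, hreg₃, hreg₂ h₁]
        · simp [hreg₃, hreg₂ h₁]
    constructor
    · intro i hi him h₁ h₂ h₃
      rw [hC hi him, if_pos ⟨h₁, h₂, h₃⟩]
    · intro i hi him h
      rw [hC hi him, if_neg]
      rintro ⟨k₁, k₂, k₃⟩
      exact absurd (h k₁ k₂) (not_lt.2 k₃)
    · intro i hi him h₁ h₂ h₃
      rw [hR hi him, if_pos ⟨h₁, h₂, h₃⟩]
    · intro i hi him h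
      rw [hR hi him, if_neg]
      rintro ⟨k₁, k₂, -⟩
      exact absurd (h k₁) (not_lt.2 k₂)
  · simp [Cmd.cost]
  · rw [card_pieces, card_positions]
    simp [Cmd.cost]
    nlinarith

end Machine

section Machine

variable {β : Type*} {I : Input β}

/-! ### The sweeping stage: comparing the remaining symbols -/

/-- `r + w` is the first position after `r` at which the strings differ, and `w = 0` if there is
none. -/
structure IsMismatch (PS TS : ℕ → Option β) (m r w : ℕ) : Prop where
  agree : ∀ {i}, r < i → i ≤ m → (w ≠ 0 → i < r + w) → PS i = TS i
  le : w ≠ 0 → r + w ≤ m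
  ne : w ≠ 0 → PS (r + w) ≠ TS (r + w)

/-- Again the priority rule computes a minimum: among the mismatching positions the smallest one
succeeds. The stored distance from `rx` is at least 1, so 0 can stand for a full match. -/
theorem probe_compare {m Q Xt Xw : ℕ} {σ : State β} {S : Finset Proc} (hS : S ⊆ positions Q m)
    {X r : ℕ → ℕ → ℕ}
    (hreg : ∀ {q b}, [q, b] ∈ S → σ.reg [q, b] .base = q * m ∧ σ.reg [q, b] .q = q ∧
      σ.reg [q, b] .m = m ∧ σ.reg [q, b] .b = b ∧ σ.reg [q, b] .x = X q b ∧
      σ.reg [q, b] .rx = r q b)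
    (hWit : ∀ {q b}, [q, b] ∈ S → σ.mem .Wit (q * m + b) = 0)
    (ht : ∀ {q b}, [q, b] ∈ S → I.ξt (I.str (q + 1)).length ≤ Xt)
    (hw : ∀ {q b}, [q, b] ∈ S → I.ξw (I.str (q + 1)).length ≤ Xw) :
    Runs I (.par .i (Reg.rx + 1) Reg.m (
        .loadSym .c 0 Reg.i ;;
        .reenc .d (Reg.q + 1) Reg.x Reg.i ;;
        .ite (.symEq .c .d) .skip (.store .Wit (Reg.base + Reg.b) (Reg.i - Reg.rx)))) S σ
      (30 + Xt) (S.card * 5 + (children S (fun p => σ.eval p (Reg.rx + 1))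
        (fun p => σ.eval p Reg.m)).card * (30 + Xw))
      (fun σ' => ∀ {q b}, [q, b] ∈ S → IsMismatch (sym (I.str 0)) (I.re (I.str (q + 1)) (X q b)) m
        (r q b) (σ'.mem .Wit (q * m + b))) := by
  set S' := children S (fun p => σ.eval p (Reg.rx + 1)) (fun p => σ.eval p Reg.m) with hS'
  have hmem' : ∀ {p}, p ∈ S' → ∃ q b i, p = [q, b, i] ∧ [q, b] ∈ S ∧ r q b < i ∧ i ≤ m := by
    intro p hp
    obtain ⟨p₀, hp₀, i, h₁, h₂, rfl⟩ := mem_children.1 hp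
    obtain ⟨q, b, -, -, -, rfl⟩ := mem_positions.1 (hS hp₀)
    simp only [State.eval_add, State.eval_one, State.eval_reg, hreg hp₀] at h₁ h₂
    exact ⟨q, b, i, rfl, hp₀, h₁, h₂⟩
  have hmem : ∀ {q b i}, [q, b] ∈ S → r q b < i → i ≤ m → [q, b, i] ∈ S' := by
    intro q b i h h₁ h₂
    refine mem_children.2 ⟨[q, b], h, i, ?_, ?_, rfl⟩
    · simpa [hreg h] using h₁
    · simpa [hreg h] using h₂
  have hlen : ∀ p ∈ S', p.length = 3 := by
    intro p hp
    obtain ⟨q, b, i, rfl, -⟩ := hmem' hp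
    rfl
  set τ := σ.fork S' .i with hτ
  have hregτ : ∀ {q b i}, [q, b] ∈ S → [q, b, i] ∈ S' → τ.reg [q, b, i] .base = q * m ∧
      τ.reg [q, b, i] .q = q ∧ τ.reg [q, b, i] .m = m ∧ τ.reg [q, b, i] .b = b ∧
      τ.reg [q, b, i] .x = X q b ∧ τ.reg [q, b, i] .rx = r q b ∧ τ.reg [q, b, i] .i = i := by
    intro q b i h h'
    simp [hτ, σ.fork_reg_triple _ h', hreg h]
  have hload : Triple I σ.mem (.loadSym .c 0 Reg.i ;; .reenc .d (Reg.q + 1) Reg.x Reg.i)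
      (fun p L => ∃ q b i, p = [q, b, i] ∧ [q, b] ∈ S ∧ L.reg .q = q ∧ L.reg .x = X q b ∧
        L.reg .i = i)
      (fun p L => ∀ q b i, p = [q, b, i] → L.sreg .c = sym (I.str 0) i ∧
        L.sreg .d = I.re (I.str (q + 1)) (X q b) i) (10 + Xt) (10 + Xw) := by
    refine ((Triple.of_imp (.seq (.loadSym .c 0 Reg.i)
      (.reenc .d (Reg.q + 1) Reg.x Reg.i Xt Xw)) ?_).mono ?_ ?_)
    · rintro p L ⟨q, b, i, rfl, h, h₁, h₂, h₃⟩
      simp only [Loc.eval_zero, Loc.eval_one, Loc.eval_add, Loc.eval_reg, Loc.setSym_reg,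
        Loc.setSym_sreg, h₁, h₂, h₃]
      refine ⟨fun q' b' i' h' => ?_, ht h, hw h⟩
      cases h'
      simp
    · simp
      omega
    · simp
      omega
  have hload' := (hload.runs (σ := τ) rfl (S := S') (fun p hp => by
    obtain ⟨q, b, i, rfl, h, -⟩ := hmem' hp
    have := hregτ h hp
    exact ⟨q, b, i, rfl, h, this.2.1, this.2.2.2.2.1, this.2.2.2.2.2.2⟩)).frame hlen
    (Q₁ := fun τ' => τ'.mem = σ.mem ∧ (∀ p ∈ S', τ'.reg p = τ.reg p) ∧
      ∀ q b i, [q, b, i] ∈ S' → τ'.sreg [q, b, i] .c = sym (I.str 0) i ∧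
        τ'.sreg [q, b, i] .d = I.re (I.str (q + 1)) (X q b) i)
    (fun τ' h₁ h₂ h₃ => ⟨funext fun A => h₂ A (by simp [Cmd.writes]),
      fun p hp => funext fun r => h₃ p (hlen p hp).le r (by simp [Cmd.sets]),
      fun q b i h => h₁ _ h q b i rfl⟩)
  refine (Runs.par hS' (Runs.seq_assoc (hload'.seq fun τ' hτ' =>
    ((Runs.of_straight (by rfl) S' τ').imp ?_)))).mono ?_ ?_
  · rintro _ rfl q b hqb
    obtain ⟨h₁, h₂, h₃⟩ := hτ'
    have hb := pair_mem_positions.1 (hS hqb)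
    simp only [Cmd.run]
    set U := τ'.unsel S' (.symEq .c .d) with hU
    have hmemU : ∀ {q b i}, [q, b, i] ∈ U ↔ [q, b, i] ∈ S' ∧
        sym (I.str 0) i ≠ I.re (I.str (q + 1)) (X q b) i := by
      intro q b i
      rw [hU, State.unsel, Finset.mem_filter]
      refine and_congr_right fun h => ?_
      simp [h₃ q b i h]
    have haddr : ∀ {q b i}, [q, b] ∈ S → [q, b, i] ∈ S' →
        τ'.eval [q, b, i] (Reg.base + Reg.b) = q * m + b ∧
        τ'.eval [q, b, i] (Reg.i - Reg.rx) = i - r q b := by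
      intro q b i h h'
      simp [h₂ _ h', hregτ h h']
    have hcell : ∀ {p}, p ∈ U → τ'.eval p (Reg.base + Reg.b) = q * m + b →
        ∃ i, p = [q, b, i] := by
      intro p hp hpa
      obtain ⟨q', b', i, rfl, h, -⟩ := hmem' (Finset.mem_filter.1 hp).1
      have hb' := pair_mem_positions.1 (hS h)
      rw [(haddr h (hmemU.1 hp).1).1] at hpa
      obtain ⟨rfl, rfl⟩ := addr_inj hb'.2.1 hb'.2.2 hb.2.1 hb.2.2 hpa
      exact ⟨i, rfl⟩
    by_cases h : ∃ i, [q, b, i] ∈ U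
    · classical
      have hmin : ∀ i, [q, b, i] ∈ U → Nat.find h ≤ i := fun i hi => Nat.find_min' h hi
      have hi := Nat.find_spec h
      set i := Nat.find h
      have hi' := (hmemU.1 hi).1
      have hlt : r q b < i ∧ i ≤ m := by
        obtain ⟨q', b', i', h, -, k₁, k₂⟩ := hmem' hi'
        cases h
        exact ⟨k₁, k₂⟩
      have hval := τ'.write_mem_of_le (A := .Wit) (S := U)
        (a := fun p => τ'.eval p (Reg.base + Reg.b)) (fun p => τ'.eval p (Reg.i - Reg.rx)) hi
        (fun p' hp' hpa => by
          simp only [(haddr hqb hi').1] at hpa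
          obtain ⟨i', rfl⟩ := hcell hp' hpa
          refine Or.inr ?_
          rcases (hmin i' hp').eq_or_lt with h' | h'
          · rw [h']
          · exact le_of_lt (List.Lex.cons (List.Lex.cons (List.Lex.rel h'))))
      simp only [haddr hqb hi'] at hval
      rw [hval]
      have hri : r q b + (i - r q b) = i := by omega
      refine ⟨fun {j} k₁ k₂ k₃ => ?_, fun _ => by omega, fun _ => ?_⟩
      · by_contra hne
        have := hmin j (hmemU.2 ⟨hmem hqb k₁ k₂, hne⟩)
        have := k₃ (by omega)
        omega
      · rw [hri]
        exact (hmemU.1 hi).2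
    · push Not at h
      rw [State.write_mem_of_forall_ne _ _ fun p hp hpa => by
        obtain ⟨i, rfl⟩ := hcell hp hpa
        exact h i hp, h₁, hWit hqb]
      refine ⟨fun {j} k₁ k₂ _ => ?_, fun h => absurd rfl h, fun h => absurd rfl h⟩
      by_contra hne
      exact h j (hmemU.2 ⟨hmem hqb k₁ k₂, hne⟩)
  · simp [Cmd.cost]
    omega
  · simp [Cmd.cost]
    nlinarith

theorem probe_store {m Q bs : ℕ} {σ : State β} {S : Finset Proc} (hS : S ⊆ positions Q m)
    {X r : ℕ → ℕ → ℕ}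
    (hX : ∀ {q b}, [q, b] ∈ S → 1 ≤ X q b ∧ X q b ≤ m ∧ (X q b - 1) / bs + 1 = b)
    (hreg : ∀ {q b}, [q, b] ∈ S → σ.reg [q, b] .base = q * m ∧ σ.reg [q, b] .m = m ∧
        σ.reg [q, b] .b = b ∧ σ.reg [q, b] .x = X q b ∧ σ.reg [q, b] .rx = r q b) :
    Runs I ((.w ≔ .ld .Wit (Reg.base + Reg.b)) ;;
         .ite (Reg.w =ₑ 0)
           (.store .R (Reg.base + Reg.x) Reg.m)
           (.store .R (Reg.base + Reg.x) (Reg.rx + Reg.w - 1))) S σ 23 (S.card * 23)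
      (fun σ' => (∀ {q b}, [q, b] ∈ S → σ'.mem .R (q * m + X q b) =
          if σ.mem .Wit (q * m + b) = 0 then m else r q b + σ.mem .Wit (q * m + b) - 1) ∧
        ∀ {q x}, 1 ≤ x → x ≤ m → X q ((x - 1) / bs + 1) ≠ x →
          σ'.mem .R (q * m + x) = σ.mem .R (q * m + x)) := by
  refine ((Runs.of_straight (by rfl) S σ).imp ?_).mono (by simp [Cmd.cost]) (by simp [Cmd.cost])
  rintro _ rfl
  simp only [Cmd.run]
  set τ := σ.setReg S .w (fun p => σ.eval p (.ld .Wit (Reg.base + Reg.b))) with hτ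
  have hregτ : ∀ {q b}, [q, b] ∈ S → τ.reg [q, b] .base = q * m ∧ τ.reg [q, b] .m = m ∧
      τ.reg [q, b] .x = X q b ∧ τ.reg [q, b] .rx = r q b ∧
      τ.reg [q, b] .w = σ.mem .Wit (q * m + b) := by
    intro q b h
    simp [hτ, State.setReg, h, hreg h]
  have haddr : ∀ {q b}, [q, b] ∈ S → τ.eval [q, b] (Reg.base + Reg.x) = q * m + X q b := by
    intro q b h
    simp [hregτ h]
  -- A picked candidate determines its block, so different processors write different cells of `R`.
  have hcell : ∀ {p q x}, 1 ≤ x → x ≤ m → p ∈ S → τ.eval p (Reg.base + Reg.x) = q * m + x →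
      p = [q, (x - 1) / bs + 1] ∧ X q ((x - 1) / bs + 1) = x := by
    intro p q x hx hxm hp hpa
    obtain ⟨q', b', -, -, -, rfl⟩ := mem_positions.1 (hS hp)
    rw [haddr hp] at hpa
    obtain ⟨k₁, k₂, k₃⟩ := hX hp
    obtain ⟨rfl, rfl⟩ := addr_inj k₁ k₂ hx hxm hpa
    rw [k₃]
    exact ⟨rfl, rfl⟩
  have hUs : τ.sel S (Reg.w =ₑ 0) ⊆ S := Finset.filter_subset _ _
  have hVs : τ.unsel S (Reg.w =ₑ 0) ⊆ S := Finset.filter_subset _ _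
  have hUV : ∀ p ∈ τ.sel S (Reg.w =ₑ 0), p ∉ τ.unsel S (Reg.w =ₑ 0) := fun p hp hp' =>
    (Finset.mem_filter.1 hp).2 (Finset.mem_filter.1 hp').2
  refine ⟨fun {q b} hb => ?_, fun {q x} hx hxm hne => ?_⟩
  · have hXb := hX hb
    have huniq : ∀ p' ∈ S, τ.eval p' (Reg.base + Reg.x) =
        τ.eval [q, b] (Reg.base + Reg.x) → p' = [q, b] := by
      intro p' hp' hpa
      rw [haddr hb] at hpa
      rw [(hcell hXb.1 hXb.2.1 hp' hpa).1, hXb.2.2]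
    split_ifs with h0
    · have hbU : [q, b] ∈ τ.sel S (Reg.w =ₑ 0) :=
        Finset.mem_filter.2 ⟨hb, by simp [hregτ hb, h0]⟩
      rw [State.write_mem_of_forall_ne]
      · have := τ.write_mem_of_inj (A := .R) (a := fun p => τ.eval p (Reg.base + Reg.x))
          (fun p => τ.eval p Reg.m) hbU (fun p' hp' => huniq p' (hUs hp'))
        simp only [haddr hb] at this
        exact this.trans (hregτ hb).2.1
      · intro p hp hpa
        have hp' := huniq p (hVs hp) (hpa.trans (haddr hb).symm)
        exact hUV _ hbU (hp' ▸ hp)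
    · have hbV : [q, b] ∈ τ.unsel S (Reg.w =ₑ 0) :=
        Finset.mem_filter.2 ⟨hb, by simp [hregτ hb, h0]⟩
      have := (τ.write (τ.sel S (Reg.w =ₑ 0)) .R (fun p => τ.eval p (Reg.base + Reg.x))
        (fun p => τ.eval p Reg.m)).write_mem_of_inj (A := .R)
          (a := fun p => τ.eval p (Reg.base + Reg.x))
          (fun p => τ.eval p (Reg.rx + Reg.w - 1)) hbV (fun p' hp' => huniq p' (hVs hp'))
      simp only [haddr hb] at this
      refine this.trans ?_
      simp [hregτ hb]
  · have hne' : ∀ p ∈ S, τ.eval p (Reg.base + Reg.x) ≠ q * m + x :=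
      fun p hp hpa => hne (hcell hx hxm hp hpa).2
    exact (State.write_mem_of_forall_ne _ _ fun p hp => hne' p (hVs hp)).trans
      (State.write_mem_of_forall_ne _ _ fun p hp => hne' p (hUs hp))

theorem IsProbe.of_isMismatch {PS : ℕ → Option β} {TS : ℕ → ℕ → Option β} {m bs : ℕ}
    {Cd R R' : ℕ → ℕ}
    (hR : ∀ {b}, 1 ≤ b → b ≤ (m + bs - 1) / bs → Cd b ≠ 0 → R (Cd b) ≤ m)
    (h : ∀ {b}, 1 ≤ b → b ≤ (m + bs - 1) / bs → Cd b ≠ 0 →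
      ∃ w, IsMismatch PS (TS (Cd b)) m (R (Cd b)) w ∧
        R' (Cd b) = if w = 0 then m else R (Cd b) + w - 1)
    (hother : ∀ {x}, 1 ≤ x → x ≤ m → Cd ((x - 1) / bs + 1) ≠ x → R' x = R x) :
    IsProbe PS TS m bs Cd R R' := by
  constructor
  · intro b hb hbB h0
    obtain ⟨w, hw, h⟩ := h hb hbB h0
    rw [h]
    split_ifs with hw0
    · exact le_rfl
    · have := hw.le hw0
      omega
  · intro b hb hbB h0
    obtain ⟨w, hw, h⟩ := h hb hbB h0
    rw [h]
    split_ifs with hw0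
    · exact hR hb hbB h0
    · omega
  · intro b hb hbB h0 i hi hi'
    obtain ⟨w, hw, h⟩ := h hb hbB h0
    rw [h] at hi'
    refine hw.agree hi ?_ ?_
    · split_ifs at hi' with hw0
      · exact hi'
      · have := hw.le hw0
        omega
    · intro hw0
      rw [if_neg hw0] at hi'
      omega
  · intro b hb hbB h0 hlt
    obtain ⟨w, hw, h⟩ := h hb hbB h0
    rw [h] at hlt ⊢
    split_ifs at hlt ⊢ with hw0
    · omega
    · rw [show R (Cd b) + w - 1 + 1 = R (Cd b) + w by omega]
      exact hw.ne hw0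
  · exact hother

/-- The cost is dominated by the comparing processors, one for each position after `R x` of a picked
candidate `x`; `hwork` bounds their number by `2m` per piece. -/
theorem sweep_probe {m n Q bs Xt Xw : ℕ} {σ : State β} (hσ : IsSweepState m n Q bs σ)
    (hbs : 0 < bs)
    (hpick : ∀ q ≤ Q, IsPick m bs (fun x => σ.mem .C (q * m + x))
      (fun b => σ.mem .Cand (q * m + b)))
    (hR : ∀ q ≤ Q, ∀ {x}, 1 ≤ x → x ≤ m → σ.mem .C (q * m + x) = 1 → σ.mem .R (q * m + x) ≤ m)
    (hwork : ∀ q ≤ Q, ∑ b ∈ Finset.Icc 1 ((m + bs - 1) / bs), (if σ.mem .Cand (q * m + b) = 0 then 0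
      else m - σ.mem .R (q * m + σ.mem .Cand (q * m + b))) ≤ 2 * m)
    (ht : ∀ q ≤ Q, ∀ {x}, 1 ≤ x → x ≤ m → σ.mem .C (q * m + x) = 1 →
      I.ξt (I.str (q + 1)).length ≤ Xt)
    (hw : ∀ q ≤ Q, ∀ {x}, 1 ≤ x → x ≤ m → σ.mem .C (q * m + x) = 1 →
      I.ξw (I.str (q + 1)).length ≤ Xw) :
    Runs I (.par .b 1 ((Reg.m + Reg.bs - 1) / Reg.bs) (
      (.x ≔ .ld .Cand (Reg.base + Reg.b)) ;;
      .ite Reg.x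
        ((.rx ≔ .ld .R (Reg.base + Reg.x)) ;;
         .store .Wit (Reg.base + Reg.b) 0 ;;
         .par .i (Reg.rx + 1) Reg.m (
           .loadSym .c 0 Reg.i ;;
           .reenc .d (Reg.q + 1) Reg.x Reg.i ;;
           .ite (.symEq .c .d) .skip (.store .Wit (Reg.base + Reg.b) (Reg.i - Reg.rx))) ;;
         (.w ≔ .ld .Wit (Reg.base + Reg.b)) ;;
         .ite (Reg.w =ₑ 0)
           (.store .R (Reg.base + Reg.x) Reg.m)
           (.store .R (Reg.base + Reg.x) (Reg.rx + Reg.w - 1)))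
        .skip)) (pieces Q) σ (120 + Xt) ((Q + 1) * m * (200 * (Xw + 1)) + (Q + 1) * 20)
      (fun σ' => ∀ q ≤ Q, IsProbe (sym (I.str 0)) (I.re (I.str (q + 1))) m bs
        (fun b => σ.mem .Cand (q * m + b)) (fun x => σ.mem .R (q * m + x))
        (fun x => σ'.mem .R (q * m + x))) := by
  set S := positions Q ((m + bs - 1) / bs) with hS
  have hSm : S ⊆ positions Q m := positions_mono (blocks_le hbs)
  let X : ℕ → ℕ → ℕ := fun q b => σ.mem .Cand (q * m + b)
  let r : ℕ → ℕ → ℕ := fun q b => σ.mem .R (q * m + X q b)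
  set τ := σ.fork S .b with hτ
  set τ₁ := τ.setReg S .x (fun p => τ.eval p (.ld .Cand (Reg.base + Reg.b))) with hτ₁
  have hm₁ : τ₁.mem = σ.mem := rfl
  have hreg₁ : ∀ {q b}, [q, b] ∈ S → τ₁.reg [q, b] .base = q * m ∧ τ₁.reg [q, b] .q = q ∧
      τ₁.reg [q, b] .m = m ∧ τ₁.reg [q, b] .b = b ∧ τ₁.reg [q, b] .x = X q b := by
    intro q b h
    have hq := (pair_mem_positions.1 h).1
    have hm : τ.mem = σ.mem := rfl
    have hr := fun r => σ.fork_reg_pair .b h r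
    simp [hτ₁, State.setReg, h, hτ, hr, hσ.base q hq, hσ.m q hq, hσ.q q hq, X]
  set S₁ := τ₁.sel S Reg.x with hS₁
  have hsub : S₁ ⊆ S := Finset.filter_subset _ _
  have hmem₁ : ∀ {q b}, [q, b] ∈ S₁ ↔ [q, b] ∈ S ∧ X q b ≠ 0 := by
    intro q b
    rw [hS₁, State.sel, Finset.mem_filter]
    refine and_congr_right fun h => ?_
    simp [hreg₁ h]
  have hlen₁ : ∀ p ∈ S₁, p.length = 2 := by
    intro p hp
    obtain ⟨q, b, -, -, -, rfl⟩ := mem_positions.1 (hsub hp)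
    rfl
  have hX : ∀ {q b}, [q, b] ∈ S₁ → q ≤ Q ∧ 1 ≤ X q b ∧ X q b ≤ m ∧
      (X q b - 1) / bs + 1 = b ∧ σ.mem .C (q * m + X q b) = 1 := by
    intro q b h
    obtain ⟨h₁, h₂⟩ := hmem₁.1 h
    obtain ⟨hq, hb, hbB⟩ := pair_mem_positions.1 h₁
    have hp := hpick q hq
    exact ⟨hq, (hp.pos hb hbB h₂).1, (hp.pos hb hbB h₂).2, hp.block hb hbB h₂, hp.cand hb hbB h₂⟩
  set τ₂ := ((.rx ≔ .ld .R (Reg.base + Reg.x)) ;; .store .Wit (Reg.base + Reg.b) 0).run I S₁ τ₁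
    with hτ₂
  have hreg₂ : ∀ {q b}, [q, b] ∈ S₁ → τ₂.reg [q, b] .base = q * m ∧ τ₂.reg [q, b] .q = q ∧
      τ₂.reg [q, b] .m = m ∧ τ₂.reg [q, b] .b = b ∧ τ₂.reg [q, b] .x = X q b ∧
      τ₂.reg [q, b] .rx = r q b := by
    intro q b h
    simp [hτ₂, Cmd.run, State.write, State.setReg, h, hreg₁ (hsub h), hm₁, r]
  have hmem₂ : ∀ A, A ≠ .Wit → τ₂.mem A = σ.mem A := by
    intro A hA
    simp only [hτ₂, Cmd.run]
    rw [State.write_mem_ne _ _ hA]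
    rfl
  have hWit : ∀ {q b}, [q, b] ∈ S₁ → τ₂.mem .Wit (q * m + b) = 0 := by
    intro q b h
    simp only [hτ₂, Cmd.run]
    exact State.write_pair _ (d := 0) (Nat.zero_le 1) (hsub.trans hSm)
      (fun q b h => by simp [State.setReg, h, hreg₁ (hsub h)]) h
  have hcmp := (probe_compare (I := I) (hsub.trans hSm) (r := r) hreg₂ hWit
    (fun h => ht _ (hX h).1 (hX h).2.1 (hX h).2.2.1 (hX h).2.2.2.2)
    (fun h => hw _ (hX h).1 (hX h).2.1 (hX h).2.2.1 (hX h).2.2.2.2)).frame hlen₁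
    (Q₁ := fun σ' => (∀ A, A ≠ .Wit → σ'.mem A = σ.mem A) ∧
      (∀ {q b}, [q, b] ∈ S₁ → σ'.reg [q, b] .base = q * m ∧ σ'.reg [q, b] .m = m ∧
        σ'.reg [q, b] .b = b ∧ σ'.reg [q, b] .x = X q b ∧ σ'.reg [q, b] .rx = r q b) ∧
      ∀ {q b}, [q, b] ∈ S₁ → IsMismatch (sym (I.str 0)) (I.re (I.str (q + 1)) (X q b)) m
        (r q b) (σ'.mem .Wit (q * m + b)))
    (fun σ' h₁ h₂ h₃ => ⟨fun A hA => (h₂ A (by simpa [Cmd.writes] using hA)).trans (hmem₂ A hA),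
      fun {q b} h => by
        have hr := fun r => h₃ [q, b] le_rfl r (by simp [Cmd.sets])
        simp [hr, hreg₂ h], h₁⟩)
  let P : State β → Prop := fun σ' => ∀ q ≤ Q,
    (∀ b, [q, b] ∈ S₁ → ∃ w, IsMismatch (sym (I.str 0)) (I.re (I.str (q + 1)) (X q b)) m (r q b) w ∧
      σ'.mem .R (q * m + X q b) = if w = 0 then m else r q b + w - 1) ∧
    ∀ x, 1 ≤ x → x ≤ m → X q ((x - 1) / bs + 1) ≠ x → σ'.mem .R (q * m + x) = σ.mem .R (q * m + x)
  have hcard₁ : S₁.card ≤ (Q + 1) * m := (Finset.card_le_card (hsub.trans hSm)).trans_eq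
    (card_positions Q m)
  have hcardS : S.card ≤ (Q + 1) * m := (Finset.card_le_card hSm).trans_eq (card_positions Q m)
  have hcard : (children S₁ (fun p => τ₂.eval p (Reg.rx + 1))
      (fun p => τ₂.eval p Reg.m)).card ≤ (Q + 1) * m * 2 := by
    rw [card_children]
    have hpos : ∀ p, p ∈ pieces Q → ∑ b ∈ Finset.Icc 1 ((m + bs - 1) / bs),
        (if p ++ [b] ∈ S₁ then τ₂.eval (p ++ [b]) Reg.m + 1 - τ₂.eval (p ++ [b]) (Reg.rx + 1)
          else 0) ≤ 2 * m := by
      intro p hp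
      obtain ⟨q, hq, rfl⟩ := mem_pieces.1 hp
      refine (Finset.sum_le_sum fun b hb => ?_).trans (hwork q hq)
      rw [Finset.mem_Icc] at hb
      change (if [q, b] ∈ S₁ then τ₂.eval [q, b] Reg.m + 1 - τ₂.eval [q, b] (Reg.rx + 1)
        else 0) ≤ if X q b = 0 then 0 else m - r q b
      split_ifs with h₁ h₂ h₂
      · exact absurd h₂ (hmem₁.1 h₁).2
      · simp [hreg₂ h₁]
      · exact le_rfl
      · exact Nat.zero_le _
    -- Blocks without a pick contribute 0, so the sum may run over all blocks and be split by
    -- pieces.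
    calc _ = ∑ p ∈ S, if p ∈ S₁ then τ₂.eval p Reg.m + 1 - τ₂.eval p (Reg.rx + 1) else 0 := by
          rw [← Finset.sum_filter, Finset.filter_mem_eq_inter, Finset.inter_eq_right.2 hsub]
      _ ≤ ∑ p ∈ pieces Q, 2 * m := by
          rw [hS, positions, sum_children]
          exact Finset.sum_le_sum hpos
      _ = _ := by
          rw [Finset.sum_const, card_pieces, smul_eq_mul]
          ring
  have hend : ∀ σ₃ : State β, ((∀ A, A ≠ .Wit → σ₃.mem A = σ.mem A) ∧
      (∀ {q b}, [q, b] ∈ S₁ → σ₃.reg [q, b] .base = q * m ∧ σ₃.reg [q, b] .m = m ∧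
        σ₃.reg [q, b] .b = b ∧ σ₃.reg [q, b] .x = X q b ∧ σ₃.reg [q, b] .rx = r q b) ∧
      ∀ {q b}, [q, b] ∈ S₁ → IsMismatch (sym (I.str 0)) (I.re (I.str (q + 1)) (X q b)) m
        (r q b) (σ₃.mem .Wit (q * m + b))) → Runs I _ S₁ σ₃ 23 (S₁.card * 23) P :=
    fun σ₃ h => (probe_store (bs := bs) (hsub.trans hSm)
      (fun hb => ⟨(hX hb).2.1, (hX hb).2.2.1, (hX hb).2.2.2.1⟩) h.2.1).imp fun σ' h' q hq =>
      ⟨fun b hb => ⟨_, h.2.2 hb, h'.1 hb⟩,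
        fun x hx hxm hne => (h'.2 hx hxm hne).trans (congrFun (h.1 _ (by decide)) _)⟩
  have hinner := Runs.seq_assoc (((Runs.of_straight (I := I)
    (c := (.rx ≔ .ld .R (Reg.base + Reg.x)) ;; .store .Wit (Reg.base + Reg.b) 0)
    (by rfl) S₁ τ₁)).seq fun σ' h => by
    subst h
    exact hcmp.seq hend)
  have hbody := Runs.par hσ.blocks ((Runs.of_straight (I := I)
    (c := .x ≔ .ld .Cand (Reg.base + Reg.b)) (by rfl) S τ).seq (fun σ' h => by
      subst h
      exact Runs.ite hinner (c₂ := .skip) (Q := P) fun σ' h =>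
        (Runs.of_straight (by rfl) _ _).imp fun σ'' h' => by
          subst h'
          exact h))
  refine (hbody.imp ?_).mono ?_ ?_
  · intro σ' h q hq
    have hin : ∀ {b}, 1 ≤ b → b ≤ (m + bs - 1) / bs → σ.mem .Cand (q * m + b) ≠ 0 →
        [q, b] ∈ S₁ := fun hb hbB h0 => hmem₁.2 ⟨pair_mem_positions.2 ⟨hq, hb, hbB⟩, h0⟩
    refine IsProbe.of_isMismatch (fun hb hbB h0 => ?_) (fun {b} hb hbB h0 => ?_) ?_
    · have := hX (hin hb hbB h0)
      exact hR q hq this.2.1 this.2.2.1 this.2.2.2.2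
    · exact (h q hq).1 b (hin hb hbB h0)
    · exact (h q hq).2 _
  · simp [Cmd.cost]
    omega
  · have hV : ((Cmd.run I (.x ≔ .ld .Cand (Reg.base + Reg.b)) S τ).unsel S Reg.x).card ≤
        (Q + 1) * m := (Finset.card_filter_le _ _).trans hcardS
    generalize (Finset.card (children S₁ _ _)) = N at *
    generalize (Finset.card (State.unsel _ S _)) = N₂ at *
    have h₁ := Nat.mul_le_mul_right (30 + Xw) hcard
    simp [Cmd.cost, card_pieces]
    nlinarith

end Machine

section Machine

variable {β : Type*} {I : Input β}

/-- The invariant of the sweeping stage for all pieces. -/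
def SweepInvs (I : Input β) (W : ℕ → ℕ) (occ : ℕ → ℕ → Prop) (m n Q bs : ℕ) (M : Arr → ℕ → ℕ) :
    Prop :=
  ∀ q ≤ Q, SweepInv W (sym (I.str 0)) (I.re (I.str (q + 1)))
    (fun x => 1 ≤ x ∧ x ≤ m ∧ q * m + x + m ≤ n + 1) (occ q) m bs (fun x => M .C (q * m + x))
    (fun x => M .R (q * m + x))

/-- One round of the sweeping stage. -/
def sweepRound : Cmd :=
  .par .b 1 ((Reg.m + Reg.bs - 1) / Reg.bs) (.store .Cand (Reg.base + Reg.b) 0) ;;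
  .par .x 1 Reg.m (
    .ite ((.ld .C (Reg.base + Reg.x) =ₑ 1) ∧ₑ (Reg.bs / 2 ≤ₑ (Reg.x - 1) % Reg.bs))
      (.store .Cand (Reg.base + ((Reg.x - 1) / Reg.bs + 1)) Reg.x)
      .skip) ;;
  .par .b 1 ((Reg.m + Reg.bs - 1) / Reg.bs) (
    (.x ≔ .ld .Cand (Reg.base + Reg.b)) ;;
    .ite Reg.x
      ((.rx ≔ .ld .R (Reg.base + Reg.x)) ;;
       .store .Wit (Reg.base + Reg.b) 0 ;;
       .par .i (Reg.rx + 1) Reg.m (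
         .loadSym .c 0 Reg.i ;;
         .reenc .d (Reg.q + 1) Reg.x Reg.i ;;
         .ite (.symEq .c .d) .skip (.store .Wit (Reg.base + Reg.b) (Reg.i - Reg.rx))) ;;
       (.w ≔ .ld .Wit (Reg.base + Reg.b)) ;;
       .ite (Reg.w =ₑ 0)
         (.store .R (Reg.base + Reg.x) Reg.m)
         (.store .R (Reg.base + Reg.x) (Reg.rx + Reg.w - 1)))
      .skip) ;;
  .par .i 1 Reg.m (
    (.x ≔ .ld .Cand (Reg.base + ((Reg.i - 1) / Reg.bs + 1))) ;;
    .ite Reg.x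
      ((.rx ≔ .ld .R (Reg.base + Reg.x)) ;;
       .ite ((Reg.i ≤ₑ Reg.x) ∧ₑ (Reg.rx + (Reg.x - Reg.i) + 1 ≤ₑ Reg.m))
         (.store .C (Reg.base + Reg.i) 0)
         .skip ;;
       .ite ((Reg.x ≤ₑ Reg.i) ∧ₑ (.ld .C (Reg.base + Reg.i) =ₑ 1))
         (.store .R (Reg.base + Reg.i) (Reg.rx - (Reg.i - Reg.x)))
         .skip)
      .skip) ;;
  (.bs ≔ Reg.bs / 2)

theorem sweep_round {m n Q bs Xt Xw : ℕ} {occ : ℕ → ℕ → Prop} {σ : State β}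
    (hσ : IsSweepState m n Q bs σ) (hm : 0 < m) (hbs : bs = 1 ∨ ∃ c, 0 < c ∧ bs = 2 * c)
    (hspec : ∀ q ≤ Q, PieceSpec m (σ.mem .W) (sym (I.str 0)) (I.re (I.str (q + 1)))
      (fun x => 1 ≤ x ∧ x ≤ m ∧ q * m + x + m ≤ n + 1) (occ q))
    (ht : ∀ q ≤ Q, q * m + m ≤ n → I.ξt (I.str (q + 1)).length ≤ Xt)
    (hw : ∀ q ≤ Q, q * m + m ≤ n → I.ξw (I.str (q + 1)).length ≤ Xw)
    (hinv : SweepInvs I (σ.mem .W) occ m n Q bs σ.mem) :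
    Runs I sweepRound (pieces Q) σ (300 * (Xt + 1)) ((Q + 1) * m * (400 * (Xw + 1)))
      (fun σ' => IsSweepState m n Q (bs / 2) σ' ∧ σ'.mem .W = σ.mem .W ∧
        SweepInvs I (σ.mem .W) occ m n Q (bs / 2) σ'.mem) := by
  have hpos : 0 < bs := by omega
  have hreg : ∀ {r lo hi c} {σ₁ σ₂ : State β}, IsSweepState m n Q bs σ₁ →
      (∀ p : Proc, p.length ≤ 1 → ∀ r', r' ∉ (Cmd.par r lo hi c).sets →
        σ₂.reg p r' = σ₁.reg p r') → IsSweepState m n Q bs σ₂ :=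
    fun h₁ h₂ => h₁.congr fun q r => h₂ [q] le_rfl r (by simp [Cmd.sets])
  have hcand : ∀ q ≤ Q, ∀ {x}, 1 ≤ x → x ≤ m → σ.mem .C (q * m + x) = 1 → q * m + m ≤ n := by
    intro q hq x h₁ h₂ h₃
    have := ((hinv q hq).sieve.isCand h₁ h₂ h₃).2.2
    omega
  refine (((sweep_clear (I := I) hσ hpos).frame length_of_mem_pieces
    (Q₁ := fun τ => IsSweepState m n Q bs τ ∧ τ.mem .W = σ.mem .W ∧ τ.mem .C = σ.mem .C ∧
      τ.mem .R = σ.mem .R ∧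
      ∀ q ≤ Q, ∀ b, 1 ≤ b → b ≤ (m + bs - 1) / bs → τ.mem .Cand (q * m + b) = 0)
    fun τ h₁ h₂ h₃ => ⟨hreg hσ h₃, h₂ _ (by decide), h₂ _ (by decide), h₂ _ (by decide), h₁⟩).seq
    fun τ ⟨hτ, hW, hC, hR, hCd⟩ => ((sweep_pick (I := I) hτ hpos hCd).frame length_of_mem_pieces
      (Q₁ := fun τ => IsSweepState m n Q bs τ ∧ τ.mem .W = σ.mem .W ∧ τ.mem .C = σ.mem .C ∧
        τ.mem .R = σ.mem .R ∧ ∀ q ≤ Q, IsPick m bs (fun x => σ.mem .C (q * m + x))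
          (fun b => τ.mem .Cand (q * m + b)))
      fun τ' h₁ h₂ h₃ => ⟨hreg hτ h₃, (h₂ _ (by decide)).trans hW, (h₂ _ (by decide)).trans hC,
        (h₂ _ (by decide)).trans hR, by rw [hC] at h₁; exact h₁⟩).seq
    fun τ ⟨hτ, hW, hC, hR, hp⟩ => ((sweep_probe (I := I) (Xt := Xt) (Xw := Xw) hτ hpos
      (by rw [hC]; exact hp)
      (fun q hq x h₁ h₂ h₃ => by
        rw [hR]
        rw [hC] at h₃
        exact (hinv q hq).le h₁ h₂ h₃)
      (fun q hq => by
        rw [hR]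
        -- A pick is at most `m`, so every interval to be compared ends by `2m`.
        refine (hinv q hq).work (hp q hq) le_rfl fun b h₁ h₂ h₃ => ?_
        have := ((hp q hq).pos h₁ h₂ h₃).2
        omega)
      (fun q hq x h₁ h₂ h₃ => ht q hq (hcand q hq h₁ h₂ (hC ▸ h₃)))
      (fun q hq x h₁ h₂ h₃ => hw q hq (hcand q hq h₁ h₂ (hC ▸ h₃)))).frame length_of_mem_pieces
      (Q₁ := fun τ => IsSweepState m n Q bs τ ∧ τ.mem .W = σ.mem .W ∧ τ.mem .C = σ.mem .C ∧
        ∀ q ≤ Q, IsPick m bs (fun x => σ.mem .C (q * m + x))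
          (fun b => τ.mem .Cand (q * m + b)) ∧
          IsProbe (sym (I.str 0)) (I.re (I.str (q + 1))) m bs (fun b => τ.mem .Cand (q * m + b))
            (fun x => σ.mem .R (q * m + x)) (fun x => τ.mem .R (q * m + x)))
      fun τ' h₁ h₂ h₃ => ⟨hreg hτ h₃, (h₂ _ (by decide)).trans hW, (h₂ _ (by decide)).trans hC,
        fun q hq => by
          rw [h₂ .Cand (by decide), ← hR]
          exact ⟨hp q hq, h₁ q hq⟩⟩).seq
    fun τ ⟨hτ, hW, hC, hp⟩ => ((sweep_blocks (I := I) hτ).frame length_of_mem_pieces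
      (Q₁ := fun τ => IsSweepState m n Q bs τ ∧ τ.mem .W = σ.mem .W ∧
        SweepInvs I (σ.mem .W) occ m n Q (bs / 2) τ.mem)
      fun τ' h₁ h₂ h₃ => ⟨hreg hτ h₃, (h₂ _ (by decide)).trans hW, fun q hq =>
        (hinv q hq).step (hspec q hq) hbs (hp q hq).1 (hp q hq).2
          (by rw [hC] at h₁; exact h₁ q hq)⟩).seq
    fun τ ⟨hτ, hW, hS⟩ => ((Runs.of_straight (I := I) (c := .bs ≔ Reg.bs / 2) (by rfl) _
      _).frame length_of_mem_pieces fun τ' h₁ h₂ h₃ => ?_)).mono ?_ ?_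
  · subst h₁
    refine ⟨⟨hτ.toIsPieceState.congr fun q r hr => h₃ [q] le_rfl r ?_, fun q hq => ?_⟩, hW, hS⟩
    · intro h
      simp only [Cmd.sets, List.mem_singleton] at h
      subst h
      simp at hr
    · simp [Cmd.run, State.setReg, mem_pieces.2 ⟨q, hq, rfl⟩, hτ.bs q hq]
  · simp [Cmd.cost]
    omega
  · have := Nat.mul_le_mul_left (Q + 1) hm
    simp [Cmd.cost, card_pieces]
    nlinarith

theorem sweepingStage_runs {m n Q Xt Xw : ℕ} {occ : ℕ → ℕ → Prop} {σ : State β}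
    (hσ : IsPieceState m n Q σ) (hm : 2 ≤ m) (hh : ∀ q ≤ Q, σ.reg [q] .h = 2 ^ Nat.clog 2 m)
    (hspec : ∀ q ≤ Q, PieceSpec m (σ.mem .W) (sym (I.str 0)) (I.re (I.str (q + 1)))
      (fun x => 1 ≤ x ∧ x ≤ m ∧ q * m + x + m ≤ n + 1) (occ q))
    (ht : ∀ q ≤ Q, q * m + m ≤ n → I.ξt (I.str (q + 1)).length ≤ Xt)
    (hw : ∀ q ≤ Q, q * m + m ≤ n → I.ξw (I.str (q + 1)).length ≤ Xw)
    (hsieve : ∀ q ≤ Q, IsSieve (σ.mem .W) (fun x => 1 ≤ x ∧ x ≤ m ∧ q * m + x + m ≤ n + 1) (occ q) m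
      (fun x => σ.mem .C (q * m + x))) :
    Runs I sweepingStage (pieces Q) σ ((Nat.clog 2 m + 1) * (700 * (Xt + 1)))
      ((Q + 1) * m * ((Nat.clog 2 m + 1) * (700 * (Xw + 1))))
      (fun σ' => ∀ q ≤ Q, ∀ x, 1 ≤ x → x ≤ m →
        (σ'.mem .C (q * m + x) = 0 ∨ σ'.mem .C (q * m + x) = 1) ∧
        (σ'.mem .C (q * m + x) = 1 ↔
          (1 ≤ x ∧ x ≤ m ∧ q * m + x + m ≤ n + 1) ∧ occ q x)) := by
  set L := Nat.clog 2 m with hL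
  set W := σ.mem .W with hW
  have hmL : m ≤ 2 ^ L := Nat.le_pow_clog (by norm_num) m
  -- `L + 1` rounds take the block size from `2 ^ L` through 1 to 0, which ends the loop and
  -- activates `SweepInv.done`.
  let J : ℕ → State β → Prop := fun k τ => IsSweepState m n Q (2 ^ L / 2 ^ k) τ ∧
    τ.mem .W = W ∧ SweepInvs I W occ m n Q (2 ^ L / 2 ^ k) τ.mem
  have hinit := (store_positions (I := I) hσ .R).frame length_of_mem_pieces
    (Q₁ := fun τ => IsPieceState m n Q τ ∧ (∀ q ≤ Q, τ.reg [q] .h = 2 ^ L) ∧ τ.mem .W = W ∧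
      SweepInvs I W occ m n Q (2 ^ L) τ.mem)
    fun τ h₁ h₂ h₃ => ⟨hσ.congr fun q r _ => h₃ [q] le_rfl r (by simp [Cmd.sets]),
      fun q hq => (h₃ [q] le_rfl _ (by simp [Cmd.sets])).trans (hh q hq), h₂ _ (by decide),
      fun q hq => by
        constructor
        · rw [h₂ .C (by decide)]
          exact hsieve q hq
        · intro x hx hxm _
          simp only [h₁ q hq x hx hxm]
          exact Nat.zero_le _
        · intro x hx hxm _ i hi hi'
          simp only [h₁ q hq x hx hxm] at hi'
          omega
        -- Initially `m ≤ 2 ^ L`, so there is only one block and nothing has to be apart.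
        · intro x y hx hxy hy _ _ hne
          rw [Nat.div_eq_of_lt (by omega), Nat.div_eq_of_lt (by omega)] at hne
          exact absurd rfl hne
        · intro h
          have : 0 < 2 ^ L := by positivity
          omega⟩
  have hset : ∀ τ, (IsPieceState m n Q τ ∧ (∀ q ≤ Q, τ.reg [q] .h = 2 ^ L) ∧ τ.mem .W = W ∧
      SweepInvs I W occ m n Q (2 ^ L) τ.mem) →
      Runs I (.bs ≔ Reg.h) (pieces Q) τ 2 ((Q + 1) * 2) (J 0) := by
    rintro τ ⟨h₁, h₂, h₃, h₄⟩
    refine (((Runs.of_straight (by rfl) _ _).frame length_of_mem_pieces ?_).mono ?_ ?_)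
    · rintro τ' rfl h₆ h₅
      simp only [J, pow_zero, Nat.div_one]
      refine ⟨⟨h₁.congr fun q r hr => h₅ [q] le_rfl r ?_, fun q hq => ?_⟩, h₃, h₄⟩
      · rintro h
        simp only [Cmd.sets, List.mem_singleton] at h
        subst h
        simp at hr
      · simp [Cmd.run, State.setReg, mem_pieces.2 ⟨q, hq, rfl⟩, h₂ q hq]
    · simp [Cmd.cost]
    · simp [Cmd.cost, card_pieces]
  have hbs : ∀ k ≤ L, 2 ^ L / 2 ^ k = 2 ^ (L - k) := fun k hk => Nat.pow_div hk (by norm_num)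
  have hloop : ∀ τ, J 0 τ → Runs I (.loop (0 <ₑ Reg.bs) sweepRound) (pieces Q) τ _ _ (J (L + 1)) :=
    fun τ h₀ => by
    refine Runs.loop (T := 300 * (Xt + 1)) (N := fun _ => (Q + 1) * m * (400 * (Xw + 1)))
      ⟨[0], mem_pieces.2 ⟨0, Nat.zero_le _, rfl⟩⟩ (fun k hk τ h p hp => ?_)
      (fun τ h p hp => ?_) (fun k hk τ h => ?_) h₀
    · obtain ⟨q, hq, rfl⟩ := mem_pieces.1 hp
      have := h.1.bs q hq
      rw [hbs k (by omega)] at this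
      simp [this]
    · obtain ⟨q, hq, rfl⟩ := mem_pieces.1 hp
      have := h.1.bs q hq
      rw [Nat.div_eq_of_lt (Nat.pow_lt_pow_right (by norm_num) (Nat.lt_succ_self L))] at this
      simp [this]
    · obtain ⟨h₁, h₂, h₃⟩ := h
      have hround := sweep_round (I := I) (Xt := Xt) (Xw := Xw) h₁ (by omega) (by
        rw [hbs k (by omega)]
        rcases (show k ≤ L by omega).eq_or_lt with rfl | hlt
        · simp
        · refine Or.inr ⟨2 ^ (L - k - 1), by positivity, ?_⟩
          rw [← pow_succ']
          congr 1
          omega) (by rw [h₂]; exact hspec) ht hw (by rw [h₂]; exact h₃)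
      refine hround.imp fun τ' h => ?_
      simp only [J, pow_succ, ← Nat.div_div_eq_div_mul]
      rw [h₂] at h
      exact h
  refine ((hinit.seq fun τ h => (hset τ h).seq hloop).imp ?_).mono ?_ ?_
  · rintro τ ⟨-, -, h⟩ q hq x hx hxm
    have hq' := h q hq
    refine ⟨hq'.sieve.bool hx hxm, fun hC => ?_, fun h => hq'.sieve.complete h.1 h.2⟩
    have hc := hq'.sieve.isCand hx hxm hC
    refine ⟨hc, ((hspec q hq).occ_iff hc).2 fun i hi him => hq'.agree hx hxm hC i hi ?_⟩
    -- At block size 0 the known match of a survivor has length `m`, so the survivor is an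
    -- occurrence.
    rw [hq'.done (Nat.div_eq_of_lt (Nat.pow_lt_pow_right (by norm_num) (Nat.lt_succ_self L))) hx
      hxm hC]
    exact him
  · simp
    nlinarith
  · have h₁ : Q + 1 ≤ (Q + 1) * m := Nat.le_mul_of_pos_right _ (by omega)
    have h₂ := Nat.mul_le_mul_right (L + 1) h₁
    have h₃ : (Q + 1) * m ≤ (Q + 1) * m * (L + 1) := Nat.le_mul_of_pos_right _ (by omega)
    have h₄ : (Q + 1) * m * (L + 1) ≤ (Q + 1) * m * (L + 1) * (Xw + 1) :=
      Nat.le_mul_of_pos_right _ (by omega)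
    simp [card_pieces]
    generalize (Q + 1) * m = A at *
    linarith

end Machine

/-! ### Both stages together, and the passage to real logarithms. -/

section Machine

/-- Write the rounded logarithm as `k + 1`. Then `2 ^ k < m` and `2 ≤ m` bound both `k * log 2` and
`log 2` by `log m`, so `k + 2 ≤ 3 * log m / log 2`, and `3 / log 2 < 5`. -/
theorem clog_succ_le_log {m : ℕ} (hm : 2 ≤ m) :
    ((Nat.clog 2 m + 1 : ℕ) : ℝ) ≤ 5 * Real.log m := by
  obtain ⟨k, hk⟩ : ∃ k, Nat.clog 2 m = k + 1 :=
    ⟨Nat.clog 2 m - 1, by have := Nat.clog_pos (b := 2) (by norm_num) hm; omega⟩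
  have h₁ : 2 ^ k < m := by
    by_contra h
    have := Nat.clog_le_of_le_pow (b := 2) (not_lt.1 h)
    omega
  have h₂ : (k : ℝ) * Real.log 2 ≤ Real.log m := by
    rw [← Real.log_pow]
    exact Real.log_le_log (by positivity) (by exact_mod_cast h₁.le)
  have h₃ : Real.log 2 ≤ Real.log m := Real.log_le_log (by norm_num) (by exact_mod_cast hm)
  have h₄ := Real.log_two_gt_d9
  rw [hk]
  push_cast
  have h₅ : (k : ℝ) * 0.6931471803 ≤ k * Real.log 2 :=
    mul_le_mul_of_nonneg_left h₄.le (Nat.cast_nonneg k)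
  linarith

theorem patternSearch_runs {α β : Type*} {rel : List α → List α → Prop} {f : List α → List β}
    {P T : List α} {ξt ξw : ℕ → ℕ} {σ : State β} {Xt Xw : ℕ} (hrel : IsSCER rel)
    (hf : IsEncoding rel f) (hP : 2 ≤ P.length)
    (ht : ∀ l, P.length ≤ l → l ≤ 2 * P.length - 1 → ξt l ≤ Xt)
    (hw : ∀ l, P.length ≤ l → l ≤ 2 * P.length - 1 → ξw l ≤ Xw)
    (hW : IsWitnessTable f P (σ.mem .W)) (hn : σ.reg [] .n = T.length)
    (hm : σ.reg [] .m = P.length) :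
    Runs (searchInput f ξt ξw P T) patternSearch {[]} σ
      (1200 * (Nat.clog 2 P.length + 1) ^ 3 * (Xt + 1))
      (((T.length - 1) / P.length + 1) * P.length *
        (1600 * (Nat.clog 2 P.length + 1) ^ 2 * (Xw + 1)))
      (fun σ' => ∀ i, 1 ≤ i → i + P.length ≤ T.length + 1 →
        (σ'.mem .C i = 1 ↔ IsOccurrence rel P T i) ∧
        (σ'.mem .C i = 0 ↔ ¬ IsOccurrence rel P T i)) := by
  set m := P.length with hmdef
  set n := T.length with hndef
  set Q := (n - 1) / m with hQ
  set L := Nat.clog 2 m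
  set I := searchInput f ξt ξw P T with hI
  have hchild : pieces Q = children {[]} (fun p => σ.eval p 0)
      (fun p => σ.eval p ((Reg.n - 1) / Reg.m)) := by
    ext p
    simp [mem_pieces, mem_children, hn, hm, hQ, eq_comm]
  set τ := (Cmd.assign .base (Reg.q * Reg.m)).run I (pieces Q) (σ.fork (pieces Q) .q) with hτ
  have hreg : ∀ q ≤ Q, ∀ r, (σ.fork (pieces Q) .q).reg [q] r = if r = .q then q else σ.reg [] r :=
    fun q hq r => σ.fork_reg (p := []) .q (mem_pieces.2 ⟨q, hq, rfl⟩) r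
  have hτreg : ∀ q ≤ Q, ∀ r, r ≠ .base → τ.reg [q] r = if r = .q then q else σ.reg [] r := by
    intro q hq r hr
    rw [← hreg q hq r]
    simp [hτ, Cmd.run, State.setReg, hr]
  have hτ' : IsPieceState m n Q τ := by
    constructor
    · intro q hq
      simp [hτreg q hq]
    · intro q hq
      simp [hτ, Cmd.run, State.setReg, mem_pieces.2 ⟨q, hq, rfl⟩, hreg q hq, hm]
    · intro q hq
      simp [hτreg q hq, hm]
    · intro q hq
      simp [hτreg q hq, hn]
  have hspec : ∀ q ≤ Q, PieceSpec m (τ.mem .W) (sym (I.str 0)) (I.re (I.str (q + 1)))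
      (fun x => 1 ≤ x ∧ x ≤ m ∧ q * m + x + m ≤ n + 1)
      (fun x => IsOccurrence rel P T (q * m + x)) :=
    fun q _ => pieceSpec hrel hf (by omega) hW q
  -- A piece with a candidate has length between `m` and `2m - 1`, the range in which the costs are
  -- controlled.
  have hlen : ∀ q, q * m + m ≤ n → m ≤ (I.str (q + 1)).length ∧
      (I.str (q + 1)).length ≤ 2 * m - 1 := by
    intro q hq
    have : (I.str (q + 1)).length = min (2 * m - 1) (n - q * m) := by
      change (f (piece T m q)).length = _
      rw [← hf.length_eq]
      simp [piece_eq, hndef]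
    omega
  have ht' : ∀ q ≤ Q, q * m + m ≤ n → I.ξt (I.str (q + 1)).length ≤ Xt :=
    fun q _ h => ht _ (hlen q h).1 (hlen q h).2
  have hw' : ∀ q ≤ Q, q * m + m ≤ n → I.ξw (I.str (q + 1)).length ≤ Xw :=
    fun q _ h => hw _ (hlen q h).1 (hlen q h).2
  refine ((Runs.par hchild ((Runs.of_straight (by rfl) _ _).seq fun τ' h => by
    subst h
    exact (duelingStage_runs hτ' hP hspec ht' hw').seq fun τ₁ h₁ =>
      sweepingStage_runs h₁.1 hP h₁.2.1 (by rw [h₁.2.2.1]; exact hspec) ht' hw'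
        (by rw [h₁.2.2.1]; exact h₁.2.2.2))).imp ?_).mono ?_ ?_
  · intro σ' h i hi him
    have e := Nat.mod_add_div (i - 1) m
    have hx := Nat.mod_lt (i - 1) (show 0 < m by omega)
    have hi' : (i - 1) / m ≤ Q := Nat.div_le_div_right (by omega)
    obtain ⟨q, x, hq, hx₁, hx₂, rfl⟩ : ∃ q x, q ≤ Q ∧ 1 ≤ x ∧ x ≤ m ∧ i = q * m + x :=
      ⟨(i - 1) / m, (i - 1) % m + 1, hi', by omega, by omega, by rw [mul_comm]; omega⟩
    obtain ⟨h₁, h₂⟩ := h q hq x hx₁ hx₂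
    have h₃ : σ'.mem .C (q * m + x) = 1 ↔ IsOccurrence rel P T (q * m + x) :=
      h₂.trans (and_iff_right ⟨hx₁, hx₂, him⟩)
    refine ⟨h₃, ?_⟩
    rw [← h₃]
    omega
  · have h₁ : L + 1 ≤ (L + 1) ^ 3 := Nat.le_self_pow (by norm_num) _
    have h₂ := Nat.mul_le_mul_right (Xt + 1) h₁
    have h₃ : 1 ≤ (L + 1) * (Xt + 1) := Nat.succ_le_of_lt (by positivity)
    simp [Cmd.cost]
    nlinarith
  · have h₁ : L + 1 ≤ (L + 1) ^ 2 := Nat.le_self_pow (by norm_num) _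
    have h₂ := Nat.mul_le_mul_right (Xw + 1) h₁
    have h₃ : 1 ≤ (L + 1) * (Xw + 1) := Nat.succ_le_of_lt (by positivity)
    have h₄ : (Q + 1) * 2 ≤ (Q + 1) * m := Nat.mul_le_mul_left _ hP
    have h₅ := Nat.mul_le_mul_left ((Q + 1) * m) h₂
    have h₆ := Nat.mul_le_mul_left ((Q + 1) * m) h₃
    simp [Cmd.cost, card_pieces]
    nlinarith

end Machine

end DuelSweep

theorem mainTheorem1 (K : ℕ) :
    ∃ c : ℝ, ∀ {α : Type*} {β : Type*} (rel : List α → List α → Prop) (f : List α → List β)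
      (P T : List α) (ξt ξw : ℕ → ℕ) (σ : DuelSweep.State β),
      DuelSweep.IsSCER rel → DuelSweep.IsEncoding rel f →
      2 ≤ P.length → P.length ≤ T.length →
      1 ≤ ξt P.length → 1 ≤ ξw P.length →
      (∀ l, P.length ≤ l → l ≤ 2 * P.length - 1 →
        ξt l ≤ K * ξt P.length ∧ ξw l ≤ K * ξw P.length) →
      DuelSweep.IsWitnessTable f P (σ.mem .W) →
      σ.reg [] .n = T.length → σ.reg [] .m = P.length →
      ∃ (σ' : DuelSweep.State β) (time work : ℕ),
        DuelSweep.Exec (DuelSweep.searchInput f ξt ξw P T) DuelSweep.patternSearch {[]} σ σ'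
          time work ∧
        (∀ i, 1 ≤ i → i + P.length ≤ T.length + 1 →
          (σ'.mem .C i = 1 ↔ DuelSweep.IsOccurrence rel P T i) ∧
          (σ'.mem .C i = 0 ↔ ¬ DuelSweep.IsOccurrence rel P T i)) ∧
        (time : ℝ) ≤ c * (ξt P.length * Real.log P.length ^ 3) ∧
        (work : ℝ) ≤ c * (ξw P.length * T.length * Real.log P.length ^ 2) := by
  -- The time requires `1200 * 5 ^ 3 = 150000`, which also covers the work, `2 * 1600 * 5 ^ 2 =
  -- 80000`; the factor `K + 1` absorbs `K * ξ + 1` because `ξ ≥ 1`.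
  refine ⟨150000 * (K + 1), fun {α β} rel f P T ξt ξw σ hrel hf hP hPT hξt hξw hK hW hn hm => ?_⟩
  obtain ⟨σ', t, w, he, ht, hw, h⟩ := DuelSweep.patternSearch_runs (ξt := ξt) (ξw := ξw)
    (Xt := K * ξt P.length) (Xw := K * ξw P.length) hrel hf hP
    (fun l h₁ h₂ => (hK l h₁ h₂).1) (fun l h₁ h₂ => (hK l h₁ h₂).2) hW hn hm
  have hlog := DuelSweep.clog_succ_le_log hP
  set L := Nat.clog 2 P.length
  have hX : ∀ {x : ℕ}, 1 ≤ x → ((K * x + 1 : ℕ) : ℝ) ≤ (K + 1) * x := by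
    intro x hx
    have : (1 : ℝ) ≤ x := by exact_mod_cast hx
    push_cast
    linarith
  refine ⟨σ', t, w, he, h, ?_, ?_⟩
  · calc (t : ℝ) ≤ (1200 * (L + 1) ^ 3 * (K * ξt P.length + 1) : ℕ) := by exact_mod_cast ht
      _ = 1200 * ((L + 1 : ℕ) : ℝ) ^ 3 * ((K * ξt P.length + 1 : ℕ) : ℝ) := by push_cast; ring
      _ ≤ 1200 * (5 * Real.log P.length) ^ 3 * ((K + 1) * ξt P.length) := by
        gcongr
        exact hX hξt
      _ = _ := by ring
  -- The last piece may start close to the end of the text, which costs at most another `m ≤ n`.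
  · have hQ : (((T.length - 1) / P.length + 1) * P.length : ℕ) ≤ 2 * T.length := by
      have := Nat.div_mul_le_self (T.length - 1) P.length
      rw [add_mul, one_mul]
      omega
    calc (w : ℝ) ≤ (((T.length - 1) / P.length + 1) * P.length *
          (1600 * (L + 1) ^ 2 * (K * ξw P.length + 1)) : ℕ) := by exact_mod_cast hw
      _ ≤ (2 * T.length * (1600 * (L + 1) ^ 2 * (K * ξw P.length + 1)) : ℕ) := by
        exact_mod_cast Nat.mul_le_mul_right _ hQ
      _ = 2 * T.length * (1600 * ((L + 1 : ℕ) : ℝ) ^ 2 * ((K * ξw P.length + 1 : ℕ) : ℝ)) := by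
        push_cast; ring
      _ ≤ 2 * T.length * (1600 * (5 * Real.log P.length) ^ 2 * ((K + 1) * ξw P.length)) := by
        gcongr
        exact hX hξw
      _ = 80000 * (K + 1) * (ξw P.length * T.length * Real.log P.length ^ 2) := by ring
      _ ≤ _ := by
        gcongr
        norm_num
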